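/- **Setting.** Let $\mathcal H$ be a separable real or complex Hilbert space (of finite or infinite dimension) with orthonormal basis $(e_j)_{j\ge1}$. Let $p\ge 1$, let $\Theta\subset\mathbb R^p$ be compact and $\theta_0$ an interior point of $\Theta$. Let $(K_\theta)_{\theta\in\Theta}$ be real-valued covariance functions on $\mathcal H$, let $Y$ be a centred real Gaussian process indexed by $\mathcal H$ with covariance function $K_{\theta_0}$, and let $(f_i)_{1\le i\le n}=(f_i^n)_{1\le i\le n}$, $n\ge1$, be a deterministic triangular array in $\mathcal H$. Put $y=(Y(f_1),\dots,Y(f_n))^\top$, $R_\theta=(K_\theta(f_i,f_j))_{1\le i,j\le n}$, and let $\widehat\theta_n\in\Theta$ be a measurable minimiser over $\Theta$ of $\mathcal L_n(\theta)=\frac1n\ln|R_\theta|+\frac1n y^\top R_\theta^{-1}y$. Below, "$a\lesssim b$" means $a\le Cb$ with a constant $C$ independent of $h\in\mathcal H$ and of $\theta$. **Conditions.** 1. There is $\Delta>0$ with $\|f_i^n-f_j^n\|\ge 2\Delta$ for all $n$ and all $1\le i\ne j\le n$. 2. There are $J_0$ and $s_j\ge0$ ($j\ge J_0$) with $\sum_{j\ge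 J_0}s_j^2<\infty$ and $|\langle f_i^n,e_j\rangle|\le s_j$ for all $n$, $1\le i\le n$ and $j\ge J_0$. Write $f_{i,d}=\sum_{j\le d}\langle f_i,e_j\rangle e_j$ and fix an integer $d_0\ge J_0$ such that $\|f_{j,d_0}-f_{i,d_0}\|\ge\Delta$ for all $n$ and $1\le i\neq j\le n$, and $\sum_{k>d_0}s_k^2<\Delta^2/16$. Let $D_0$ be the number of real coordinates of the truncations $f_{i,d_0}$: $D_0=d_0$ if $\mathcal H$ is real and $D_0=2d_0$ if $\mathcal H$ is complex. 3. The kernels are stationary, $K_\theta(g,h)=K_\theta(g-h)$, and for some $\gamma_0>D_0$, $\sup_{\theta\in\Theta}|K_\theta(h)|\lesssim 1/(1+\|h\|^{\gamma_0})$ for all $h\in\mathcal H$. 4. There is $c>0$ with $\lambda_{\min}(R_\theta)\ge c$ for all $\theta\in\Theta$ and all $n$. 5. For all $\alpha>0$, $\displaystyle\liminf_{n\to\infty}\ \inf_{\theta\in\Theta,\ \|\theta-\theta_0\|\ge\alpha}\ \frac1n\sum_{i,j=1}^n\big(K_\theta(f_i,f_j)-K_{\theta_0}(f_i,f_j)\big)^2>0$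 (with $\inf\emptyset=+\infty$). 6. For all $(\lambda_1,\dots,\lambda_p)\ne0$, $\displaystyle\liminf_{n\to\infty}\frac1n\sum_{i,j=1}^n\Big(\sum_{k=1}^p\lambda_k\frac{\partial K_\theta}{\partial\theta_k}\Big|_{\theta=\theta_0}(f_i,f_j)\Big)^2>0$. 7. There are an open set $U\supset\Theta$, a set $V\subset U$ and $\delta>0$ such that $V$ contains the segment between any two points of $\Theta$ at distance less than $\delta$ (for instance $V=\Theta$ if $\Theta$ is convex, or $V=U$ with $\delta$ small), and such that, for every $h\in\mathcal H$, $\theta\mapsto K_\theta(h)$ is (the restriction to $\Theta$ of) a continuously differentiable function on $U$, with, for some $\gamma_1>D_0$, $\sup_{\theta\in V}\max_{i}\left|\frac{\partial K_\theta}{\partial\theta_i}(h)\right|\lesssim 1/(1+\|h\|^{\gamma_1})$ for all $h\in\mathcal H$. 8. For every $h\in\mathcal H$, $\theta\mapsto K_\theta(h)$ is three times continuously differentiable on $U$ and, for some $\gamma_2>D_0$, all $q\in\{2,3\}$ and all $i_1,\dots,i_q\in\{1,\dots,p\}$, $\sup_{\theta\in\Theta}\left|\frac{\partial^qK_\theta}{\partial\theta_{i_1}\cdots\partial\theta_{i_q}}(h)\right|\lesssim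 1/(1+\|h\|^{\gamma_2})$ for all $h\in\mathcal H$. **Theorem.** Suppose that Conditions 1–8 hold, and let $M_n$ be the $p\times p$ matrix $$(M_n)_{i,j}=\frac1{2n}\operatorname{tr}\Big(R_{\theta_0}^{-1}\frac{\partial R}{\partial\theta_i}(\theta_0)R_{\theta_0}^{-1}\frac{\partial R}{\partial\theta_j}(\theta_0)\Big).$$ Then $\sqrt n\,M_n^{1/2}(\widehat\theta_n-\theta_0)$ converges in law to $\mathcal N(0,I_p)$ as $n\to\infty$, and $$0<\liminf_{n\to\infty}\lambda_{\min}(M_n)\le\limsup_{n\to\infty}\lambda_{\max}(M_n)<\infty .$$ -/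

import Mathlib

open MeasureTheory ProbabilityTheory Filter Topology Matrix

noncomputable section

namespace GPML

/-! ### The Hilbert space of inputs and the design points -/

/-- Index set `{1, …, N}` (if `N` is finite) or `{1, 2, …}` (if `N = ∞`) of an orthonormal basis
`e₁, e₂, …` of a separable Hilbert space, which may be of finite or infinite dimension. -/
abbrev BasisIndex (N : ℕ∞) : Type := {j : ℕ // 1 ≤ j ∧ (j : ℕ∞) ≤ N}

section Design

variable {𝕜 H : Type*} [RCLike 𝕜] [NormedAddCommGroup H] [InnerProductSpace 𝕜 H]

/-- A triangular array of inputs: `f n i` for `i = 1, …, n` is `fᵢⁿ`. It is separated by `2 Δ`. -/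
def Separated (f : (n : ℕ) → Fin n → H) (Δ : ℝ) : Prop :=
  ∀ n, ∀ i j : Fin n, i ≠ j → 2 * Δ ≤ ‖f n i - f n j‖

open Classical in
/-- The truncated expansion `∑_{j ≤ d} ⟨x, eⱼ⟩ eⱼ`. -/
def basisTruncation {N : ℕ∞} (e : HilbertBasis (BasisIndex N) 𝕜 H) (d : ℕ) (x : H) : H :=
  ∑ j ∈ (Finset.Icc 1 d).subtype (fun j : ℕ => 1 ≤ j ∧ (j : ℕ∞) ≤ N), (inner 𝕜 (e j) x : 𝕜) • e j

/-- Uniform square-summable control, by a sequence `(sⱼ)_{j ≥ J₀}`, of the coordinates of the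
inputs in the orthonormal basis `e`. -/
structure UniformCoordinateBound {N : ℕ∞} (e : HilbertBasis (BasisIndex N) 𝕜 H)
    (f : (n : ℕ) → Fin n → H) (J₀ : ℕ) (s : ℕ → ℝ) : Prop where
  nonneg : ∀ j, J₀ ≤ j → 0 ≤ s j
  bound : ∀ n, ∀ i : Fin n, ∀ j : BasisIndex N, J₀ ≤ (j : ℕ) → ‖(inner 𝕜 (e j) (f n i) : 𝕜)‖ ≤ s j
  summable : Summable fun j : ℕ => s (J₀ + j) ^ 2

/-- `d₀` is an approximation order for which the truncated inputs stay separated, with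
`∑_{k > d₀} s_k² < Δ² / 16`. -/
structure IsApproximationOrder {N : ℕ∞} (e : HilbertBasis (BasisIndex N) 𝕜 H)
    (f : (n : ℕ) → Fin n → H) (Δ : ℝ) (J₀ : ℕ) (s : ℕ → ℝ) (d₀ : ℕ) : Prop where
  le : J₀ ≤ d₀
  separated : ∀ n, ∀ i j : Fin n, i ≠ j →
    Δ ≤ ‖basisTruncation e d₀ (f n j) - basisTruncation e d₀ (f n i)‖
  tail : ∑' k : ℕ, s (d₀ + 1 + k) ^ 2 < Δ ^ 2 / 16

end Design

/-! ### Covariance functions, matrices, likelihood -/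

/-- `C` is a (real-valued) covariance function on `H`: all the matrices `(C (xᵢ, xⱼ))` are
symmetric positive semi-definite. -/
def IsCovarianceFunction {H : Type*} (C : H → H → ℝ) : Prop :=
  ∀ (m : ℕ) (x : Fin m → H), (Matrix.of fun i j => C (x i) (x j)).PosSemidef

/-- The partial derivative `∂g/∂θᵢ (θ)`. -/
def pderiv {p : ℕ} (i : Fin p) (g : EuclideanSpace ℝ (Fin p) → ℝ)
    (θ : EuclideanSpace ℝ (Fin p)) : ℝ :=
  fderiv ℝ g θ (EuclideanSpace.single i 1)

/-- `sup_{θ ∈ V} |g_θ(h)| ≤ C / (1 + ‖h‖ ^ γ)` for all `h`, with some constant `C`. -/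
def DecaysUniformly {E H : Type*} [NormedAddCommGroup H] (g : E → H → ℝ) (V : Set E) (γ : ℝ) :
    Prop :=
  ∃ C : ℝ, 0 < C ∧ ∀ θ ∈ V, ∀ h : H, |g θ h| ≤ C / (1 + ‖h‖ ^ γ)

/-- The smallest eigenvalue of a real symmetric matrix (`⊤` for the empty matrix). -/
def lambdaMin {m : ℕ} (A : Matrix (Fin m) (Fin m) ℝ) : EReal := ⨅ μ ∈ spectrum ℝ A, (μ : EReal)

/-- The largest eigenvalue of a real symmetric matrix (`⊥` for the empty matrix). -/
def lambdaMax {m : ℕ} (A : Matrix (Fin m) (Fin m) ℝ) : EReal := ⨆ μ ∈ spectrum ℝ A, (μ : EReal)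

section Model

variable {p : ℕ} {H : Type*} (K : EuclideanSpace ℝ (Fin p) → H → H → ℝ)
  (f : (n : ℕ) → Fin n → H)

/-- The covariance matrix `R_θ = (K_θ(fᵢ, fⱼ))_{1 ≤ i, j ≤ n}`. -/
def covMatrix (n : ℕ) (θ : EuclideanSpace ℝ (Fin p)) : Matrix (Fin n) (Fin n) ℝ :=
  Matrix.of fun a b => K θ (f n a) (f n b)

/-- The entrywise partial derivative `∂R/∂θᵢ (θ)` of the covariance matrix. -/
def dcovMatrix (n : ℕ) (i : Fin p) (θ : EuclideanSpace ℝ (Fin p)) : Matrix (Fin n) (Fin n) ℝ :=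
  Matrix.of fun a b => pderiv i (fun θ' => K θ' (f n a) (f n b)) θ

/-- The modified negative log-likelihood
`L_n(θ) = (1/n) ln |R_θ| + (1/n) yᵀ R_θ⁻¹ y` of the observation vector `y`. -/
def negLogLik (n : ℕ) (y : Fin n → ℝ) (θ : EuclideanSpace ℝ (Fin p)) : ℝ :=
  (1 / (n : ℝ)) * Real.log (covMatrix K f n θ).det
    + (1 / (n : ℝ)) * (y ⬝ᵥ ((covMatrix K f n θ)⁻¹ *ᵥ y))

/-- The matrix `M_n`, with entries
`(1 / 2n) tr (R⁻¹ (∂R/∂θᵢ) R⁻¹ (∂R/∂θⱼ))` at the parameter `θ`. -/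
def infoMatrix (θ : EuclideanSpace ℝ (Fin p)) (n : ℕ) : Matrix (Fin p) (Fin p) ℝ :=
  Matrix.of fun i j => (1 / (2 * (n : ℝ))) *
    ((covMatrix K f n θ)⁻¹ * dcovMatrix K f n i θ *
      (covMatrix K f n θ)⁻¹ * dcovMatrix K f n j θ).trace

/-- Global asymptotic separation of the true parameter `θ₀` from the other ones. -/
def AsymptoticallySeparates (Θ : Set (EuclideanSpace ℝ (Fin p)))
    (θ₀ : EuclideanSpace ℝ (Fin p)) : Prop :=
  ∀ α : ℝ, 0 < α → (0 : EReal) < liminf (fun n : ℕ =>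
    ⨅ θ ∈ {θ ∈ Θ | α ≤ ‖θ - θ₀‖},
      (((1 / (n : ℝ)) *
        ∑ i, ∑ j, (K θ (f n i) (f n j) - K θ₀ (f n i) (f n j)) ^ 2 : ℝ) : EReal)) atTop

/-- Asymptotic linear independence of the partial derivatives of the kernel at `θ₀`. -/
def AsymptoticallyIndependentDerivatives (θ₀ : EuclideanSpace ℝ (Fin p)) : Prop :=
  ∀ l : Fin p → ℝ, l ≠ 0 → (0 : EReal) < liminf (fun n : ℕ =>
    (((1 / (n : ℝ)) * ∑ i, ∑ j,
      (∑ k, l k * pderiv k (fun θ => K θ (f n i) (f n j)) θ₀) ^ 2 : ℝ) : EReal)) atTop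

end Model

/-! ### The Gaussian process and the estimator -/

/-- `Y` is a real Gaussian process with zero mean and covariance function `C`. -/
structure IsCenteredGP {H Ω : Type*} [MeasurableSpace Ω] (Y : H → Ω → ℝ) (P : Measure Ω)
    (C : H → H → ℝ) : Prop where
  gaussian : IsGaussianProcess Y P
  mean : ∀ h, P[Y h] = 0
  covariance : ∀ g h, cov[Y g, Y h; P] = C g h

/-- `θhat n` is a (measurable) maximum likelihood estimator from the observations
`Y(f₁), …, Y(fₙ)`, i.e. almost surely a minimiser of `L_n` over `Θ`. -/
structure IsMLE {p : ℕ} {H Ω : Type*} [MeasurableSpace Ω]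
    (K : EuclideanSpace ℝ (Fin p) → H → H → ℝ) (f : (n : ℕ) → Fin n → H)
    (Y : H → Ω → ℝ) (P : Measure Ω) (Θ : Set (EuclideanSpace ℝ (Fin p)))
    (θhat : ℕ → Ω → EuclideanSpace ℝ (Fin p)) : Prop where
  aemeasurable : ∀ n, AEMeasurable (θhat n) P
  mem : ∀ n, 1 ≤ n → ∀ᵐ ω ∂P, θhat n ω ∈ Θ
  isMinOn : ∀ n, 1 ≤ n → ∀ᵐ ω ∂P,
    IsMinOn (negLogLik K f n (fun i => Y (f n i) ω)) Θ (θhat n ω)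

end GPML

end

/-! A kernel that decays faster than the real dimension of the truncated inputs, summed over points
whose truncations are separated, has row sums bounded uniformly in n, by a packing argument. Schur's
test then bounds the operator norms of the covariance matrices and of their θ-derivatives uniformly
in n, and the lower bound on the eigenvalues does the same for the inverses. `exists_regularModel`
collects these facts in `RegularModel`. After that the Hilbert space no longer plays a role:
everything is matrix analysis in operator norm, plus concentration.

The probabilistic input is that (1/n)(yᵀAy − tr(A R)), with R the true covariance and ‖A‖ bounded,
has variance O(1/n), because diagonalisation turns yᵀAy into a weighted sum of independent
chi-squares. For consistency, L_n(θ) − L_n(θ₀) is a normalised Kullback-Leibler divergence plus such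
a deviation. The divergence dominates the squared Frobenius distance of the covariance matrices
(`frobSq_le_kullback`), which global separation keeps of order n away from θ₀. A finite net and a
Lipschitz bound make the estimate uniform in θ (`highProb_norm_sub_lt`).

Near θ₀, deterministic expansions of log det and of the inverse (`abs_nll_expansion_le`) give L_n(θ₀
+ t) − L_n(θ₀) = −t·g + tᵀM_n t up to η‖t‖², where the entries of g are centred quadratic forms in
y. Independence of the derivatives and compactness of the sphere make M_n uniformly positive.
Comparing the values of L_n at the estimator and at θ₀ + z, where z = M_n⁻¹g/2 minimises the
quadratic, yields ‖θhat − θ₀ − z‖² ≤ η‖z‖² (`highProb_norm_sub_oneStep_le`). No likelihood equation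
is solved and no measurability of a supremum is needed.

Finally, √n M_n^{1/2} z tested against a vector u is one centred quadratic form in y, with variance
‖u‖² and spectral coefficients O(n^{-1/2}). The central limit theorem for weighted chi-squares
(`tendsto_integral_exp_quadForm`) gives its Gaussian limit, and Slutsky's lemma passes from z to
θhat − θ₀. -/

namespace GPML

set_option linter.unusedSectionVars false

/-! ### Operator norm, trace and Frobenius norm of real matrices. -/

section MatrixLemmas

open scoped Matrix.Norms.L2Operator MatrixOrder

variable {ι : Type*} [Fintype ι] [DecidableEq ι]

/-- The squared Frobenius norm. -/
noncomputable def frobSq (A : Matrix ι ι ℝ) : ℝ := ∑ i, ∑ j, A i j ^ 2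

theorem dotProduct_self_eq_norm_sq (x : ι → ℝ) : x ⬝ᵥ x = ‖WithLp.toLp 2 x‖ ^ 2 := by
  rw [EuclideanSpace.real_norm_sq_eq]
  simp [dotProduct, sq]

theorem dotProduct_self_nonneg' (x : ι → ℝ) : 0 ≤ x ⬝ᵥ x := by
  rw [dotProduct_self_eq_norm_sq]; positivity

theorem norm_toLp_mulVec_le (A : Matrix ι ι ℝ) (x : ι → ℝ) :
    ‖WithLp.toLp 2 (A *ᵥ x)‖ ≤ ‖A‖ * ‖WithLp.toLp 2 x‖ :=
  A.l2_opNorm_mulVec (WithLp.toLp 2 x)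

theorem abs_dotProduct_mulVec_le (A : Matrix ι ι ℝ) (x y : ι → ℝ) :
    |x ⬝ᵥ A *ᵥ y| ≤ ‖A‖ * (‖WithLp.toLp 2 x‖ * ‖WithLp.toLp 2 y‖) := by
  have h := abs_real_inner_le_norm (WithLp.toLp 2 x) (WithLp.toLp 2 (A *ᵥ y))
  have e : inner ℝ (WithLp.toLp 2 x) (WithLp.toLp 2 (A *ᵥ y)) = x ⬝ᵥ A *ᵥ y := by
    simp [PiLp.inner_apply, dotProduct, mul_comm]
  rw [e] at h
  refine h.trans ?_
  have := norm_toLp_mulVec_le A y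
  calc _ ≤ ‖WithLp.toLp 2 x‖ * (‖A‖ * ‖WithLp.toLp 2 y‖) := by gcongr
    _ = _ := by ring

theorem abs_quadForm_le (A : Matrix ι ι ℝ) (x : ι → ℝ) :
    |x ⬝ᵥ A *ᵥ x| ≤ ‖A‖ * (x ⬝ᵥ x) := by
  rw [dotProduct_self_eq_norm_sq, sq]
  exact abs_dotProduct_mulVec_le A x x

theorem norm_transpose_eq (A : Matrix ι ι ℝ) : ‖Aᵀ‖ = ‖A‖ := by
  rw [← conjTranspose_eq_transpose_of_trivial, l2_opNorm_conjTranspose]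

theorem abs_diag_le (A : Matrix ι ι ℝ) (i : ι) : |A i i| ≤ ‖A‖ := by
  have h := abs_quadForm_le A (Pi.single i 1)
  simpa using h

theorem abs_trace_le (A : Matrix ι ι ℝ) : |A.trace| ≤ Fintype.card ι * ‖A‖ := by
  unfold Matrix.trace
  refine (Finset.abs_sum_le_sum_abs _ _).trans ?_
  refine (Finset.sum_le_sum fun i _ => abs_diag_le A i).trans ?_
  simp

/-- Schur test for symmetric matrices. -/
theorem norm_le_of_rowSum {A : Matrix ι ι ℝ} (hA : A.IsHermitian) {C : ℝ} (hC : 0 ≤ C)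
    (h : ∀ i, ∑ j, |A i j| ≤ C) : ‖A‖ ≤ C := by
  have hs : ∀ i j, A j i = A i j := fun i j => by simpa using hA.apply i j
  have hq : ∀ x y : ι → ℝ, |x ⬝ᵥ A *ᵥ y| ≤ C * ((x ⬝ᵥ x + y ⬝ᵥ y) / 2) := by
    intro x y
    have h1 : ∑ i, ∑ j, |A i j| * (x i ^ 2) ≤ C * (x ⬝ᵥ x) := by
      simp only [← Finset.sum_mul, dotProduct, Finset.mul_sum, ← sq]
      exact Finset.sum_le_sum fun i _ => mul_le_mul_of_nonneg_right (h i) (sq_nonneg _)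
    have h2 : ∑ i, ∑ j, |A i j| * (y j ^ 2) ≤ C * (y ⬝ᵥ y) := by
      rw [Finset.sum_comm]
      simp only [← Finset.sum_mul, dotProduct, Finset.mul_sum, ← sq]
      refine Finset.sum_le_sum fun i _ => mul_le_mul_of_nonneg_right ?_ (sq_nonneg _)
      simpa only [hs i] using h i
    -- Arithmetic-geometric mean inequality with weights |A i j|: the x part sees row sums, the y
    -- part column sums, and symmetry makes these equal.
    have h3 : |x ⬝ᵥ A *ᵥ y| ≤ ∑ i, ∑ j, (|A i j| * x i ^ 2 + |A i j| * y j ^ 2) / 2 := by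
      simp only [dotProduct, mulVec, Finset.mul_sum]
      refine (Finset.abs_sum_le_sum_abs _ _).trans (Finset.sum_le_sum fun i _ => ?_)
      refine (Finset.abs_sum_le_sum_abs _ _).trans (Finset.sum_le_sum fun j _ => ?_)
      rw [abs_mul, abs_mul]
      have := two_mul_le_add_sq |x i| |y j|
      rw [sq_abs, sq_abs] at this
      nlinarith [abs_nonneg (A i j)]
    refine h3.trans ?_
    simp only [← Finset.sum_div, Finset.sum_add_distrib]
    linarith
  rw [cstar_norm_def]
  refine ContinuousLinearMap.opNorm_le_of_re_inner_le hC ?_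
  intro x y hx hy
  have := hq y.ofLp x.ofLp
  rw [dotProduct_self_eq_norm_sq, dotProduct_self_eq_norm_sq] at this
  simp only [WithLp.toLp_ofLp, hx, hy] at this
  rw [real_inner_comm, inner_toEuclideanCLM]
  simpa using (le_abs_self _).trans this

/-- Orthogonal diagonalisation of a real symmetric matrix. -/
theorem exists_orthogonal_diagonal {X : Matrix ι ι ℝ} (hX : X.IsHermitian) :
    ∃ (U : Matrix ι ι ℝ) (d : ι → ℝ), Uᵀ * U = 1 ∧ U * Uᵀ = 1 ∧ X = U * diagonal d * Uᵀ ∧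
      ∀ i, |d i| ≤ ‖X‖ := by
  refine ⟨hX.eigenvectorUnitary, hX.eigenvalues, ?_, ?_, ?_, ?_⟩
  · have := (Unitary.mem_iff.1 hX.eigenvectorUnitary.2).1
    rwa [star_eq_conjTranspose, conjTranspose_eq_transpose_of_trivial] at this
  · have := (Unitary.mem_iff.1 hX.eigenvectorUnitary.2).2
    rwa [star_eq_conjTranspose, conjTranspose_eq_transpose_of_trivial] at this
  · have := hX.spectral_theorem
    rw [Unitary.conjStarAlgAut_apply, star_eq_conjTranspose,
      conjTranspose_eq_transpose_of_trivial] at this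
    exact this
  · intro i
    exact spectrum.norm_le_norm_mul_of_mem (hX.eigenvalues_mem_spectrum_real i) |>.trans (by
      rcases isEmpty_or_nonempty ι with h | h
      · exact (h.false i).elim
      · rw [norm_one, mul_one])

theorem exists_symm_mul_self_eq {A : Matrix ι ι ℝ} (hA : A.PosSemidef) :
    ∃ S : Matrix ι ι ℝ, S.IsHermitian ∧ S * S = A :=
  ⟨CFC.sqrt A, (CFC.sqrt_nonneg A).isSelfAdjoint, CFC.sqrt_mul_sqrt_self A hA.nonneg⟩

theorem norm_mul_self_of_isHermitian {S : Matrix ι ι ℝ} (hS : S.IsHermitian) :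
    ‖S * S‖ = ‖S‖ * ‖S‖ := by
  have := l2_opNorm_conjTranspose_mul_self S
  rwa [hS.eq] at this

theorem frobSq_eq_trace (A : Matrix ι ι ℝ) : frobSq A = (Aᵀ * A).trace := by
  simp only [frobSq, Matrix.trace, diag_apply, mul_apply, transpose_apply, sq]
  rw [Finset.sum_comm]

theorem frobSq_nonneg (A : Matrix ι ι ℝ) : 0 ≤ frobSq A :=
  Finset.sum_nonneg fun _ _ => Finset.sum_nonneg fun _ _ => sq_nonneg _

theorem frobSq_transpose (A : Matrix ι ι ℝ) : frobSq Aᵀ = frobSq A := by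
  simp only [frobSq, transpose_apply]; rw [Finset.sum_comm]

theorem frobSq_mul_le (A B : Matrix ι ι ℝ) : frobSq (A * B) ≤ ‖A‖ ^ 2 * frobSq B := by
  rw [← frobSq_transpose, ← frobSq_transpose B]
  simp only [frobSq, Finset.mul_sum]
  refine Finset.sum_le_sum fun j _ => ?_
  have h := norm_toLp_mulVec_le A (Bᵀ j)
  have h2 := pow_le_pow_left₀ (norm_nonneg _) h 2
  rw [mul_pow, EuclideanSpace.real_norm_sq_eq, EuclideanSpace.real_norm_sq_eq] at h2
  simp only [Finset.mul_sum] at h2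
  exact h2

theorem frobSq_mul_le' (A B : Matrix ι ι ℝ) : frobSq (A * B) ≤ frobSq A * ‖B‖ ^ 2 := by
  rw [← frobSq_transpose, transpose_mul, ← frobSq_transpose A, mul_comm, ← norm_transpose_eq B]
  exact frobSq_mul_le _ _

theorem frobSq_le (A : Matrix ι ι ℝ) : frobSq A ≤ Fintype.card ι * ‖A‖ ^ 2 := by
  rw [frobSq_eq_trace]
  refine (le_abs_self _).trans ((abs_trace_le _).trans ?_)
  refine mul_le_mul_of_nonneg_left ((norm_mul_le _ _).trans ?_) (by positivity)
  rw [norm_transpose_eq, sq]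

/-- Comparison of `tr(P B P B)` with the Frobenius norm of `B`, for `P` positive definite. -/
theorem frobSq_le_mul_trace {A B : Matrix ι ι ℝ} (hA : A.PosDef) (hB : B.IsHermitian) :
    frobSq B ≤ ‖A‖ ^ 2 * (A⁻¹ * B * A⁻¹ * B).trace := by
  obtain ⟨S, hS, hSS⟩ := exists_symm_mul_self_eq hA.posSemidef
  have hSd : IsUnit S.det := by
    have := hA.det_pos
    rw [← hSS, det_mul] at this
    exact isUnit_iff_ne_zero.2 fun h => by simp [h] at this
  have hA' : A⁻¹ = S⁻¹ * S⁻¹ := by rw [← hSS, Matrix.mul_inv_rev]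
  -- With S = A^{1/2} the trace is the squared Frobenius norm of S⁻¹BS⁻¹; undoing the conjugation
  -- costs ‖S‖⁴ = ‖A‖².
  have hBS : S * (S⁻¹ * B * S⁻¹) * S = B := by
    simp only [Matrix.mul_assoc]
    rw [nonsing_inv_mul _ hSd, ← Matrix.mul_assoc, mul_nonsing_inv _ hSd]
    simp
  have hT : (S⁻¹ * B * S⁻¹)ᵀ = S⁻¹ * B * S⁻¹ := by
    have h1 : Sᵀ = S := by simpa using hS.eq
    have h2 : Bᵀ = B := by simpa using hB.eq
    simp only [transpose_mul, transpose_nonsing_inv, h1, h2, Matrix.mul_assoc]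
  have htr : (A⁻¹ * B * A⁻¹ * B).trace = frobSq (S⁻¹ * B * S⁻¹) := by
    rw [frobSq_eq_trace, hT, hA']
    simp only [Matrix.mul_assoc]
    rw [trace_mul_comm]
    simp only [Matrix.mul_assoc]
  rw [htr]
  calc frobSq B = frobSq (S * (S⁻¹ * B * S⁻¹) * S) := by rw [hBS]
    _ ≤ ‖S‖ ^ 2 * frobSq (S⁻¹ * B * S⁻¹) * ‖S‖ ^ 2 :=
      (frobSq_mul_le' _ _).trans (by gcongr; exact frobSq_mul_le _ _)
    _ = (‖S‖ * ‖S‖) ^ 2 * frobSq (S⁻¹ * B * S⁻¹) := by ring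
    _ = _ := by rw [← norm_mul_self_of_isHermitian hS, hSS]

end MatrixLemmas

end GPML

namespace GPML

set_option linter.unusedSectionVars false

/-! ### Comparison of log-determinants through eigenvalues. -/

section LogDet

open scoped Matrix.Norms.L2Operator MatrixOrder

variable {ι : Type*} [Fintype ι] [DecidableEq ι]

theorem trace_conj_diagonal {U : Matrix ι ι ℝ} (hU : Uᵀ * U = 1) (d : ι → ℝ) :
    (U * diagonal d * Uᵀ).trace = ∑ i, d i := by
  rw [trace_mul_comm, ← Matrix.mul_assoc, hU, Matrix.one_mul, trace_diagonal]

theorem conj_diagonal_mul_self {U : Matrix ι ι ℝ} (hU : Uᵀ * U = 1) (d : ι → ℝ) :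
    (U * diagonal d * Uᵀ) * (U * diagonal d * Uᵀ) = U * diagonal (fun i => d i ^ 2) * Uᵀ := by
  have : (U * diagonal d * Uᵀ) * (U * diagonal d * Uᵀ)
      = U * (diagonal d * ((Uᵀ * U) * diagonal d)) * Uᵀ := by simp only [Matrix.mul_assoc]
  rw [this, hU, Matrix.one_mul, diagonal_mul_diagonal]
  simp only [sq]

theorem det_one_add_conj_diagonal {U : Matrix ι ι ℝ} (hU' : U * Uᵀ = 1)
    (d : ι → ℝ) : (1 + U * diagonal d * Uᵀ).det = ∏ i, (1 + d i) := by
  have : 1 + U * diagonal d * Uᵀ = U * diagonal (fun i => 1 + d i) * Uᵀ := by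
    have h : diagonal (fun i => 1 + d i) = 1 + diagonal d := by
      rw [← diagonal_one, diagonal_add]
    rw [h, Matrix.mul_add, Matrix.add_mul, Matrix.mul_one, hU']
  rw [this, det_mul, det_mul, det_diagonal, mul_right_comm, ← det_mul, hU', det_one, one_mul]

/-- Spectral data of a symmetric `X`: trace, trace of the square, determinant of `1 + X`. -/
theorem exists_eigenvalue_data {X : Matrix ι ι ℝ} (hX : X.IsHermitian) :
    ∃ d : ι → ℝ, (∀ i, |d i| ≤ ‖X‖) ∧ X.trace = ∑ i, d i ∧ (X * X).trace = ∑ i, d i ^ 2 ∧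
      (1 + X).det = ∏ i, (1 + d i) ∧ ((1 + X).PosDef → ∀ i, 0 < 1 + d i) ∧
      ∀ i, |1 + d i| ≤ ‖1 + X‖ := by
  obtain ⟨U, d, h1, h2, h3, h4⟩ := exists_orthogonal_diagonal hX
  have e : Uᴴ * (1 + X) * U = 1 + diagonal d := by
    rw [conjTranspose_eq_transpose_of_trivial, h3, Matrix.mul_add, Matrix.mul_one,
      Matrix.add_mul, h1]
    have : Uᵀ * (U * diagonal d * Uᵀ) * U = (Uᵀ * U) * diagonal d * (Uᵀ * U) := by
      simp only [Matrix.mul_assoc]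
    rw [this, h1, Matrix.one_mul, Matrix.mul_one]
  refine ⟨d, h4, ?_, ?_, ?_, ?_, ?_⟩
  · rw [h3, trace_conj_diagonal h1]
  · rw [h3, conj_diagonal_mul_self h1, trace_conj_diagonal h1]
  · rw [h3, det_one_add_conj_diagonal h2]
  · intro hp i
    have hinj : Function.Injective U.mulVec := by
      intro x y hxy
      have := congrArg (Uᵀ *ᵥ ·) hxy
      simpa [mulVec_mulVec, h1] using this
    have := (hp.conjTranspose_mul_mul_same hinj).diag_pos (i := i)
    rw [e] at this
    simpa using this
  · intro i
    have : Nonempty ι := ⟨i⟩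
    have hU : ‖U‖ * ‖U‖ = 1 := by
      rw [← l2_opNorm_conjTranspose_mul_self, conjTranspose_eq_transpose_of_trivial, h1, norm_one]
    have hi := abs_diag_le (Uᴴ * (1 + X) * U) i
    rw [e] at hi
    simp only [Matrix.add_apply, one_apply_eq, diagonal_apply_eq] at hi
    rw [← e] at hi
    calc |1 + d i| ≤ ‖Uᴴ‖ * ‖1 + X‖ * ‖U‖ :=
          hi.trans ((norm_mul_le _ _).trans (by gcongr; exact norm_mul_le _ _))
      _ = ‖U‖ * ‖U‖ * ‖1 + X‖ := by rw [l2_opNorm_conjTranspose]; ring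
      _ = _ := by rw [hU, one_mul]

theorem abs_log_one_add_sub_le {u : ℝ} (hu : |u| ≤ 1 / 2) :
    |Real.log (1 + u) - u + u ^ 2 / 2| ≤ 2 * |u| ^ 3 := by
  have h := Real.abs_log_sub_add_sum_range_le (x := -u) (by rw [abs_neg]; linarith) 2
  simp only [Finset.sum_range_succ, Finset.sum_range_zero, abs_neg, sub_neg_eq_add] at h
  norm_num at h
  have e : Real.log (1 + u) - u + u ^ 2 / 2 = -u + u ^ 2 / 2 + Real.log (1 + u) := by ring
  rw [e]
  refine h.trans ?_
  rw [div_le_iff₀ (by linarith)]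
  have : 0 ≤ |u| ^ 3 := by positivity
  nlinarith

/-- From log v = 2 log √v ≤ 2(√v − 1), the right side is at least (√v − 1)²; then v − 1 = (√v −
1)(√v + 1) with √v ≤ L. -/
theorem sub_log_ge {v L : ℝ} (hv : 0 < v) (hvL : v ≤ L ^ 2) (hL : 0 ≤ L) :
    (v - 1) ^ 2 / (L + 1) ^ 2 ≤ (v - 1) - Real.log v := by
  have hs : 0 < √v := Real.sqrt_pos.2 hv
  have hlog : Real.log v = 2 * Real.log √v := by rw [Real.log_sqrt hv.le]; ring
  have h1 := Real.log_le_sub_one_of_pos hs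
  have h2 : √v ≤ L := (Real.sqrt_le_left hL).2 hvL
  have h3 : √v ^ 2 = v := Real.sq_sqrt hv.le
  have h4 : (√v - 1) ^ 2 ≤ (v - 1) - Real.log v := by nlinarith
  refine le_trans ?_ h4
  rw [div_le_iff₀ (by positivity)]
  have h5 : (v - 1) ^ 2 = (√v - 1) ^ 2 * (√v + 1) ^ 2 := by
    rw [show v - 1 = (√v - 1) * (√v + 1) by linear_combination -h3]; ring
  rw [h5]
  gcongr

/-- S is A^{-1/2}. Congruence by it turns A into 1 and B into 1 + X with X symmetric, so statements
about log det become scalar inequalities for the eigenvalues of X. -/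
theorem exists_normalizer {A : Matrix ι ι ℝ} (hA : A.PosDef) :
    ∃ S : Matrix ι ι ℝ, S.IsHermitian ∧ S * S = A⁻¹ ∧ S * A * S = 1 ∧ IsUnit S.det := by
  obtain ⟨S, hS, hSS⟩ := exists_symm_mul_self_eq hA.inv.posSemidef
  have hAu : IsUnit A.det := isUnit_iff_ne_zero.2 hA.det_pos.ne'
  have hSd : IsUnit S.det := by
    have := hA.inv.det_pos
    rw [← hSS, det_mul] at this
    exact isUnit_iff_ne_zero.2 fun h => by simp [h] at this
  refine ⟨S, hS, hSS, ?_, hSd⟩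
  have h1 : S * (S * A) = 1 := by rw [← Matrix.mul_assoc, hSS, nonsing_inv_mul _ hAu]
  exact mul_eq_one_comm.1 h1

/-- For `S² = A⁻¹` and `X = S (B - A) S`: the basic facts on `X`. -/
theorem normalized_difference {A B : Matrix ι ι ℝ} (hA : A.PosDef) (hB : B.PosDef) :
    ∃ X : Matrix ι ι ℝ, X.IsHermitian ∧ (1 + X).PosDef ∧
      Real.log (1 + X).det = Real.log B.det - Real.log A.det ∧
      X.trace = (A⁻¹ * (B - A)).trace ∧
      (X * X).trace = (A⁻¹ * (B - A) * A⁻¹ * (B - A)).trace ∧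
      ‖X‖ ≤ ‖A⁻¹‖ * ‖B - A‖ ∧ ‖1 + X‖ ≤ ‖A⁻¹‖ * ‖B‖ := by
  obtain ⟨S, hS, hSS, hSA, hSd⟩ := exists_normalizer hA
  have hnS : ‖S‖ * ‖S‖ = ‖A⁻¹‖ := by rw [← norm_mul_self_of_isHermitian hS, hSS]
  have h1X : 1 + S * (B - A) * S = S * B * S := by
    rw [Matrix.mul_sub, Matrix.sub_mul, hSA]; abel
  have hinj : Function.Injective S.mulVec := by
    exact mulVec_injective_iff_isUnit.2 ((isUnit_iff_isUnit_det S).2 hSd)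
  have hpd : (S * B * S).PosDef := by
    have := hB.conjTranspose_mul_mul_same hinj
    rwa [hS.eq] at this
  have hnorm : ∀ D : Matrix ι ι ℝ, ‖S * D * S‖ ≤ ‖A⁻¹‖ * ‖D‖ := fun D => by
    calc ‖S * D * S‖ ≤ ‖S‖ * ‖D‖ * ‖S‖ :=
          (norm_mul_le _ _).trans (by gcongr; exact norm_mul_le _ _)
      _ = ‖A⁻¹‖ * ‖D‖ := by rw [← hnS]; ring
  refine ⟨S * (B - A) * S, ?_, h1X ▸ hpd, ?_, ?_, ?_, hnorm _, h1X ▸ hnorm _⟩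
  · have hd : (B - A).IsHermitian := hB.1.sub hA.1
    simp only [IsHermitian, conjTranspose_mul, hS.eq, hd.eq, Matrix.mul_assoc]
  · rw [h1X, det_mul, det_mul, ← Real.log_div hB.det_pos.ne' hA.det_pos.ne']
    congr 1
    have := congrArg det hSA
    rw [det_mul, det_mul, det_one] at this
    rw [eq_div_iff hA.det_pos.ne']
    linear_combination B.det * this
  · rw [trace_mul_comm, ← Matrix.mul_assoc, hSS]
  · rw [← hSS]
    simp only [Matrix.mul_assoc]
    rw [trace_mul_comm]
    simp only [Matrix.mul_assoc]
    rw [trace_mul_comm (B - A)]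
    simp only [Matrix.mul_assoc]

/-- Third-order expansion of `log det`. -/
theorem abs_logdet_expansion_le {A B : Matrix ι ι ℝ} (hA : A.PosDef) (hB : B.PosDef)
    (h : ‖A⁻¹‖ * ‖B - A‖ ≤ 1 / 2) :
    |Real.log B.det - Real.log A.det - (A⁻¹ * (B - A)).trace
        + (A⁻¹ * (B - A) * A⁻¹ * (B - A)).trace / 2|
      ≤ 2 * Fintype.card ι * (‖A⁻¹‖ * ‖B - A‖) ^ 3 := by
  obtain ⟨X, hX, hp, hdet, htr, htr2, hn, -⟩ := normalized_difference hA hB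
  obtain ⟨d, hd, h1, h2, h3, h4, -⟩ := exists_eigenvalue_data hX
  rw [← hdet, ← htr, ← htr2, h1, h2, h3, Real.log_prod (fun i _ => (h4 hp i).ne'),
    Finset.sum_div, ← Finset.sum_sub_distrib, ← Finset.sum_add_distrib]
  refine (Finset.abs_sum_le_sum_abs _ _).trans ?_
  have : ∀ i ∈ Finset.univ, |Real.log (1 + d i) - d i + d i ^ 2 / 2|
      ≤ 2 * (‖A⁻¹‖ * ‖B - A‖) ^ 3 := fun i _ => by
    have hi := (hd i).trans hn
    refine (abs_log_one_add_sub_le (hi.trans h)).trans ?_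
    gcongr
  refine (Finset.sum_le_sum this).trans (le_of_eq ?_)
  rw [Finset.sum_const, nsmul_eq_mul, Finset.card_univ]; ring

/-- Lower bound for (twice) the Kullback-Leibler divergence of centred Gaussian vectors. -/
theorem frobSq_le_kullback {A B : Matrix ι ι ℝ} (hA : A.PosDef) (hB : B.PosDef) {C : ℝ}
    (hC : 0 < C) (hAC : ‖A‖ ≤ C) (hBC : ‖B‖ ≤ C) (hAC' : ‖A⁻¹‖ ≤ C) :
    frobSq (B - A) / (C ^ 2 * (C + 1) ^ 2) ≤
      (A⁻¹ * (B - A)).trace - (Real.log B.det - Real.log A.det) := by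
  obtain ⟨X, hX, hp, hdet, htr, htr2, -, hn⟩ := normalized_difference hA hB
  obtain ⟨d, -, h1, h2, h3, h4, h5⟩ := exists_eigenvalue_data hX
  -- The eigenvalues of 1 + X lie in (0, C²], so `sub_log_ge` applies with L = C. The other factor
  -- C² in the constant is the price of passing from X back to B − A.
  have hn' : ‖1 + X‖ ≤ C ^ 2 := hn.trans (by rw [sq]; gcongr)
  have hd : ∀ i, 1 + d i ≤ C ^ 2 := fun i => (le_abs_self _).trans ((h5 i).trans hn')
  have hF := frobSq_le_mul_trace hA (hB.1.sub hA.1)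
  have hX2 : (X * X).trace / (C + 1) ^ 2 ≤ X.trace - Real.log (1 + X).det := by
    rw [h1, h2, h3, Real.log_prod (fun i _ => (h4 hp i).ne'), ← Finset.sum_sub_distrib,
      Finset.sum_div]
    refine Finset.sum_le_sum fun i _ => ?_
    have := sub_log_ge (h4 hp i) (hd i) hC.le
    simpa using this
  rw [← htr, ← hdet]
  refine le_trans ?_ hX2
  rw [← htr2] at hF
  rw [div_le_div_iff₀ (by positivity) (by positivity)]
  have hnn : 0 ≤ (X * X).trace := by rw [h2]; positivity
  have : frobSq (B - A) ≤ C ^ 2 * (X * X).trace := hF.trans (by gcongr)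
  nlinarith [sq_nonneg (C + 1)]

/-- Concavity of log det: log(1 + d) ≤ d, summed over the eigenvalues. Exchanging A and B gives the
two-sided bound below. -/
theorem logdet_sub_le {A B : Matrix ι ι ℝ} (hA : A.PosDef) (hB : B.PosDef) :
    Real.log B.det - Real.log A.det ≤ Fintype.card ι * (‖A⁻¹‖ * ‖B - A‖) := by
  obtain ⟨X, hX, hp, hdet, htr, -, -, -⟩ := normalized_difference hA hB
  obtain ⟨d, -, h1, -, h3, h4, -⟩ := exists_eigenvalue_data hX
  have : Real.log (1 + X).det ≤ X.trace := by
    rw [h1, h3, Real.log_prod (fun i _ => (h4 hp i).ne')]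
    refine Finset.sum_le_sum fun i _ => ?_
    have := Real.log_le_sub_one_of_pos (h4 hp i)
    linarith
  rw [← hdet]
  refine this.trans ?_
  rw [htr]
  refine (le_abs_self _).trans ((abs_trace_le _).trans ?_)
  gcongr
  exact norm_mul_le _ _

theorem abs_logdet_sub_le {A B : Matrix ι ι ℝ} (hA : A.PosDef) (hB : B.PosDef) {C : ℝ}
    (hAC : ‖A⁻¹‖ ≤ C) (hBC : ‖B⁻¹‖ ≤ C) :
    |Real.log B.det - Real.log A.det| ≤ Fintype.card ι * (C * ‖B - A‖) := by
  rw [abs_le]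
  constructor
  · have := logdet_sub_le hB hA
    rw [norm_sub_rev] at this
    have h2 : (Fintype.card ι : ℝ) * (‖B⁻¹‖ * ‖B - A‖) ≤ Fintype.card ι * (C * ‖B - A‖) := by
      gcongr
    linarith
  · refine (logdet_sub_le hA hB).trans ?_
    gcongr

end LogDet

end GPML

namespace GPML

set_option linter.unusedSectionVars false

/-! ### Moments of the standard Gaussian law up to order four. -/

section GaussianMoments

/-- Each derivative of the moment generating function exp(t²/2) brings down one factor x; four of
them, evaluated at t = 0, give the moments needed. -/
theorem hasDerivAt_integral_pow_mul_exp_gaussianReal (n : ℕ) (t : ℝ) :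
    HasDerivAt (fun t => ∫ x, x ^ n * Real.exp (t * x) ∂gaussianReal 0 1)
      (∫ x, x ^ (n + 1) * Real.exp (t * x) ∂gaussianReal 0 1) t := by
  have := hasDerivAt_integral_pow_mul_exp_real (X := id) (μ := gaussianReal 0 1) (t := t)
    (by rw [integrableExpSet_id_gaussianReal]; simp) n
  simpa using this

theorem integral_exp_mul_gaussianReal (t : ℝ) :
    ∫ x, Real.exp (t * x) ∂gaussianReal 0 1 = Real.exp (t ^ 2 / 2) := by
  have := congrFun (mgf_id_gaussianReal (μ := 0) (v := 1)) t
  simpa [mgf] using this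

/-- The even moments of order two and four of the standard Gaussian law. -/
theorem integral_sq_and_pow_four_gaussianReal :
    ∫ x, x ^ 2 ∂gaussianReal 0 1 = 1 ∧ ∫ x, x ^ 4 ∂gaussianReal 0 1 = 3 := by
  have hE : ∀ t : ℝ, HasDerivAt (fun t : ℝ => Real.exp (t ^ 2 / 2)) (t * Real.exp (t ^ 2 / 2)) t := by
    intro t
    have := ((hasDerivAt_pow 2 t).div_const 2).exp
    convert! this using 1
    simp; ring
  have I0 : ∀ t : ℝ, ∫ x, x ^ 0 * Real.exp (t * x) ∂gaussianReal 0 1 = Real.exp (t ^ 2 / 2) := by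
    intro t; simpa using integral_exp_mul_gaussianReal t
  have I1 : ∀ t : ℝ, ∫ x, x ^ 1 * Real.exp (t * x) ∂gaussianReal 0 1
      = t * Real.exp (t ^ 2 / 2) := fun t => by
    have h := hasDerivAt_integral_pow_mul_exp_gaussianReal 0 t
    simp only [I0] at h
    exact h.unique (hE t)
  have I2 : ∀ t : ℝ, ∫ x, x ^ 2 * Real.exp (t * x) ∂gaussianReal 0 1
      = (1 + t ^ 2) * Real.exp (t ^ 2 / 2) := fun t => by
    have h := hasDerivAt_integral_pow_mul_exp_gaussianReal 1 t
    simp only [I1] at h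
    refine h.unique (((hasDerivAt_id t).mul (hE t)).congr_deriv ?_)
    simp; ring
  have I3 : ∀ t : ℝ, ∫ x, x ^ 3 * Real.exp (t * x) ∂gaussianReal 0 1
      = (3 * t + t ^ 3) * Real.exp (t ^ 2 / 2) := fun t => by
    have h := hasDerivAt_integral_pow_mul_exp_gaussianReal 2 t
    simp only [I2] at h
    refine h.unique ((((hasDerivAt_pow 2 t).const_add 1).mul (hE t)).congr_deriv ?_)
    simp; ring
  have I4 : ∀ t : ℝ, ∫ x, x ^ 4 * Real.exp (t * x) ∂gaussianReal 0 1
      = (3 + 3 * t ^ 2 + (3 * t + t ^ 3) * t) * Real.exp (t ^ 2 / 2) := fun t => by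
    have h := hasDerivAt_integral_pow_mul_exp_gaussianReal 3 t
    simp only [I3] at h
    refine h.unique (((((hasDerivAt_id t).const_mul 3).add (hasDerivAt_pow 3 t)).mul
      (hE t)).congr_deriv ?_)
    simp; ring
  exact ⟨by simpa using I2 0, by simpa using I4 0⟩

theorem memLp_sq_sub_one_gaussianReal :
    MemLp (fun x : ℝ => x ^ 2 - 1) 2 (gaussianReal 0 1) := by
  have h4 : MemLp (fun x : ℝ => x) 4 (gaussianReal 0 1) := memLp_id_gaussianReal' 4 (by simp)
  refine MemLp.sub ?_ (memLp_const 1)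
  rw [memLp_two_iff_integrable_sq (by fun_prop)]
  have := h4.integrable_norm_pow (p := 4) (by simp)
  refine this.congr (ae_of_all _ fun x => ?_)
  simp only [Real.norm_eq_abs]
  rw [show (4 : ℕ) = 2 * 2 from rfl, pow_mul, sq_abs]

theorem integral_sq_sub_one_gaussianReal : ∫ x, (x ^ 2 - 1) ∂gaussianReal 0 1 = 0 := by
  have hi : Integrable (fun x : ℝ => x ^ 2) (gaussianReal 0 1) :=
    (memLp_two_iff_integrable_sq (by fun_prop)).1 (memLp_id_gaussianReal' 2 (by simp))
  rw [integral_sub hi (integrable_const 1), integral_sq_and_pow_four_gaussianReal.1]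
  simp

theorem integral_sq_sub_one_sq_gaussianReal : ∫ x, (x ^ 2 - 1) ^ 2 ∂gaussianReal 0 1 = 2 := by
  have hi : Integrable (fun x : ℝ => x ^ 2) (gaussianReal 0 1) :=
    (memLp_two_iff_integrable_sq (by fun_prop)).1 (memLp_id_gaussianReal' 2 (by simp))
  have hi4 : Integrable (fun x : ℝ => x ^ 4) (gaussianReal 0 1) := by
    have h4 : MemLp (fun x : ℝ => x) 4 (gaussianReal 0 1) := memLp_id_gaussianReal' 4 (by simp)
    refine (h4.integrable_norm_pow (p := 4) (by simp)).congr (ae_of_all _ fun x => ?_)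
    simp only [Real.norm_eq_abs]
    rw [show (4 : ℕ) = 2 * 2 from rfl, pow_mul, sq_abs, ← pow_mul]
  have e : ∀ x : ℝ, (x ^ 2 - 1) ^ 2 = x ^ 4 - (2 * x ^ 2 - 1) := fun x => by ring
  simp only [e]
  have hi2 : Integrable (fun x : ℝ => 2 * x ^ 2 - 1) (gaussianReal 0 1) :=
    (hi.const_mul 2).sub (integrable_const 1)
  rw [integral_sub hi4 hi2,
    integral_sub (hi.const_mul 2) (integrable_const 1), integral_const_mul,
    integral_sq_and_pow_four_gaussianReal.1, integral_sq_and_pow_four_gaussianReal.2]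
  simp; norm_num

end GaussianMoments

/-! ### Quadratic forms in Gaussian vectors and their concentration. -/

section GaussianVectors

open scoped Matrix.Norms.L2Operator

variable {ι : Type*} [Fintype ι] [DecidableEq ι]

/-- The law of `n` independent standard Gaussian variables. -/
noncomputable abbrev stdPi (ι : Type*) [Fintype ι] : Measure (ι → ℝ) :=
  Measure.pi fun _ : ι => gaussianReal 0 1

variable {Ω : Type*} [MeasurableSpace Ω] {P : Measure Ω} [IsProbabilityMeasure P]

/-- `y` is a centred Gaussian vector with covariance matrix `R`. -/
structure IsCenteredGaussian (y : Ω → ι → ℝ) (P : Measure Ω) (R : Matrix ι ι ℝ) : Prop where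
  gaussian : HasGaussianLaw y P
  mean : ∀ i, ∫ ω, y ω i ∂P = 0
  covariance : ∀ i j, cov[fun ω => y ω i, fun ω => y ω j; P] = R i j

theorem dual_apply_eq_sum (L : StrongDual ℝ (ι → ℝ)) (x : ι → ℝ) :
    L x = ∑ i, L (Pi.single i 1) * x i := by
  conv_lhs => rw [pi_eq_sum_univ' x, map_sum]
  simp [mul_comm]

theorem IsCenteredGaussian.memLp {y : Ω → ι → ℝ} {R : Matrix ι ι ℝ}
    (hy : IsCenteredGaussian y P R) (i : ι) : MemLp (fun ω => y ω i) 2 P :=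
  (hy.gaussian.eval i).memLp_two

theorem integral_exp_linear_stdPi (m : ι → ℝ) :
    ∫ z, Complex.exp (((∑ i, m i * z i : ℝ) : ℂ) * Complex.I) ∂stdPi ι
      = Complex.exp (-((∑ i, m i ^ 2 : ℝ) : ℂ) / 2) := by
  simp_rw [Complex.ofReal_sum, Finset.sum_mul, Complex.exp_sum]
  rw [integral_fintype_prod_eq_prod
    (f := fun i x => Complex.exp (((m i * x : ℝ) : ℂ) * Complex.I))]
  simp_rw [Complex.ofReal_mul, ← charFun_apply_real, charFun_gaussianReal, ← Complex.exp_sum]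
  congr 1
  rw [neg_div, Finset.sum_div, ← Finset.sum_neg_distrib]
  exact Finset.sum_congr rfl fun i _ => by simp

/-- Both laws have characteristic functional l ↦ exp(−lᵀRl/2). This replaces y by a linear image of
independent standard normals. -/
theorem IsCenteredGaussian.map_eq {y : Ω → ι → ℝ} {R T : Matrix ι ι ℝ}
    (hy : IsCenteredGaussian y P R) (hT : T * Tᵀ = R) :
    P.map y = (stdPi ι).map (fun z => T *ᵥ z) := by
  have hTm : Measurable (fun z : ι → ℝ => T *ᵥ z) :=
    (LinearMap.continuous_of_finiteDimensional T.mulVecLin).measurable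
  have : IsProbabilityMeasure (P.map y) :=
    Measure.isProbabilityMeasure_map hy.gaussian.aemeasurable
  have : IsProbabilityMeasure ((stdPi ι).map (fun z => T *ᵥ z)) :=
    Measure.isProbabilityMeasure_map hTm.aemeasurable
  apply Measure.ext_of_charFunDual
  ext L
  set l : ι → ℝ := fun i => L (Pi.single i 1) with hl
  have hL : ∀ x, L x = ∑ i, l i * x i := dual_apply_eq_sum L
  have hm1 : ∫ ω, L (y ω) ∂P = 0 := by
    simp only [hL]
    rw [integral_finsetSum _ fun i _ => ((hy.memLp i).integrable (by norm_num)).const_mul _]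
    simp [integral_const_mul, hy.mean]
  have hv1 : Var[fun ω => L (y ω); P] = ∑ i, ∑ j, l i * l j * R i j := by
    simp only [hL]
    rw [variance_fun_sum fun i => (hy.memLp i).const_mul _]
    simp only [covariance_const_mul_left, covariance_const_mul_right, hy.covariance]
    exact Finset.sum_congr rfl fun i _ => Finset.sum_congr rfl fun j _ => by ring
  rw [hy.gaussian.charFunDual_map_eq_fun, charFunDual_apply,
    integral_map hTm.aemeasurable (by fun_prop), hm1, hv1]
  have hLT : ∀ z, L (T *ᵥ z) = ∑ j, (∑ i, l i * T i j) * z j := fun z => by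
    rw [hL]
    simp only [mulVec, dotProduct, Finset.mul_sum, Finset.sum_mul]
    rw [Finset.sum_comm]
    exact Finset.sum_congr rfl fun i _ => Finset.sum_congr rfl fun j _ => by ring
  simp_rw [hLT]
  rw [integral_exp_linear_stdPi]
  have : ∑ j, (∑ i, l i * T i j) ^ 2 = ∑ i, ∑ j, l i * l j * R i j := by
    simp_rw [sq, Finset.sum_mul_sum, ← hT, mul_apply, transpose_apply]
    rw [Finset.sum_comm]
    refine Finset.sum_congr rfl fun i _ => ?_
    rw [Finset.sum_comm]
    refine Finset.sum_congr rfl fun j _ => ?_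
    rw [Finset.mul_sum]
    exact Finset.sum_congr rfl fun k _ => by ring
  rw [this]
  congr 1
  simp [neg_div]

theorem quadForm_mulVec (T A : Matrix ι ι ℝ) (z : ι → ℝ) :
    (T *ᵥ z) ⬝ᵥ A *ᵥ (T *ᵥ z) = z ⬝ᵥ (Tᵀ * A * T) *ᵥ z := by
  rw [← mulVec_mulVec, ← mulVec_mulVec, dotProduct_mulVec z, vecMul_transpose]

/-- The law of a quadratic form in a centred Gaussian vector. -/
theorem IsCenteredGaussian.quadForm_map_eq {y : Ω → ι → ℝ} {R A : Matrix ι ι ℝ}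
    (hy : IsCenteredGaussian y P R) (hR : R.PosSemidef) (hA : A.IsHermitian) :
    ∃ d : ι → ℝ, ∑ i, d i = (A * R).trace ∧ ∑ i, d i ^ 2 = (A * R * A * R).trace ∧
      (∀ i, |d i| ≤ ‖A‖ * ‖R‖) ∧
      P.map (fun ω => y ω ⬝ᵥ A *ᵥ y ω) = (stdPi ι).map (fun z => ∑ i, d i * z i ^ 2) := by
  obtain ⟨S, hS, hSS⟩ := exists_symm_mul_self_eq hR
  have hSt : Sᵀ = S := by simpa using hS.eq
  have hX : (S * A * S).IsHermitian := by
    simp only [IsHermitian, conjTranspose_mul, hS.eq, hA.eq, Matrix.mul_assoc]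
  -- With S = R^{1/2} and U diagonalising SAS, the single matrix T = SU satisfies TTᵀ = R and TᵀAT =
  -- diag(d): it represents y and diagonalises the form at once.
  obtain ⟨U, d, h1, h2, h3, h4⟩ := exists_orthogonal_diagonal hX
  have hT : (S * U) * (S * U)ᵀ = R := by
    rw [transpose_mul, hSt, Matrix.mul_assoc, ← Matrix.mul_assoc U, h2, Matrix.one_mul, hSS]
  have hTA : (S * U)ᵀ * A * (S * U) = diagonal d := by
    have : (S * U)ᵀ * A * (S * U) = Uᵀ * (S * A * S) * U := by
      rw [transpose_mul, hSt]; simp only [Matrix.mul_assoc]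
    rw [this, h3]
    have : Uᵀ * (U * diagonal d * Uᵀ) * U = (Uᵀ * U) * diagonal d * (Uᵀ * U) := by
      simp only [Matrix.mul_assoc]
    rw [this, h1, Matrix.one_mul, Matrix.mul_one]
  refine ⟨d, ?_, ?_, ?_, ?_⟩
  · rw [← trace_conj_diagonal h1, ← h3, trace_mul_comm, ← Matrix.mul_assoc, hSS, trace_mul_comm]
  · rw [← trace_conj_diagonal h1, ← conj_diagonal_mul_self h1, ← h3, ← hSS]
    simp only [Matrix.mul_assoc]
    rw [trace_mul_comm S]
    simp only [Matrix.mul_assoc]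
  · intro i
    refine (h4 i).trans ?_
    calc ‖S * A * S‖ ≤ ‖S‖ * ‖A‖ * ‖S‖ :=
          (norm_mul_le _ _).trans (by gcongr; exact norm_mul_le _ _)
      _ = ‖A‖ * ‖R‖ := by rw [← hSS, norm_mul_self_of_isHermitian hS]; ring
  · have hq : Measurable (fun x : ι → ℝ => x ⬝ᵥ A *ᵥ x) := by
      simp only [dotProduct, mulVec]; fun_prop
    have hTm : Measurable (fun z : ι → ℝ => (S * U) *ᵥ z) :=
      (LinearMap.continuous_of_finiteDimensional (S * U).mulVecLin).measurable
    have e : (fun ω => y ω ⬝ᵥ A *ᵥ y ω) = (fun x : ι → ℝ => x ⬝ᵥ A *ᵥ x) ∘ y := rfl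
    rw [e, ← AEMeasurable.map_map_of_aemeasurable hq.aemeasurable hy.gaussian.aemeasurable,
      hy.map_eq hT, Measure.map_map hq hTm]
    congr 1
    ext z
    simp only [Function.comp_apply]
    rw [quadForm_mulVec, hTA]
    simp only [dotProduct, mulVec_diagonal]
    exact Finset.sum_congr rfl fun i _ => by ring

theorem memLp_eval_stdPi (i : ι) : MemLp (fun z : ι → ℝ => z i ^ 2 - 1) 2 (stdPi ι) :=
  memLp_sq_sub_one_gaussianReal.comp_measurePreserving
    (measurePreserving_eval (fun _ : ι => gaussianReal 0 1) i)

/-- Chebyshev's inequality: each zᵢ² − 1 is centred with variance 2, and the coordinates are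
independent. -/
theorem meas_chiSq_deviation_le (d : ι → ℝ) {c : ℝ} (hc : 0 < c) :
    stdPi ι {z | c ≤ |∑ i, d i * (z i ^ 2 - 1)|} ≤ ENNReal.ofReal (2 * ∑ i, d i ^ 2 / c ^ 2) := by
  set X : (ι → ℝ) → ℝ := ∑ i, fun z : ι → ℝ => d i * (z i ^ 2 - 1) with hX
  have hXa : ∀ z, X z = ∑ i, d i * (z i ^ 2 - 1) := fun z => by simp [hX]
  have hmem : MemLp X 2 (stdPi ι) := memLp_finsetSum' _ fun i _ => (memLp_eval_stdPi i).const_mul _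
  have hmean : (stdPi ι)[X] = 0 := by
    simp only [hXa]
    rw [integral_finsetSum _ fun i _ =>
      ((memLp_eval_stdPi i).integrable (by norm_num)).const_mul _]
    refine Finset.sum_eq_zero fun i _ => ?_
    rw [integral_const_mul]
    have := integral_comp_eval (μ := fun _ : ι => gaussianReal 0 1) (i := i)
      (f := fun x : ℝ => x ^ 2 - 1) (by fun_prop)
    rw [this, integral_sq_sub_one_gaussianReal, mul_zero]
  have hvar : Var[X; stdPi ι] = 2 * ∑ i, d i ^ 2 := by
    rw [hX, variance_sum_pi (X := fun i x => d i * (x ^ 2 - 1))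
      fun i => memLp_sq_sub_one_gaussianReal.const_mul _, Finset.mul_sum]
    refine Finset.sum_congr rfl fun i _ => ?_
    rw [variance_const_mul, variance_eq_integral (by fun_prop), integral_sq_sub_one_gaussianReal]
    simp only [sub_zero]
    rw [integral_sq_sub_one_sq_gaussianReal, mul_comm]
  have := meas_ge_le_variance_div_sq hmem hc
  rw [hmean, hvar] at this
  simp only [hXa, sub_zero] at this
  rw [Finset.mul_sum, Finset.sum_div] at this
  rw [Finset.mul_sum]
  simpa only [mul_div_assoc] using this

/-- Chebyshev bound for quadratic forms in a centred Gaussian vector. -/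
theorem IsCenteredGaussian.meas_quadForm_deviation_le {y : Ω → ι → ℝ} {R A : Matrix ι ι ℝ}
    (hy : IsCenteredGaussian y P R) (hR : R.PosSemidef) {c : ℝ} (hc : 0 < c) :
    P {ω | c ≤ |y ω ⬝ᵥ A *ᵥ y ω - (A * R).trace|}
      ≤ ENNReal.ofReal (2 * Fintype.card ι * (‖A‖ * ‖R‖) ^ 2 / c ^ 2) := by
  -- Only the symmetric part of A enters the form and, R being symmetric, the trace. A itself must
  -- be allowed to be non-symmetric, for products such as R⁻¹DᵢR⁻¹DⱼR⁻¹.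
  set B : Matrix ι ι ℝ := (1 / 2 : ℝ) • (A + Aᵀ) with hB
  have hBh : B.IsHermitian := by
    simp [IsHermitian, hB, add_comm]
  have hRt : Rᵀ = R := by simpa using hR.1.eq
  have hBn : ‖B‖ ≤ ‖A‖ := by
    rw [hB, norm_smul]
    have := norm_add_le A Aᵀ
    rw [norm_transpose_eq] at this
    norm_num
    linarith
  have hq : ∀ x : ι → ℝ, x ⬝ᵥ A *ᵥ x = x ⬝ᵥ B *ᵥ x := fun x => by
    have h : x ⬝ᵥ Aᵀ *ᵥ x = x ⬝ᵥ A *ᵥ x := by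
      rw [mulVec_transpose, dotProduct_comm, ← dotProduct_mulVec]
    rw [hB, smul_mulVec, add_mulVec, dotProduct_smul, dotProduct_add, h, smul_eq_mul]
    ring
  have htr : (A * R).trace = (B * R).trace := by
    have h : (Aᵀ * R).trace = (A * R).trace := by
      rw [← trace_transpose, transpose_mul, transpose_transpose, hRt, trace_mul_comm]
    rw [hB, Matrix.smul_mul, trace_smul, Matrix.add_mul, trace_add, h, smul_eq_mul]
    ring
  simp only [hq, htr]
  obtain ⟨d, h1, -, h3, h4⟩ := hy.quadForm_map_eq hR hBh
  have hqm : Measurable (fun x : ι → ℝ => x ⬝ᵥ B *ᵥ x) := by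
    simp only [dotProduct, mulVec]; fun_prop
  have hset : MeasurableSet {x : ℝ | c ≤ |x - (B * R).trace|} :=
    measurableSet_le measurable_const (by fun_prop)
  have hqy : AEMeasurable (fun ω => y ω ⬝ᵥ B *ᵥ y ω) P :=
    hqm.comp_aemeasurable hy.gaussian.aemeasurable
  have e1 : P {ω | c ≤ |y ω ⬝ᵥ B *ᵥ y ω - (B * R).trace|}
      = (P.map (fun ω => y ω ⬝ᵥ B *ᵥ y ω)) {x : ℝ | c ≤ |x - (B * R).trace|} := by
    rw [Measure.map_apply_of_aemeasurable hqy hset]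
    rfl
  rw [e1, h4, Measure.map_apply (by fun_prop) hset]
  have e2 : (fun z : ι → ℝ => ∑ i, d i * z i ^ 2) ⁻¹' {x : ℝ | c ≤ |x - (B * R).trace|}
      = {z | c ≤ |∑ i, d i * (z i ^ 2 - 1)|} := by
    ext z
    simp only [Set.mem_preimage, Set.mem_ofPred_eq, ← h1, mul_sub, Finset.sum_sub_distrib, mul_one]
  rw [e2]
  refine (meas_chiSq_deviation_le d hc).trans (ENNReal.ofReal_le_ofReal ?_)
  have : ∀ i ∈ Finset.univ, d i ^ 2 / c ^ 2 ≤ (‖A‖ * ‖R‖) ^ 2 / c ^ 2 := fun i _ => by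
    rw [← sq_abs (d i)]
    have := (h3 i).trans (mul_le_mul_of_nonneg_right hBn (norm_nonneg R))
    gcongr
  calc 2 * ∑ i, d i ^ 2 / c ^ 2 ≤ 2 * ∑ _i : ι, (‖A‖ * ‖R‖) ^ 2 / c ^ 2 :=
        mul_le_mul_of_nonneg_left (Finset.sum_le_sum this) (by norm_num)
    _ = _ := by simp; ring

end GaussianVectors

end GPML

namespace GPML

/-! ### Central limit theorem for weighted sums of centred chi-squares. -/

section ChiSquareCLT

/-- The characteristic function of a centred chi-square variable with one degree of freedom. -/
noncomputable def chiSqChar (s : ℝ) : ℂ :=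
  ∫ x, Complex.exp (((s * (x ^ 2 - 1) : ℝ) : ℂ) * Complex.I) ∂gaussianReal 0 1

theorem norm_chiSqChar_le_one (s : ℝ) : ‖chiSqChar s‖ ≤ 1 := by
  refine (norm_integral_le_integral_norm _).trans ?_
  simp only [Complex.norm_exp_ofReal_mul_I]
  simp

/-- Dividing x² − 1 by √2 gives unit variance, so the second-order expansion 1 − t²/2 of a
characteristic function applies at t = √2 s. -/
theorem chiSqChar_isLittleO :
    (fun s : ℝ => chiSqChar s - (1 - (s : ℂ) ^ 2)) =o[𝓝 0] fun s : ℝ => s ^ 2 := by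
  set X : ℝ → ℝ := fun x => (√2)⁻¹ * (x ^ 2 - 1) with hX
  have h2 : (√2 : ℝ) ^ 2 = 2 := Real.sq_sqrt (by norm_num)
  have h0 : (gaussianReal 0 1)[X] = 0 := by
    rw [hX, integral_const_mul, integral_sq_sub_one_gaussianReal, mul_zero]
  have h1 : (gaussianReal 0 1)[X ^ 2] = 1 := by
    have : X ^ 2 = fun x => (2 : ℝ)⁻¹ * (x ^ 2 - 1) ^ 2 := by
      ext x; simp only [hX, Pi.pow_apply, mul_pow, inv_pow, h2]
    rw [this, integral_const_mul, integral_sq_sub_one_sq_gaussianReal]; norm_num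
  have key := taylor_charFun_two (X := X) (P := gaussianReal 0 1) (by fun_prop) h0 h1
  have htend : Tendsto (fun s : ℝ => √2 * s) (𝓝 0) (𝓝 0) := by
    have : Continuous fun s : ℝ => √2 * s := by fun_prop
    simpa using this.tendsto 0
  have key2 := key.comp_tendsto htend
  have e1 : ((fun t : ℝ => charFun (Measure.map X (gaussianReal 0 1)) t - (1 - (t : ℂ) ^ 2 / 2)) ∘
      fun s : ℝ => √2 * s) = fun s : ℝ => chiSqChar s - (1 - (s : ℂ) ^ 2) := by
    ext s
    have hc : ((√2 : ℝ) : ℂ) ^ 2 = 2 := by exact_mod_cast h2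
    simp only [Function.comp_apply]
    congr 1
    · rw [charFun_apply_real, integral_map (by fun_prop) (by fun_prop), chiSqChar]
      congr 1
      ext x
      congr 2
      rw [← Complex.ofReal_mul]
      congr 1
      rw [hX]
      have : √2 ≠ 0 := by positivity
      field_simp
    · push_cast
      rw [mul_pow, hc]; ring
  rw [e1] at key2
  refine key2.trans_isBigO ?_
  refine Asymptotics.IsBigO.of_bound 2 (Eventually.of_forall fun s => ?_)
  simp only [Function.comp_apply, mul_pow, h2, norm_mul, norm_pow]
  norm_num

theorem exists_chiSqChar_sub_exp_le {ε : ℝ} (hε : 0 < ε) :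
    ∃ δ : ℝ, 0 < δ ∧ ∀ s : ℝ, |s| ≤ δ → ‖chiSqChar s - Complex.exp (-((s ^ 2 : ℝ) : ℂ))‖ ≤ ε * s ^ 2 := by
  have h := chiSqChar_isLittleO.bound (half_pos hε)
  obtain ⟨δ, hδ, h⟩ := Metric.eventually_nhds_iff.1 h
  -- δ/2 serves the expansion of `chiSqChar`; 1 and ε/2 give s² ≤ |s| ≤ ε/2, so the exponential
  -- remainder s⁴ is at most (ε/2)s².
  refine ⟨min (δ / 2) (min 1 (ε / 2)), by positivity, fun s hs => ?_⟩
  have hs1 : |s| ≤ δ / 2 := hs.trans (min_le_left _ _)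
  have hs2 : |s| ≤ 1 := hs.trans ((min_le_right _ _).trans (min_le_left _ _))
  have hs3 : |s| ≤ ε / 2 := hs.trans ((min_le_right _ _).trans (min_le_right _ _))
  have h1 := h (y := s) (by rw [Real.dist_eq, sub_zero]; linarith)
  have hsq : s ^ 2 ≤ |s| := by rw [← sq_abs]; nlinarith [abs_nonneg s]
  have h2 : ‖(1 - (s : ℂ) ^ 2) - Complex.exp (-((s ^ 2 : ℝ) : ℂ))‖ ≤ ε / 2 * s ^ 2 := by
    have h3 := Real.abs_exp_sub_one_sub_id_le (x := -s ^ 2) (by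
      rw [abs_neg, abs_of_nonneg (sq_nonneg s)]; linarith)
    have h4 : (1 - (s : ℂ) ^ 2) - Complex.exp (-((s ^ 2 : ℝ) : ℂ))
        = (((-(Real.exp (-s ^ 2) - 1 - -s ^ 2)) : ℝ) : ℂ) := by push_cast; ring
    rw [h4, Complex.norm_real, Real.norm_eq_abs, abs_neg]
    refine h3.trans ?_
    nlinarith [sq_nonneg s]
  have h5 : chiSqChar s - Complex.exp (-((s ^ 2 : ℝ) : ℂ)) = (chiSqChar s - (1 - (s : ℂ) ^ 2)) +
      ((1 - (s : ℂ) ^ 2) - Complex.exp (-((s ^ 2 : ℝ) : ℂ))) := by ring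
  rw [h5]
  refine (norm_add_le _ _).trans ?_
  rw [Real.norm_eq_abs, abs_of_nonneg (sq_nonneg s)] at h1
  linarith

/-- Telescoping: factors are exchanged one at a time, the others having norm at most 1. -/
theorem norm_prod_sub_prod_le {ι : Type*} (s : Finset ι) (a b : ι → ℂ)
    (ha : ∀ i, ‖a i‖ ≤ 1) (hb : ∀ i, ‖b i‖ ≤ 1) :
    ‖∏ i ∈ s, a i - ∏ i ∈ s, b i‖ ≤ ∑ i ∈ s, ‖a i - b i‖ := by
  classical
  induction s using Finset.induction_on with
  | empty => simp
  | insert i s hi ih =>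
    rw [Finset.prod_insert hi, Finset.prod_insert hi, Finset.sum_insert hi]
    have e : a i * ∏ j ∈ s, a j - b i * ∏ j ∈ s, b j
        = (a i - b i) * ∏ j ∈ s, a j + b i * (∏ j ∈ s, a j - ∏ j ∈ s, b j) := by ring
    have hp : ‖∏ j ∈ s, a j‖ ≤ 1 := by
      rw [norm_prod]; exact Finset.prod_le_one (fun _ _ => norm_nonneg _) fun j _ => ha j
    rw [e]
    refine (norm_add_le _ _).trans (add_le_add ?_ ?_)
    · rw [norm_mul]; exact mul_le_of_le_one_right (norm_nonneg _) hp
    · rw [norm_mul]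
      exact (mul_le_of_le_one_left (norm_nonneg _) (hb i)).trans ih

theorem integral_exp_chiSq_stdPi {ι : Type*} [Fintype ι] (d : ι → ℝ) :
    ∫ z, Complex.exp (((∑ i, d i * (z i ^ 2 - 1) : ℝ) : ℂ) * Complex.I) ∂stdPi ι
      = ∏ i, chiSqChar (d i) := by
  simp_rw [Complex.ofReal_sum, Finset.sum_mul, Complex.exp_sum]
  rw [integral_fintype_prod_eq_prod
    (f := fun i x => Complex.exp (((d i * (x ^ 2 - 1) : ℝ) : ℂ) * Complex.I))]
  rfl

/-- Central limit theorem, at the level of characteristic functions, for triangular arrays of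
weighted chi-square variables. -/
theorem tendsto_prod_chiSqChar {d : (n : ℕ) → Fin n → ℝ} {σ : ℝ} {b : ℕ → ℝ}
    (hσ : ∀ᶠ n in atTop, ∑ i, d n i ^ 2 = σ) (hb : ∀ n i, |d n i| ≤ b n)
    (hb0 : Tendsto b atTop (𝓝 0)) :
    Tendsto (fun n => ∏ i, chiSqChar (d n i)) atTop (𝓝 (Complex.exp (-(σ : ℂ)))) := by
  rw [Metric.tendsto_atTop']
  intro ε hε
  have hσ0 : 0 ≤ σ := by
    obtain ⟨n, hn⟩ := hσ.exists
    rw [← hn]; positivity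
  -- Errors proportional to d² sum to at most εσ/(2(σ + 1)) < ε; the +1 covers σ = 0. Uniform
  -- smallness of the d's plays the role of Lindeberg's condition.
  obtain ⟨δ, hδ, h⟩ := exists_chiSqChar_sub_exp_le (ε := ε / (2 * (σ + 1))) (by positivity)
  obtain ⟨N, hN⟩ := eventually_atTop.1 (hσ.and (hb0.eventually_le_const hδ))
  refine ⟨N, fun n hn => ?_⟩
  obtain ⟨h1, h2⟩ := hN n hn.le
  have e : Complex.exp (-(σ : ℂ)) = ∏ i, Complex.exp (-((d n i ^ 2 : ℝ) : ℂ)) := by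
    rw [← Complex.exp_sum, ← h1, Finset.sum_neg_distrib]; push_cast; rfl
  rw [dist_eq_norm, e]
  refine (norm_prod_sub_prod_le _ _ _ (fun i => norm_chiSqChar_le_one _) fun i => ?_).trans_lt ?_
  · rw [← Complex.ofReal_neg, Complex.norm_exp_ofReal, Real.exp_le_one_iff]
    nlinarith [sq_nonneg (d n i)]
  · calc _ ≤ ∑ i, ε / (2 * (σ + 1)) * d n i ^ 2 :=
          Finset.sum_le_sum fun i _ => h _ ((hb n i).trans h2)
      _ = ε / (2 * (σ + 1)) * σ := by rw [← Finset.mul_sum, h1]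
      _ < ε := by
          rw [div_mul_eq_mul_div, div_lt_iff₀ (by positivity)]
          nlinarith

end ChiSquareCLT

/-! ### Central limit theorem for Gaussian quadratic forms. -/

section QuadFormCLT

open scoped Matrix.Norms.L2Operator

variable {Ω : Type*} [MeasurableSpace Ω] {P : Measure Ω} [IsProbabilityMeasure P]

/-- Central limit theorem for centred quadratic forms in Gaussian vectors. -/
theorem tendsto_integral_exp_quadForm {y : (n : ℕ) → Ω → Fin n → ℝ}
    {R A : (n : ℕ) → Matrix (Fin n) (Fin n) ℝ} (hy : ∀ n, IsCenteredGaussian (y n) P (R n))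
    (hR : ∀ n, (R n).PosSemidef) (hA : ∀ n, (A n).IsHermitian) {σ : ℝ}
    (hσ : ∀ᶠ n in atTop, (A n * R n * A n * R n).trace = σ)
    (hb : Tendsto (fun n => ‖A n‖ * ‖R n‖) atTop (𝓝 0)) :
    Tendsto (fun n => ∫ ω, Complex.exp
      (((y n ω ⬝ᵥ A n *ᵥ y n ω - (A n * R n).trace : ℝ) : ℂ) * Complex.I) ∂P) atTop
      (𝓝 (Complex.exp (-(σ : ℂ)))) := by
  choose d h1 h2 h3 h4 using fun n => (hy n).quadForm_map_eq (hR n) (hA n)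
  have key := tendsto_prod_chiSqChar (d := d) (σ := σ) (by simpa only [h2] using hσ) h3 hb
  refine key.congr fun n => ?_
  rw [← integral_exp_chiSq_stdPi]
  have hqm : Measurable (fun x : Fin n → ℝ => x ⬝ᵥ A n *ᵥ x) := by
    simp only [dotProduct, mulVec]; fun_prop
  have hqy : AEMeasurable (fun ω => y n ω ⬝ᵥ A n *ᵥ y n ω) P :=
    hqm.comp_aemeasurable (hy n).gaussian.aemeasurable
  have hF : Measurable fun x : ℝ =>
      Complex.exp (((x - (A n * R n).trace : ℝ) : ℂ) * Complex.I) := by fun_prop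
  have e1 := integral_map hqy (f := fun x : ℝ =>
    Complex.exp (((x - (A n * R n).trace : ℝ) : ℂ) * Complex.I)) hF.aestronglyMeasurable
  rw [← e1, h4 n, integral_map (Measurable.aemeasurable (by fun_prop)) hF.aestronglyMeasurable]
  congr 1
  ext z
  rw [← h1 n]
  simp only [mul_sub, Finset.sum_sub_distrib, mul_one]

end QuadFormCLT

/-! ### Calculus of events whose probability tends to one. -/

section HighProbability

variable {Ω : Type*} [MeasurableSpace Ω] {P : Measure Ω}

/-- The events `A n` have (outer) probability tending to one. -/
def HighProb (P : Measure Ω) (A : ℕ → Ω → Prop) : Prop :=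
  Tendsto (fun n => P {ω | ¬ A n ω}) atTop (𝓝 0)

theorem HighProb.mono {A B : ℕ → Ω → Prop} (hA : HighProb P A)
    (h : ∀ᶠ n in atTop, ∀ᵐ ω ∂P, A n ω → B n ω) : HighProb P B := by
  refine tendsto_of_tendsto_of_tendsto_of_le_of_le' tendsto_const_nhds hA
    (Eventually.of_forall fun _ => zero_le) ?_
  filter_upwards [h] with n hn
  refine measure_mono_ae ?_
  filter_upwards [hn] with ω hω hB hA
  exact hB (hω hA)

theorem HighProb.and {A B : ℕ → Ω → Prop} (hA : HighProb P A) (hB : HighProb P B) :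
    HighProb P fun n ω => A n ω ∧ B n ω := by
  have := hA.add hB
  rw [add_zero] at this
  refine tendsto_of_tendsto_of_tendsto_of_le_of_le tendsto_const_nhds this
    (fun _ => zero_le) fun n => ?_
  refine (measure_mono ?_).trans (measure_union_le _ _)
  intro ω hω
  exact not_and_or.1 hω

theorem HighProb.forall {ι : Type*} [Finite ι] {A : ι → ℕ → Ω → Prop}
    (hA : ∀ i, HighProb P (A i)) : HighProb P fun n ω => ∀ i, A i n ω := by
  have := Fintype.ofFinite ι
  have h := tendsto_finsetSum Finset.univ fun i _ => hA i
  rw [Finset.sum_const_zero] at h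
  refine tendsto_of_tendsto_of_tendsto_of_le_of_le tendsto_const_nhds h
    (fun _ => zero_le) fun n => ?_
  refine (measure_mono ?_).trans (measure_biUnion_finset_le Finset.univ fun i => {ω | ¬ A i n ω})
  intro ω hω
  obtain ⟨i, hi⟩ := not_forall.1 hω
  exact Set.mem_biUnion (Finset.mem_coe.2 (Finset.mem_univ i)) hi

end HighProbability

end GPML

namespace GPML

/-! ### Sums of a decaying function over separated points in finite dimension. -/

section Packing

/-- A displacement by a changes the decay profile by a bounded factor only, since 1 + ρ ≤ 2(1 + a)
max(1, r). This lets a value at the centre of a ball be compared with the integral over the ball. -/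
theorem one_div_one_add_rpow_le {r ρ a γ : ℝ} (hr : 0 ≤ r) (hρ : 0 ≤ ρ) (ha : 0 ≤ a) (hγ : 0 < γ)
    (h : ρ ≤ r + a) : 1 / (1 + r ^ γ) ≤ (2 * (1 + a)) ^ γ * (1 + ρ) ^ (-γ) := by
  have h1 : 1 + ρ ≤ (2 * (1 + a)) * max 1 r := by
    rcases le_total 1 r with h1 | h1
    · rw [max_eq_right h1]; nlinarith
    · rw [max_eq_left h1]; nlinarith
  have h2 : (max 1 r) ^ γ ≤ 1 + r ^ γ := by
    have : 0 ≤ r ^ γ := Real.rpow_nonneg hr γ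
    rcases le_total 1 r with h1 | h1
    · rw [max_eq_right h1]; linarith
    · rw [max_eq_left h1, Real.one_rpow]; linarith
  have h3 : (1 + ρ) ^ γ ≤ (2 * (1 + a)) ^ γ * (1 + r ^ γ) := by
    calc (1 + ρ) ^ γ ≤ ((2 * (1 + a)) * max 1 r) ^ γ :=
          Real.rpow_le_rpow (by positivity) h1 hγ.le
      _ = (2 * (1 + a)) ^ γ * (max 1 r) ^ γ := Real.mul_rpow (by positivity) (by positivity)
      _ ≤ _ := by gcongr
  rw [Real.rpow_neg (by positivity), ← div_eq_mul_inv,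
    div_le_div_iff₀ (by positivity) (by positivity), one_mul]
  exact h3

variable {E : Type*} [NormedAddCommGroup E] [NormedSpace ℝ E] [FiniteDimensional ℝ E]
  [MeasurableSpace E] [BorelSpace E]

/-- Sums of a decaying function over a separated set of points are uniformly bounded. -/
theorem exists_sum_decay_le {Δ γ : ℝ} (hΔ : 0 < Δ) (hγ : (Module.finrank ℝ E : ℝ) < γ) :
    ∃ C : ℝ, 0 < C ∧ ∀ (n : ℕ) (x : Fin n → E), (∀ i j, i ≠ j → Δ ≤ ‖x i - x j‖) → ∀ a : E,
      ∑ j, 1 / (1 + ‖x j - a‖ ^ γ) ≤ C := by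
  have hγ0 : 0 < γ := lt_of_le_of_lt (Nat.cast_nonneg _) hγ
  let μ : Measure E := Measure.addHaar
  have hint : Integrable (fun y : E => (1 + ‖y‖) ^ (-γ)) μ := integrable_one_add_norm hγ
  have hg0 : ∀ y : E, 0 ≤ (1 + ‖y‖) ^ (-γ) := fun y => by positivity
  set v : ℝ := μ.real (Metric.ball (0 : E) (Δ / 2)) with hv
  have hv0 : 0 < v := by
    rw [hv, Measure.real, ENNReal.toReal_pos_iff]
    exact ⟨Metric.measure_ball_pos μ 0 (by positivity), measure_ball_lt_top⟩
  set I : ℝ := ∫ y, (1 + ‖y‖) ^ (-γ) ∂μ with hI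
  have hI0 : 0 ≤ I := integral_nonneg hg0
  set c : ℝ := (2 * (1 + Δ / 2)) ^ γ with hc
  have hc0 : 0 < c := by positivity
  -- The added 1 only secures strict positivity.
  refine ⟨c * I / v + 1, by positivity, fun n x hx a => ?_⟩
  refine le_trans ?_ (le_add_of_nonneg_right zero_le_one)
  rw [le_div_iff₀ hv0, Finset.sum_mul]
  -- Each term times the volume of a ball of radius Δ/2 is dominated by an integral over that ball.
  -- Separation makes the balls disjoint, so the total is at most the integral over the whole space,
  -- finite because γ exceeds the dimension.
  have hball : ∀ j, 1 / (1 + ‖x j - a‖ ^ γ) * v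
      ≤ c * ∫ y in Metric.ball (x j - a) (Δ / 2), (1 + ‖y‖) ^ (-γ) ∂μ := fun j => by
    have hvj : v = μ.real (Metric.ball (x j - a) (Δ / 2)) := by
      rw [hv, Measure.real, Measure.real, Measure.addHaar_ball_center μ (x j - a)]
    rw [hvj, ← integral_const_mul, mul_comm]
    have : μ.real (Metric.ball (x j - a) (Δ / 2)) * (1 / (1 + ‖x j - a‖ ^ γ))
        = ∫ _y in Metric.ball (x j - a) (Δ / 2), 1 / (1 + ‖x j - a‖ ^ γ) ∂μ := by
      rw [setIntegral_const, smul_eq_mul]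
    rw [this]
    refine setIntegral_mono_on (integrableOn_const measure_ball_lt_top.ne)
      (hint.const_mul c).integrableOn measurableSet_ball fun y hy => ?_
    refine one_div_one_add_rpow_le (norm_nonneg _) (norm_nonneg _) (by positivity) hγ0 ?_
    have h1 : ‖y - (x j - a)‖ < Δ / 2 := by simpa [dist_eq_norm] using hy
    have h2 : ‖y‖ ≤ ‖x j - a‖ + ‖y - (x j - a)‖ := by
      simpa using norm_add_le (x j - a) (y - (x j - a))
    linarith
  refine (Finset.sum_le_sum fun j _ => hball j).trans ?_
  rw [← Finset.mul_sum]
  refine mul_le_mul_of_nonneg_left ?_ hc0.le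
  have hdisj : Pairwise (Function.onFun Disjoint fun j => Metric.ball (x j - a) (Δ / 2)) := by
    intro i j hij
    refine Metric.ball_disjoint_ball ?_
    rw [dist_eq_norm, sub_sub_sub_cancel_right]
    have := hx i j hij
    linarith
  rw [← integral_iUnion_fintype (fun j => measurableSet_ball) hdisj
    (fun j => hint.integrableOn)]
  exact setIntegral_le_integral hint (ae_of_all _ hg0)

end Packing

/-! ### Uniform row sums for the design points. -/

section Design

variable {𝕜 H : Type*} [RCLike 𝕜] [NormedAddCommGroup H] [InnerProductSpace 𝕜 H]

/-- For separated inputs, kernels with polynomial decay have uniformly bounded row sums. -/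
theorem exists_rowSum_le {N : ℕ∞} (e : HilbertBasis (BasisIndex N) 𝕜 H)
    {f : (n : ℕ) → Fin n → H} {Δ : ℝ} (hΔ : 0 < Δ) {d₀ : ℕ}
    (hsep : ∀ n, ∀ i j : Fin n, i ≠ j →
      Δ ≤ ‖basisTruncation e d₀ (f n j) - basisTruncation e d₀ (f n i)‖)
    {γ : ℝ} (hγ : ((Module.finrank ℝ 𝕜 * d₀ : ℕ) : ℝ) < γ) :
    ∃ C : ℝ, 0 < C ∧ ∀ n (i : Fin n), ∑ j, 1 / (1 + ‖f n i - f n j‖ ^ γ) ≤ C := by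
  classical
  set S : Finset (BasisIndex N) :=
    (Finset.Icc 1 d₀).subtype (fun j : ℕ => 1 ≤ j ∧ (j : ℕ∞) ≤ N) with hS
  -- Only an inequality: there are fewer than d₀ basis vectors when N < d₀.
  have hcard : S.card ≤ d₀ := by
    rw [hS, Finset.card_subtype]
    exact (Finset.card_filter_le _ _).trans (by simp)
  let E := EuclideanSpace 𝕜 S
  have hdim : Module.finrank ℝ E = S.card * Module.finrank ℝ 𝕜 := by
    rw [(WithLp.linearEquiv 2 ℝ (S → 𝕜)).finrank_eq, Module.finrank_pi_fintype]
    simp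
  have hγ0 : 0 < γ := lt_of_le_of_lt (Nat.cast_nonneg _) hγ
  have hγE : (Module.finrank ℝ E : ℝ) < γ := by
    refine lt_of_le_of_lt ?_ hγ
    rw [hdim, mul_comm]
    exact_mod_cast Nat.mul_le_mul_left _ hcard
  let coord : H → E := fun x => WithLp.toLp 2 fun j => inner 𝕜 (e j) x
  have hnorm : ∀ x y, ‖coord x - coord y‖ ^ 2 = ∑ j ∈ S, ‖inner 𝕜 (e j) (x - y)‖ ^ 2 := by
    intro x y
    rw [EuclideanSpace.norm_sq_eq, ← Finset.sum_coe_sort S]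
    simp only [Finset.univ_eq_attach, inner_sub_right]
    rfl
  have htrunc : ∀ x y, ‖basisTruncation e d₀ x - basisTruncation e d₀ y‖ ^ 2
      = ∑ j ∈ S, ‖inner 𝕜 (e j) (x - y)‖ ^ 2 := by
    intro x y
    have : basisTruncation e d₀ x - basisTruncation e d₀ y
        = ∑ j ∈ S, (inner 𝕜 (e j) (x - y) : 𝕜) • e j := by
      simp only [basisTruncation, inner_sub_right, sub_smul, Finset.sum_sub_distrib]
      rw [hS]
    rw [this]
    have h := e.orthonormal.inner_sum (fun j => inner 𝕜 (e j) (x - y))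
      (fun j => inner 𝕜 (e j) (x - y)) S
    rw [inner_self_eq_norm_sq_to_K] at h
    have h2 : ∑ i ∈ S, (starRingEnd 𝕜) (inner 𝕜 (e i) (x - y)) * inner 𝕜 (e i) (x - y)
        = ((∑ j ∈ S, ‖inner 𝕜 (e j) (x - y)‖ ^ 2 : ℝ) : 𝕜) := by
      push_cast
      exact Finset.sum_congr rfl fun j _ => RCLike.conj_mul _
    rw [h2] at h
    exact_mod_cast h
  obtain ⟨C, hC, hbound⟩ := exists_sum_decay_le (E := E) hΔ hγE
  refine ⟨C, hC, fun n i => ?_⟩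
  have hsep' : ∀ a b : Fin n, a ≠ b → Δ ≤ ‖coord (f n a) - coord (f n b)‖ := by
    intro a b hab
    have h1 := hsep n b a hab.symm
    have h2 : ‖coord (f n a) - coord (f n b)‖
        = ‖basisTruncation e d₀ (f n a) - basisTruncation e d₀ (f n b)‖ := by
      rw [← sq_eq_sq₀ (norm_nonneg _) (norm_nonneg _), hnorm, htrunc]
    rw [h2]; exact h1
  refine le_trans (Finset.sum_le_sum fun j _ => ?_)
    (hbound n (fun j => coord (f n j)) hsep' (coord (f n i)))
  -- Bessel's inequality. Passing to the first coordinates shortens distances and so increases the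
  -- decay profile, while separation survives because it was assumed for the truncations.
  have hle : ‖coord (f n j) - coord (f n i)‖ ≤ ‖f n i - f n j‖ := by
    rw [← sq_le_sq₀ (norm_nonneg _) (norm_nonneg _), hnorm, norm_sub_rev]
    exact e.orthonormal.sum_inner_products_le _
  gcongr

end Design

end GPML

namespace GPML

/-! ### Taylor estimates along segments in parameter space. -/

section Calculus

theorem abs_sub_le_of_hasDerivAt {φ φ' : ℝ → ℝ} {M : ℝ}
    (h : ∀ s ∈ Set.Icc (0 : ℝ) 1, HasDerivAt φ (φ' s) s)
    (hM : ∀ s ∈ Set.Icc (0 : ℝ) 1, |φ' s| ≤ M) {s : ℝ} (hs : s ∈ Set.Icc (0 : ℝ) 1) :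
    |φ s - φ 0| ≤ M := by
  have h1 := norm_image_sub_le_of_norm_deriv_le_segment' (f := φ) (f' := φ') (C := M)
    (a := 0) (b := 1) (fun x hx => (h x hx).hasDerivWithinAt)
    (fun x hx => hM x ⟨hx.1, hx.2.le⟩) s hs
  have hM0 : 0 ≤ M := (abs_nonneg _).trans (hM s hs)
  rw [Real.norm_eq_abs, sub_zero] at h1
  exact h1.trans (mul_le_of_le_one_right hM0 hs.2)

/-- The mean value inequality is applied three times, from the third derivative upwards. The
constant M, instead of M/6, is not sharp but suffices. -/
theorem abs_taylor_three_le {φ φ₁ φ₂ φ₃ : ℝ → ℝ} {M : ℝ}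
    (h0 : ∀ s ∈ Set.Icc (0 : ℝ) 1, HasDerivAt φ (φ₁ s) s)
    (h1 : ∀ s ∈ Set.Icc (0 : ℝ) 1, HasDerivAt φ₁ (φ₂ s) s)
    (h2 : ∀ s ∈ Set.Icc (0 : ℝ) 1, HasDerivAt φ₂ (φ₃ s) s)
    (hM : ∀ s ∈ Set.Icc (0 : ℝ) 1, |φ₃ s| ≤ M) :
    |φ 1 - φ 0 - φ₁ 0 - φ₂ 0 / 2| ≤ M := by
  have a2 : ∀ s ∈ Set.Icc (0 : ℝ) 1, |φ₂ s - φ₂ 0| ≤ M := fun s hs =>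
    abs_sub_le_of_hasDerivAt h2 hM hs
  have a1 : ∀ s ∈ Set.Icc (0 : ℝ) 1, |φ₁ s - φ₁ 0 - s * φ₂ 0| ≤ M := fun s hs => by
    have := abs_sub_le_of_hasDerivAt (φ := fun s => φ₁ s - s * φ₂ 0) (φ' := fun s => φ₂ s - φ₂ 0)
      (M := M) (fun s hs => ((h1 s hs).sub ((hasDerivAt_id s).mul_const (φ₂ 0))).congr_deriv
        (by simp)) a2 hs
    convert this using 2; ring
  have := abs_sub_le_of_hasDerivAt (φ := fun s => φ s - s * φ₁ 0 - s ^ 2 * (φ₂ 0 / 2))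
    (φ' := fun s => φ₁ s - φ₁ 0 - s * φ₂ 0)
    (M := M) (fun s hs => (((h0 s hs).sub ((hasDerivAt_id s).mul_const (φ₁ 0))).sub
      ((hasDerivAt_pow 2 s).mul_const (φ₂ 0 / 2))).congr_deriv
        (by simp; ring)) a1 (s := 1) (by simp)
  convert this using 2; ring

variable {p : ℕ}

theorem fderiv_apply_eq_sum_pderiv (g : EuclideanSpace ℝ (Fin p) → ℝ)
    (θ t : EuclideanSpace ℝ (Fin p)) : fderiv ℝ g θ t = ∑ i, t i * pderiv i g θ := by
  have h : t = ∑ i, t i • EuclideanSpace.single i (1 : ℝ) := by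
    conv_lhs => rw [← (EuclideanSpace.basisFun (Fin p) ℝ).sum_repr t]
    simp
  conv_lhs => rw [h, map_sum]
  simp [pderiv]

theorem hasDerivAt_line {g : EuclideanSpace ℝ (Fin p) → ℝ} {θ t : EuclideanSpace ℝ (Fin p)}
    {s : ℝ} (hg : DifferentiableAt ℝ g (θ + s • t)) :
    HasDerivAt (fun s : ℝ => g (θ + s • t)) (∑ i, t i * pderiv i g (θ + s • t)) s := by
  rw [← fderiv_apply_eq_sum_pderiv]
  have hl : HasDerivAt (fun s : ℝ => θ + s • t) t s := by
    simpa using ((hasDerivAt_id s).smul_const t).const_add θ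
  exact hg.hasFDerivAt.comp_hasDerivAt s hl

theorem contDiffOn_pderiv {g : EuclideanSpace ℝ (Fin p) → ℝ} {U : Set (EuclideanSpace ℝ (Fin p))}
    (hU : IsOpen U) {m n : WithTop ℕ∞} (hg : ContDiffOn ℝ n g U) (hmn : m + 1 ≤ n) (i : Fin p) :
    ContDiffOn ℝ m (pderiv i g) U :=
  (hg.fderiv_of_isOpen hU hmn).clm_apply contDiffOn_const

theorem abs_apply_le_norm (t : EuclideanSpace ℝ (Fin p)) (i : Fin p) : |t i| ≤ ‖t‖ :=
  PiLp.norm_apply_le t i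

theorem abs_sum_mul_le {t : EuclideanSpace ℝ (Fin p)} {a : Fin p → ℝ} {M : ℝ}
    (ha : ∀ i, |a i| ≤ M) : |∑ i, t i * a i| ≤ p * (‖t‖ * M) := by
  refine (Finset.abs_sum_le_sum_abs _ _).trans ?_
  calc ∑ i, |t i * a i| ≤ ∑ _i : Fin p, ‖t‖ * M := Finset.sum_le_sum fun i _ => by
        rw [abs_mul]
        exact mul_le_mul (abs_apply_le_norm t i) (ha i) (abs_nonneg _) (norm_nonneg _)
    _ = _ := by simp

theorem abs_sub_le_of_pderiv_le {g : EuclideanSpace ℝ (Fin p) → ℝ}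
    {U : Set (EuclideanSpace ℝ (Fin p))} (hU : IsOpen U) (hg : ContDiffOn ℝ 1 g U)
    {θ θ' : EuclideanSpace ℝ (Fin p)} {M : ℝ} (hs : segment ℝ θ θ' ⊆ U)
    (hM : ∀ x ∈ segment ℝ θ θ', ∀ i, |pderiv i g x| ≤ M) :
    |g θ' - g θ| ≤ p * (‖θ' - θ‖ * M) := by
  have hseg : ∀ s ∈ Set.Icc (0 : ℝ) 1, θ + s • (θ' - θ) ∈ segment ℝ θ θ' := fun s hs => by
    rw [segment_eq_image']; exact ⟨s, hs, rfl⟩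
  have := abs_sub_le_of_hasDerivAt (φ := fun s : ℝ => g (θ + s • (θ' - θ)))
    (φ' := fun s => ∑ i, (θ' - θ) i * pderiv i g (θ + s • (θ' - θ))) (M := p * (‖θ' - θ‖ * M))
    (fun s hs' => hasDerivAt_line ((hg.differentiableOn (by norm_num)).differentiableAt
      (hU.mem_nhds (hs (hseg s hs')))))
    (fun s hs' => abs_sum_mul_le fun i => hM _ (hseg s hs') i) (s := 1) (by simp)
  simpa using this

theorem abs_taylor_pderiv_le {g : EuclideanSpace ℝ (Fin p) → ℝ}
    {U : Set (EuclideanSpace ℝ (Fin p))} (hU : IsOpen U) (hg : ContDiffOn ℝ 3 g U)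
    {θ t : EuclideanSpace ℝ (Fin p)} {M : ℝ} (hs : ∀ s ∈ Set.Icc (0 : ℝ) 1, θ + s • t ∈ U)
    (hM : ∀ s ∈ Set.Icc (0 : ℝ) 1, ∀ i j l,
      |pderiv i (pderiv j (pderiv l g)) (θ + s • t)| ≤ M) :
    |g (θ + t) - g θ - ∑ l, t l * pderiv l g θ
      - (∑ l, t l * ∑ j, t j * pderiv j (pderiv l g) θ) / 2| ≤ (p : ℝ) ^ 3 * ‖t‖ ^ 3 * M := by
  have g1 : ∀ l, ContDiffOn ℝ 2 (pderiv l g) U := fun l =>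
    contDiffOn_pderiv hU hg (by norm_num) l
  have g2 : ∀ j l, ContDiffOn ℝ 1 (pderiv j (pderiv l g)) U := fun j l =>
    contDiffOn_pderiv hU (g1 l) (by norm_num) j
  have hd : ∀ {g' : EuclideanSpace ℝ (Fin p) → ℝ} {n : WithTop ℕ∞}, ContDiffOn ℝ n g' U → n ≠ 0 →
      ∀ s ∈ Set.Icc (0 : ℝ) 1, HasDerivAt (fun s : ℝ => g' (θ + s • t))
        (∑ i, t i * pderiv i g' (θ + s • t)) s := fun h hn s hs' =>
    hasDerivAt_line ((h.differentiableOn hn).differentiableAt (hU.mem_nhds (hs s hs')))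
  have key := abs_taylor_three_le (φ := fun s => g (θ + s • t))
    (φ₁ := fun s => ∑ l, t l * pderiv l g (θ + s • t))
    (φ₂ := fun s => ∑ l, t l * ∑ j, t j * pderiv j (pderiv l g) (θ + s • t))
    (φ₃ := fun s => ∑ l, t l * ∑ j, t j * ∑ i, t i * pderiv i (pderiv j (pderiv l g)) (θ + s • t))
    (M := p * (‖t‖ * (p * (‖t‖ * (p * (‖t‖ * M))))))
    (hd hg (by norm_num))
    (fun s hs' => HasDerivAt.fun_sum fun l _ => (hd (g1 l) (by norm_num) s hs').const_mul _)
    (fun s hs' => HasDerivAt.fun_sum fun l _ => HasDerivAt.const_mul _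
      (HasDerivAt.fun_sum fun j _ => (hd (g2 j l) (by norm_num) s hs').const_mul _))
    (fun s hs' => abs_sum_mul_le fun l => abs_sum_mul_le fun j => abs_sum_mul_le fun i =>
      hM s hs' i j l)
  simp only [one_smul, zero_smul, add_zero] at key
  refine key.trans (le_of_eq ?_)
  ring

/-- K agrees with k, and k is even on differences, only for θ in Θ. As Θ is a neighbourhood of θ₀
the germs agree, and stating the conclusion for germs allows iteration to second derivatives. -/
theorem pderiv_congr {g g' : EuclideanSpace ℝ (Fin p) → ℝ} {θ : EuclideanSpace ℝ (Fin p)}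
    (h : g =ᶠ[𝓝 θ] g') (i : Fin p) : pderiv i g =ᶠ[𝓝 θ] pderiv i g' := by
  filter_upwards [h.fderiv (𝕜 := ℝ)] with x hx
  simp only [pderiv, hx]

end Calculus

/-! ### The abstract regular model and the norm of inverse covariance matrices. -/

section Model

open scoped Matrix.Norms.L2Operator

/-- Uniform regularity of a family of covariance matrices `R n θ`, with first and second
derivatives `D n i` and `D₂ n i j` at `θ₀`. -/
structure RegularModel {p : ℕ} (Θ : Set (EuclideanSpace ℝ (Fin p)))
    (θ₀ : EuclideanSpace ℝ (Fin p))
    (R : (n : ℕ) → EuclideanSpace ℝ (Fin p) → Matrix (Fin n) (Fin n) ℝ)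
    (D : (n : ℕ) → Fin p → Matrix (Fin n) (Fin n) ℝ)
    (D₂ : (n : ℕ) → Fin p → Fin p → Matrix (Fin n) (Fin n) ℝ) (C : ℝ) : Prop where
  one_le : 1 ≤ C
  compact : IsCompact Θ
  mem_nhds : Θ ∈ 𝓝 θ₀
  posDef : ∀ n, ∀ θ ∈ Θ, (R n θ).PosDef
  norm_le : ∀ n, ∀ θ ∈ Θ, ‖R n θ‖ ≤ C
  norm_inv_le : ∀ n, ∀ θ ∈ Θ, ‖(R n θ)⁻¹‖ ≤ C
  lipschitz : ∃ δ, 0 < δ ∧ ∀ n, ∀ θ ∈ Θ, ∀ θ' ∈ Θ, dist θ θ' < δ →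
    ‖R n θ' - R n θ‖ ≤ C * dist θ θ'
  isHermitian : ∀ n i, (D n i).IsHermitian
  norm_deriv_le : ∀ n i, ‖D n i‖ ≤ C
  norm_deriv₂_le : ∀ n i j, ‖D₂ n i j‖ ≤ C
  taylor : ∃ r, 0 < r ∧ ∀ n, ∀ t : EuclideanSpace ℝ (Fin p), ‖t‖ ≤ r → θ₀ + t ∈ Θ ∧
    ‖R n (θ₀ + t) - R n θ₀ - ∑ i, t i • D n i
      - (1 / 2 : ℝ) • ∑ i, ∑ j, (t i * t j) • D₂ n i j‖ ≤ C * ‖t‖ ^ 3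
  separates : ∀ α, 0 < α → ∃ ε, 0 < ε ∧ ∀ᶠ n : ℕ in atTop, ∀ θ ∈ Θ, α ≤ ‖θ - θ₀‖ →
    ε * (n : ℝ) ≤ frobSq (R n θ - R n θ₀)
  independent : ∀ l : Fin p → ℝ, l ≠ 0 → ∃ ε, 0 < ε ∧ ∀ᶠ n : ℕ in atTop,
    ε * (n : ℝ) ≤ frobSq (∑ i, l i • D n i)

theorem posDef_and_norm_inv_le {n : ℕ} {A : Matrix (Fin n) (Fin n) ℝ} (hA : A.IsHermitian) {c : ℝ}
    (hc : 0 < c) (h : (c : EReal) ≤ lambdaMin A) : A.PosDef ∧ ‖A⁻¹‖ ≤ 1 / c := by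
  have hev : ∀ i, c ≤ hA.eigenvalues i := fun i => by
    have := h.trans (iInf₂_le _ (hA.eigenvalues_mem_spectrum_real i))
    exact_mod_cast this
  have hp : A.PosDef := hA.posDef_iff_eigenvalues_pos.2 fun i => hc.trans_le (hev i)
  refine ⟨hp, ?_⟩
  set U : Matrix (Fin n) (Fin n) ℝ := (hA.eigenvectorUnitary : Matrix (Fin n) (Fin n) ℝ) with hU
  have hu1 : Uᴴ * U = 1 := (Unitary.mem_iff.1 hA.eigenvectorUnitary.2).1
  have hu2 : U * Uᴴ = 1 := (Unitary.mem_iff.1 hA.eigenvectorUnitary.2).2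
  have hspec : A = U * diagonal hA.eigenvalues * Uᴴ := by
    have := hA.spectral_theorem
    rw [Unitary.conjStarAlgAut_apply, star_eq_conjTranspose] at this
    exact this
  have hinv : A⁻¹ = U * diagonal (fun i => (hA.eigenvalues i)⁻¹) * Uᴴ := by
    refine inv_eq_right_inv ?_
    have e : A * (U * diagonal (fun i => (hA.eigenvalues i)⁻¹) * Uᴴ)
        = U * (diagonal hA.eigenvalues * ((Uᴴ * U) * diagonal (fun i => (hA.eigenvalues i)⁻¹)))
          * Uᴴ := by
      refine (congrArg (· * (U * diagonal (fun i => (hA.eigenvalues i)⁻¹) * Uᴴ)) hspec).trans ?_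
      simp only [Matrix.mul_assoc]
    have e2 : diagonal hA.eigenvalues * diagonal (fun i => (hA.eigenvalues i)⁻¹) = 1 := by
      rw [diagonal_mul_diagonal, ← diagonal_one]
      congr 1; ext i
      exact mul_inv_cancel₀ (hc.trans_le (hev i)).ne'
    rw [e, hu1, Matrix.one_mul, e2, Matrix.mul_one, hu2]
  -- Not an equality: for n = 0 the identity matrix has norm 0.
  have hUn : ‖U‖ * ‖U‖ ≤ 1 := by
    rw [← l2_opNorm_conjTranspose_mul_self, hu1, ← diagonal_one, l2_opNorm_diagonal]
    exact (pi_norm_le_iff_of_nonneg zero_le_one).2 fun i => by simp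
  rw [hinv]
  have hdn : ‖(diagonal (fun i => (hA.eigenvalues i)⁻¹) : Matrix (Fin n) (Fin n) ℝ)‖ ≤ 1 / c := by
    rw [l2_opNorm_diagonal]
    refine (pi_norm_le_iff_of_nonneg (by positivity)).2 fun i => ?_
    have := hc.trans_le (hev i)
    rw [Real.norm_eq_abs, abs_of_pos (by positivity), one_div]
    exact inv_anti₀ hc (hev i)
  calc _ ≤ ‖U‖ * (1 / c) * ‖Uᴴ‖ := by
        refine (norm_mul_le _ _).trans ?_
        gcongr
        exact (norm_mul_le _ _).trans (by gcongr)
    _ = ‖U‖ * ‖U‖ * (1 / c) := by rw [l2_opNorm_conjTranspose]; ring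
    _ ≤ 1 * (1 / c) := by gcongr
    _ = _ := one_mul _

end Model

end GPML

namespace GPML

/-! ### From decay, separation and smoothness of the kernel to a regular model. -/

section Construction

open scoped Matrix.Norms.L2Operator

theorem exists_lt_of_zero_lt_liminf {u : ℕ → EReal} (h : 0 < liminf u atTop) :
    ∃ ε : ℝ, 0 < ε ∧ ∀ᶠ n in atTop, (ε : EReal) < u n := by
  obtain ⟨ε, h1, h2⟩ := EReal.lt_iff_exists_real_btwn.1 h
  exact ⟨ε, by exact_mod_cast h1, eventually_lt_of_lt_liminf h2⟩

theorem mul_le_of_lt_one_div_mul {ε x : ℝ} {n : ℕ} (h : ε < 1 / (n : ℝ) * x) (hx : 0 ≤ x) :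
    ε * n ≤ x := by
  rcases n.eq_zero_or_pos with rfl | hn
  · simpa using hx
  · have : (0 : ℝ) < n := by exact_mod_cast hn
    rw [one_div, inv_mul_eq_div, lt_div_iff₀ this] at h
    exact h.le

/-- The second-order analogue of `dcovMatrix`. -/
noncomputable def d2covMatrix {p : ℕ} {H : Type*} [Sub H] (k : EuclideanSpace ℝ (Fin p) → H → ℝ)
    (f : (n : ℕ) → Fin n → H) (n : ℕ) (i j : Fin p) (θ : EuclideanSpace ℝ (Fin p)) :
    Matrix (Fin n) (Fin n) ℝ :=
  Matrix.of fun a b => pderiv j (pderiv i fun θ' => k θ' (f n a - f n b)) θ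

variable {𝕜 H : Type*} [RCLike 𝕜] [NormedAddCommGroup H] [InnerProductSpace 𝕜 H]

/-- Schur's test combined with the uniform row sums. It turns every entrywise kernel estimate into
an operator norm estimate independent of n. -/
theorem exists_norm_le_of_decay {N : ℕ∞} (e : HilbertBasis (BasisIndex N) 𝕜 H)
    {f : (n : ℕ) → Fin n → H} {Δ : ℝ} (hΔ : 0 < Δ) {d₀ : ℕ}
    (hsep : ∀ n, ∀ i j : Fin n, i ≠ j →
      Δ ≤ ‖basisTruncation e d₀ (f n j) - basisTruncation e d₀ (f n i)‖)
    {γ : ℝ} (hγ : ((Module.finrank ℝ 𝕜 * d₀ : ℕ) : ℝ) < γ) :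
    ∃ C : ℝ, 0 < C ∧ ∀ n (A : Matrix (Fin n) (Fin n) ℝ) (B : ℝ), A.IsHermitian → 0 ≤ B →
      (∀ a b, |A a b| ≤ B * (1 / (1 + ‖f n a - f n b‖ ^ γ))) → ‖A‖ ≤ C * B := by
  obtain ⟨C, hC, h⟩ := exists_rowSum_le e hΔ hsep hγ
  refine ⟨C, hC, fun n A B hA hB hAB => norm_le_of_rowSum hA (by positivity) fun i => ?_⟩
  refine (Finset.sum_le_sum fun j _ => hAB i j).trans ?_
  rw [← Finset.mul_sum, mul_comm]
  gcongr
  exact h n i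

theorem DecaysUniformly.exists_forall {ι E H' : Type*} [Finite ι] [NormedAddCommGroup H']
    {g : ι → E → H' → ℝ} {V : Set E} {γ : ℝ} (h : ∀ i, DecaysUniformly (g i) V γ) :
    ∃ C : ℝ, 0 < C ∧ ∀ i, ∀ θ ∈ V, ∀ x, |g i θ x| ≤ C * (1 / (1 + ‖x‖ ^ γ)) := by
  have := Fintype.ofFinite ι
  choose C hC hb using h
  have hs : 0 ≤ ∑ i, C i := Finset.sum_nonneg fun i _ => (hC i).le
  refine ⟨1 + ∑ i, C i, by positivity, fun i θ hθ x => (hb i θ hθ x).trans ?_⟩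
  have h0 : 0 ≤ ‖x‖ ^ γ := Real.rpow_nonneg (norm_nonneg _) _
  rw [div_eq_mul_one_div]
  gcongr
  have := Finset.single_le_sum (f := C) (fun j _ => (hC j).le) (Finset.mem_univ i)
  linarith

/-- The rest of the asymptotics rests on this interface. The values, the first derivatives and the
higher derivatives use the exponents γ₀, γ₁ and γ₂ respectively. -/
theorem exists_regularModel {N : ℕ∞} (e : HilbertBasis (BasisIndex N) 𝕜 H)
    {p : ℕ} {Θ : Set (EuclideanSpace ℝ (Fin p))} (hΘ : IsCompact Θ)
    {θ₀ : EuclideanSpace ℝ (Fin p)} (hθ₀ : θ₀ ∈ interior Θ)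
    {K : EuclideanSpace ℝ (Fin p) → H → H → ℝ} {k : EuclideanSpace ℝ (Fin p) → H → ℝ}
    (hK : ∀ θ ∈ Θ, IsCovarianceFunction (K θ))
    (hstat : ∀ θ ∈ Θ, ∀ g h, K θ g h = k θ (g - h))
    {f : (n : ℕ) → Fin n → H} {Δ : ℝ} (hΔ : 0 < Δ) {d₀ : ℕ}
    (hsep : ∀ n, ∀ i j : Fin n, i ≠ j →
      Δ ≤ ‖basisTruncation e d₀ (f n j) - basisTruncation e d₀ (f n i)‖)
    {γ₀ : ℝ} (hγ₀ : ((Module.finrank ℝ 𝕜 * d₀ : ℕ) : ℝ) < γ₀)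
    (hdecay : DecaysUniformly k Θ γ₀)
    {c : ℝ} (hc : 0 < c) (hmin : ∀ θ ∈ Θ, ∀ n, (c : EReal) ≤ lambdaMin (covMatrix K f n θ))
    (hident : AsymptoticallySeparates K f Θ θ₀)
    (hindep : AsymptoticallyIndependentDerivatives K f θ₀)
    {U V : Set (EuclideanSpace ℝ (Fin p))} (hU : IsOpen U) (hVU : V ⊆ U)
    (hV : ∃ δ : ℝ, 0 < δ ∧ ∀ θ ∈ Θ, ∀ θ' ∈ Θ, dist θ θ' < δ → segment ℝ θ θ' ⊆ V)
    {γ₁ : ℝ} (hγ₁ : ((Module.finrank ℝ 𝕜 * d₀ : ℕ) : ℝ) < γ₁)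
    (hdecay1 : ∀ i, DecaysUniformly (fun θ h => pderiv i (fun θ' => k θ' h) θ) V γ₁)
    (hC3 : ∀ h : H, ContDiffOn ℝ 3 (fun θ => k θ h) U)
    {γ₂ : ℝ} (hγ₂ : ((Module.finrank ℝ 𝕜 * d₀ : ℕ) : ℝ) < γ₂)
    (hdecay2 : ∀ i j, DecaysUniformly
      (fun θ h => pderiv i (pderiv j (fun θ' => k θ' h)) θ) Θ γ₂)
    (hdecay3 : ∀ i j l, DecaysUniformly
      (fun θ h => pderiv i (pderiv j (pderiv l (fun θ' => k θ' h))) θ) Θ γ₂) :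
    ∃ C, RegularModel Θ θ₀ (covMatrix K f) (fun n i => dcovMatrix K f n i θ₀)
      (fun n i j => d2covMatrix k f n i j θ₀) C := by
  have hmem : Θ ∈ 𝓝 θ₀ := mem_interior_iff_mem_nhds.1 hθ₀
  have hθ₀' : θ₀ ∈ Θ := mem_of_mem_nhds hmem
  obtain ⟨δ, hδ, hV⟩ := hV
  -- The degenerate segment from θ to itself.
  have hΘV : Θ ⊆ V := fun θ hθ => hV θ hθ θ hθ (by simpa using hδ) (left_mem_segment ℝ θ θ)
  have hΘU : Θ ⊆ U := hΘV.trans hVU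
  obtain ⟨N₀, hN₀, hnorm₀⟩ := exists_norm_le_of_decay e hΔ hsep hγ₀
  obtain ⟨N₁, hN₁, hnorm₁⟩ := exists_norm_le_of_decay e hΔ hsep hγ₁
  obtain ⟨N₂, hN₂, hnorm₂⟩ := exists_norm_le_of_decay e hΔ hsep hγ₂
  obtain ⟨B₀, hB₀, hb₀⟩ := DecaysUniformly.exists_forall (ι := Unit) (fun _ => hdecay)
  obtain ⟨B₁, hB₁, hb₁⟩ := DecaysUniformly.exists_forall hdecay1
  obtain ⟨B₂, hB₂, hb₂⟩ := DecaysUniformly.exists_forall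
    (g := fun (q : Fin p × Fin p) θ h => pderiv q.1 (pderiv q.2 (fun θ' => k θ' h)) θ)
    (fun q => hdecay2 q.1 q.2)
  obtain ⟨B₃, hB₃, hb₃⟩ := DecaysUniformly.exists_forall
    (g := fun (q : Fin p × Fin p × Fin p) θ h =>
      pderiv q.1 (pderiv q.2.1 (pderiv q.2.2 (fun θ' => k θ' h))) θ)
    (fun q => hdecay3 q.1 q.2.1 q.2.2)
  have hherm : ∀ n, ∀ θ ∈ Θ, (covMatrix K f n θ).IsHermitian := fun n θ hθ => (hK θ hθ n (f n)).1
  -- Evenness comes from symmetry of the 2 × 2 covariance matrix at (g, h); it makes the derivative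
  -- matrices symmetric, as Schur's test requires.
  have hksymm : ∀ θ ∈ Θ, ∀ g h, k θ (g - h) = k θ (h - g) := fun θ hθ g h => by
    have h2 := (hK θ hθ 2 ![g, h]).1.apply 0 1
    simp at h2
    rw [← hstat θ hθ, ← hstat θ hθ, h2]
  have hkev : ∀ g h, (fun θ => k θ (g - h)) =ᶠ[𝓝 θ₀] fun θ => k θ (h - g) := fun g h => by
    filter_upwards [hmem] with θ hθ using hksymm θ hθ g h
  have hKk : ∀ g h, (fun θ => K θ g h) =ᶠ[𝓝 θ₀] fun θ => k θ (g - h) := fun g h => by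
    filter_upwards [hmem] with θ hθ using hstat θ hθ g h
  have hD : ∀ n i a b, dcovMatrix K f n i θ₀ a b
      = pderiv i (fun θ => k θ (f n a - f n b)) θ₀ := fun n i a b =>
    (pderiv_congr (hKk (f n a) (f n b)) i).eq_of_nhds
  have hDherm : ∀ n i, (dcovMatrix K f n i θ₀).IsHermitian := fun n i => by
    refine IsHermitian.ext fun a b => ?_
    rw [hD, hD, star_trivial]
    exact (pderiv_congr (hkev _ _) i).eq_of_nhds
  have hD2herm : ∀ n i j, (d2covMatrix k f n i j θ₀).IsHermitian := fun n i j => by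
    refine IsHermitian.ext fun a b => ?_
    rw [star_trivial]
    exact (pderiv_congr (pderiv_congr (hkev _ _) i) j).eq_of_nhds
  -- One summand for each norm bound required below, so that a single C serves them all.
  set C : ℝ := 1 + N₀ * B₀ + 1 / c + N₁ * (p * B₁) + N₁ * B₁ + N₂ * B₂ + N₂ * ((p : ℝ) ^ 3 * B₃)
    with hC
  have q0 : 0 ≤ N₀ * B₀ := by positivity
  have qc : 0 ≤ 1 / c := by positivity
  have q1 : 0 ≤ N₁ * (p * B₁) := by positivity
  have q1' : 0 ≤ N₁ * B₁ := by positivity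
  have q2 : 0 ≤ N₂ * B₂ := by positivity
  have q3 : 0 ≤ N₂ * ((p : ℝ) ^ 3 * B₃) := by positivity
  refine ⟨C, ⟨by linarith, hΘ, hmem, ?_, ?_, ?_, ?_, hDherm, ?_, ?_, ?_, ?_, ?_⟩⟩
  · exact fun n θ hθ => (posDef_and_norm_inv_le (hherm n θ hθ) hc (hmin θ hθ n)).1
  · intro n θ hθ
    have := hnorm₀ n (covMatrix K f n θ) B₀ (hherm n θ hθ) hB₀.le fun a b => by
      have := hb₀ () θ hθ (f n a - f n b)
      rwa [← hstat θ hθ] at this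
    linarith
  · intro n θ hθ
    have := (posDef_and_norm_inv_le (hherm n θ hθ) hc (hmin θ hθ n)).2
    linarith
  · refine ⟨δ, hδ, fun n θ hθ θ' hθ' hd => ?_⟩
    have hs := hV θ hθ θ' hθ' hd
    have := hnorm₁ n (covMatrix K f n θ' - covMatrix K f n θ) (p * (‖θ' - θ‖ * B₁))
      ((hherm n θ' hθ').sub (hherm n θ hθ)) (by positivity) fun a b => by
        have h1 := abs_sub_le_of_pderiv_le (g := fun θ => k θ (f n a - f n b)) hU
          ((hC3 _).of_le (by norm_num)) (hs.trans hVU)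
          (fun x hx i => hb₁ i x (hs hx) (f n a - f n b))
        rw [Matrix.sub_apply]
        simp only [covMatrix, of_apply, hstat θ hθ, hstat θ' hθ']
        refine h1.trans (le_of_eq ?_)
        ring
    refine this.trans ?_
    rw [dist_comm, dist_eq_norm]
    calc N₁ * (p * (‖θ' - θ‖ * B₁)) = (N₁ * (p * B₁)) * ‖θ' - θ‖ := by ring
      _ ≤ C * ‖θ' - θ‖ := by gcongr; linarith
  · intro n i
    have := hnorm₁ n (dcovMatrix K f n i θ₀) B₁ (hDherm n i) hB₁.le fun a b => by
      rw [hD]; exact hb₁ i θ₀ (hΘV hθ₀') _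
    linarith
  · intro n i j
    have := hnorm₂ n (d2covMatrix k f n i j θ₀) B₂ (hD2herm n i j) hB₂.le fun a b =>
      hb₂ (j, i) θ₀ hθ₀' _
    linarith
  -- A ball inside Θ keeps the whole segment from θ₀ to θ₀ + t in Θ, where third derivatives are
  -- controlled.
  · obtain ⟨r, hr, hball⟩ := Metric.nhds_basis_closedBall.mem_iff.1 hmem
    have hin : ∀ t : EuclideanSpace ℝ (Fin p), ‖t‖ ≤ r → θ₀ + t ∈ Θ := fun t ht =>
      hball (by simpa [dist_eq_norm] using ht)
    refine ⟨r, hr, fun n t ht => ⟨hin t ht, ?_⟩⟩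
    have hseg : ∀ s ∈ Set.Icc (0 : ℝ) 1, θ₀ + s • t ∈ Θ := fun s hs => hin _ (by
      rw [norm_smul, Real.norm_eq_abs, abs_of_nonneg hs.1]
      exact (mul_le_of_le_one_left (norm_nonneg _) hs.2).trans ht)
    have hherm' : (∑ i, t i • dcovMatrix K f n i θ₀).IsHermitian := by
      simp only [IsHermitian, conjTranspose_sum, conjTranspose_smul, star_trivial,
        (hDherm _ _).eq]
    have hherm2 : ((1 / 2 : ℝ) • ∑ i, ∑ j, (t i * t j) • d2covMatrix k f n i j θ₀).IsHermitian := by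
      simp only [IsHermitian, conjTranspose_sum, conjTranspose_smul, star_trivial,
        (hD2herm _ _ _).eq]
    have := hnorm₂ n _ ((p : ℝ) ^ 3 * ‖t‖ ^ 3 * B₃)
      ((((hherm n _ (hin t ht)).sub (hherm n θ₀ hθ₀')).sub hherm').sub hherm2) (by positivity)
      fun a b => by
        have h1 := abs_taylor_pderiv_le (g := fun θ => k θ (f n a - f n b)) hU (hC3 _)
          (fun s hs => hΘU (hseg s hs))
          (fun s hs i j l => hb₃ (i, j, l) _ (hseg s hs) (f n a - f n b))
        simp only [Matrix.sub_apply, Matrix.smul_apply, Matrix.sum_apply, hD, d2covMatrix, covMatrix,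
          of_apply, smul_eq_mul, hstat _ (hin t ht), hstat _ hθ₀']
        refine le_trans (le_of_eq ?_) (h1.trans (le_of_eq (by ring)))
        congr 2
        rw [one_div, inv_mul_eq_div]
        congr 1
        refine Finset.sum_congr rfl fun i _ => ?_
        rw [Finset.mul_sum]
        exact Finset.sum_congr rfl fun j _ => by ring
    refine this.trans ?_
    calc N₂ * ((p : ℝ) ^ 3 * ‖t‖ ^ 3 * B₃) = (N₂ * ((p : ℝ) ^ 3 * B₃)) * ‖t‖ ^ 3 := by ring
      _ ≤ C * ‖t‖ ^ 3 := by gcongr; linarith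
  · intro α hα
    obtain ⟨ε, hε, hev⟩ := exists_lt_of_zero_lt_liminf (hident α hα)
    refine ⟨ε, hε, ?_⟩
    filter_upwards [hev] with n hn θ hθ hθα
    have h1 := hn.trans_le (iInf₂_le θ ⟨hθ, hθα⟩)
    exact mul_le_of_lt_one_div_mul (by exact_mod_cast h1) (frobSq_nonneg _)
  · intro l hl
    obtain ⟨ε, hε, hev⟩ := exists_lt_of_zero_lt_liminf (hindep l hl)
    refine ⟨ε, hε, ?_⟩
    filter_upwards [hev] with n hn
    have h1 : ε < (1 / (n : ℝ)) * frobSq (∑ i, l i • dcovMatrix K f n i θ₀) := by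
      have h2 := EReal.coe_lt_coe_iff.1 hn
      convert h2 using 2
      simp only [frobSq, Matrix.sum_apply, Matrix.smul_apply, smul_eq_mul, dcovMatrix, of_apply]
    exact mul_le_of_lt_one_div_mul h1 (frobSq_nonneg _)

end Construction

end GPML

namespace GPML

/-! ### Two-sided bounds on the information matrix. -/

section Information

open scoped Matrix.Norms.L2Operator

variable {p : ℕ}

/-- The directional derivative `∑ᵢ uᵢ Dᵢ`. -/
def dirDeriv {ι : Type*} (D : Fin p → Matrix ι ι ℝ) (u : Fin p → ℝ) : Matrix ι ι ℝ :=
  ∑ i, u i • D i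

theorem dirDeriv_add {ι : Type*} (D : Fin p → Matrix ι ι ℝ) (u v : Fin p → ℝ) :
    dirDeriv D (u + v) = dirDeriv D u + dirDeriv D v := by
  simp [dirDeriv, add_smul, Finset.sum_add_distrib]

theorem dirDeriv_smul {ι : Type*} (D : Fin p → Matrix ι ι ℝ) (c : ℝ) (u : Fin p → ℝ) :
    dirDeriv D (c • u) = c • dirDeriv D u := by
  simp [dirDeriv, Finset.smul_sum, smul_smul]

theorem isHermitian_dirDeriv {ι : Type*} {D : Fin p → Matrix ι ι ℝ}
    (hD : ∀ i, (D i).IsHermitian) (u : Fin p → ℝ) : (dirDeriv D u).IsHermitian := by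
  simp only [IsHermitian, dirDeriv, conjTranspose_sum, conjTranspose_smul, star_trivial, (hD _).eq]

theorem norm_dirDeriv_le {ι : Type*} [Fintype ι] [DecidableEq ι] {D : Fin p → Matrix ι ι ℝ} {C : ℝ}
    (hD : ∀ i, ‖D i‖ ≤ C) (u : EuclideanSpace ℝ (Fin p)) :
    ‖dirDeriv D u.ofLp‖ ≤ p * C * ‖u‖ := by
  refine (norm_sum_le _ _).trans ?_
  calc ∑ i, ‖u i • D i‖ ≤ ∑ _i : Fin p, ‖u‖ * C := Finset.sum_le_sum fun i _ => by
        rw [norm_smul]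
        exact mul_le_mul (abs_apply_le_norm u i) (hD i) (norm_nonneg _) (norm_nonneg _)
    _ = _ := by simp; ring

/-- The Fisher information matrix normalised by `n`, in terms of the covariance matrix and its
derivatives. -/
noncomputable def fisher {n : ℕ} (R : Matrix (Fin n) (Fin n) ℝ)
    (D : Fin p → Matrix (Fin n) (Fin n) ℝ) : Matrix (Fin p) (Fin p) ℝ :=
  Matrix.of fun i j => (1 / (2 * (n : ℝ))) * (R⁻¹ * D i * R⁻¹ * D j).trace

theorem isHermitian_fisher {n : ℕ} (R : Matrix (Fin n) (Fin n) ℝ)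
    (D : Fin p → Matrix (Fin n) (Fin n) ℝ) : (fisher R D).IsHermitian := by
  refine IsHermitian.ext fun i j => ?_
  simp only [fisher, of_apply, star_trivial]
  congr 1
  rw [Matrix.mul_assoc, trace_mul_comm, ← Matrix.mul_assoc]

theorem fisher_quadForm {n : ℕ} (R : Matrix (Fin n) (Fin n) ℝ)
    (D : Fin p → Matrix (Fin n) (Fin n) ℝ) (u : Fin p → ℝ) :
    u ⬝ᵥ fisher R D *ᵥ u
      = (1 / (2 * (n : ℝ))) * (R⁻¹ * dirDeriv D u * R⁻¹ * dirDeriv D u).trace := by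
  simp only [dirDeriv, Matrix.sum_mul, trace_sum, Matrix.mul_smul, Matrix.smul_mul,
    trace_smul, smul_eq_mul, Finset.mul_sum, dotProduct, mulVec, fisher, of_apply]
  rw [Finset.sum_comm]
  exact Finset.sum_congr rfl fun i _ => Finset.sum_congr rfl fun j _ => by ring

/-- Entrywise, the difference of the two sides is (a + 2b)²/2. -/
theorem half_frobSq_sub_le {ι : Type*} [Fintype ι] (A B : Matrix ι ι ℝ) :
    frobSq A / 2 - frobSq B ≤ frobSq (A + B) := by
  simp only [frobSq, Finset.sum_div, ← Finset.sum_sub_distrib, Matrix.add_apply]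
  refine Finset.sum_le_sum fun i _ => Finset.sum_le_sum fun j _ => ?_
  nlinarith [sq_nonneg (A i j + 2 * B i j)]

theorem frobSq_smul {ι : Type*} [Fintype ι] (c : ℝ) (A : Matrix ι ι ℝ) :
    frobSq (c • A) = c ^ 2 * frobSq A := by
  simp only [frobSq, Finset.mul_sum, Matrix.smul_apply, smul_eq_mul, mul_pow]

namespace RegularModel

variable {Θ : Set (EuclideanSpace ℝ (Fin p))} {θ₀ : EuclideanSpace ℝ (Fin p)}
  {R : (n : ℕ) → EuclideanSpace ℝ (Fin p) → Matrix (Fin n) (Fin n) ℝ}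
  {D : (n : ℕ) → Fin p → Matrix (Fin n) (Fin n) ℝ}
  {D₂ : (n : ℕ) → Fin p → Fin p → Matrix (Fin n) (Fin n) ℝ} {C : ℝ}

theorem mem (h : RegularModel Θ θ₀ R D D₂ C) : θ₀ ∈ Θ := mem_of_mem_nhds h.mem_nhds

/-- Independence is assumed direction by direction, with a threshold in n depending on the
direction. Continuity uniform in n and compactness of the unit sphere give one constant and one
threshold; homogeneity does the rest. -/
theorem exists_frobSq_dirDeriv_ge (h : RegularModel Θ θ₀ R D D₂ C) :
    ∃ m, 0 < m ∧ ∀ᶠ n : ℕ in atTop, ∀ u : EuclideanSpace ℝ (Fin p),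
      m * n * ‖u‖ ^ 2 ≤ frobSq (dirDeriv (D n) u.ofLp) := by
  have hC : 0 < C := by linarith [h.one_le]
  have hsphere : ∃ m, 0 < m ∧ ∀ᶠ n : ℕ in atTop,
      ∀ u ∈ Metric.sphere (0 : EuclideanSpace ℝ (Fin p)) 1,
      m * n ≤ frobSq (dirDeriv (D n) u.ofLp) := by
    refine (isCompact_sphere (0 : EuclideanSpace ℝ (Fin p)) 1).induction_on
      (p := fun S => ∃ m, 0 < m ∧ ∀ᶠ n : ℕ in atTop, ∀ u ∈ S,
        m * n ≤ frobSq (dirDeriv (D n) u.ofLp)) ?_ ?_ ?_ ?_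
    · exact ⟨1, one_pos, Eventually.of_forall fun n u hu => hu.elim⟩
    · rintro S T hST ⟨m, hm, hT⟩
      exact ⟨m, hm, hT.mono fun n hn u hu => hn u (hST hu)⟩
    · rintro S T ⟨m, hm, hS⟩ ⟨m', hm', hT⟩
      refine ⟨min m m', lt_min hm hm', ?_⟩
      filter_upwards [hS, hT] with n h1 h2 u hu
      rcases hu with hu | hu
      · refine le_trans ?_ (h1 u hu)
        gcongr; exact min_le_left _ _
      · refine le_trans ?_ (h2 u hu)
        gcongr; exact min_le_right _ _
    · intro u hu
      have hu0 : u.ofLp ≠ 0 := by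
        intro h0
        have : u = 0 := by ext i; simp [h0]
        rw [this] at hu; simp at hu
      obtain ⟨ε, hε, hev⟩ := h.independent u.ofLp hu0
      -- Near u the perturbation has squared Frobenius norm at most nε/4; half of nε minus this
      -- leaves nε/4.
      have hcont : ∀ᶠ v in 𝓝 u, ((p : ℝ) * C * ‖v - u‖) ^ 2 < ε / 4 := by
        have : Continuous fun v => ((p : ℝ) * C * ‖v - u‖) ^ 2 := by fun_prop
        have h2 : Tendsto (fun v => ((p : ℝ) * C * ‖v - u‖) ^ 2) (𝓝 u) (𝓝 0) := by
          simpa using this.tendsto u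
        exact h2.eventually_lt_const (by positivity)
      refine ⟨_, mem_nhdsWithin_of_mem_nhds hcont, ε / 4, by positivity, ?_⟩
      filter_upwards [hev] with n hn v hv
      have e : dirDeriv (D n) v.ofLp = dirDeriv (D n) u.ofLp + dirDeriv (D n) (v - u).ofLp := by
        rw [← dirDeriv_add]; congr 1; simp
      rw [e]
      refine le_trans ?_ (half_frobSq_sub_le _ _)
      have h1 : frobSq (dirDeriv (D n) (v - u).ofLp) ≤ n * (ε / 4) := by
        refine (frobSq_le _).trans ?_
        rw [Fintype.card_fin]
        gcongr
        refine le_trans ?_ (le_of_lt hv)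
        gcongr
        exact norm_dirDeriv_le (h.norm_deriv_le n) _
      have h2 : ε * n ≤ frobSq (dirDeriv (D n) u.ofLp) := hn
      linarith
  obtain ⟨m, hm, hev⟩ := hsphere
  refine ⟨m, hm, ?_⟩
  filter_upwards [hev] with n hn u
  rcases eq_or_ne u 0 with rfl | hu
  · simpa using frobSq_nonneg _
  · have hu' : ‖u‖ ≠ 0 := norm_ne_zero_iff.2 hu
    have h1 := hn (‖u‖⁻¹ • u) (by simp [norm_smul, hu'])
    have e : (‖u‖⁻¹ • u).ofLp = ‖u‖⁻¹ • u.ofLp := rfl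
    rw [e, dirDeriv_smul, frobSq_smul] at h1
    have h2 : 0 < ‖u‖ ^ 2 := by positivity
    calc m * n * ‖u‖ ^ 2 ≤ ((‖u‖⁻¹) ^ 2 * frobSq (dirDeriv (D n) u.ofLp)) * ‖u‖ ^ 2 := by gcongr
      _ = _ := by field_simp

theorem exists_fisher_ge (h : RegularModel Θ θ₀ R D D₂ C) :
    ∃ m, 0 < m ∧ ∀ᶠ n : ℕ in atTop, ∀ u : EuclideanSpace ℝ (Fin p),
      m * ‖u‖ ^ 2 ≤ u.ofLp ⬝ᵥ fisher (R n θ₀) (D n) *ᵥ u.ofLp := by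
  have hC : 0 < C := by linarith [h.one_le]
  obtain ⟨m, hm, hev⟩ := h.exists_frobSq_dirDeriv_ge
  refine ⟨m / (2 * C ^ 2), by positivity, ?_⟩
  filter_upwards [hev, eventually_ge_atTop 1] with n hn hn1 u
  have hn0 : (0 : ℝ) < n := by exact_mod_cast hn1
  rw [fisher_quadForm]
  have h1 := frobSq_le_mul_trace (h.posDef n θ₀ h.mem)
    (isHermitian_dirDeriv (h.isHermitian n) u.ofLp)
  set T := ((R n θ₀)⁻¹ * dirDeriv (D n) u.ofLp * (R n θ₀)⁻¹ * dirDeriv (D n) u.ofLp).trace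
  have h2 : m * n * ‖u‖ ^ 2 ≤ ‖R n θ₀‖ ^ 2 * T := (hn u).trans h1
  -- A negative T would force ‖R‖ = 0, impossible for a positive definite matrix of size n ≥ 1.
  have hT : 0 ≤ T := by
    by_contra hT
    push Not at hT
    have h3 : 0 ≤ ‖R n θ₀‖ ^ 2 * T := le_trans (by positivity) h2
    have h4 : ‖R n θ₀‖ = 0 := by
      by_contra h4
      have : 0 < ‖R n θ₀‖ ^ 2 := by positivity
      nlinarith
    have h5 : (R n θ₀) = 0 := norm_eq_zero.1 h4
    have h6 := (h.posDef n θ₀ h.mem).diag_pos (i := ⟨0, hn1⟩)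
    rw [h5] at h6
    simp at h6
  have h7 : m * n * ‖u‖ ^ 2 ≤ C ^ 2 * T :=
    h2.trans (by gcongr; exact h.norm_le n θ₀ h.mem)
  rw [div_mul_eq_mul_div, one_div_mul_eq_div, div_le_div_iff₀ (by positivity) (by positivity)]
  nlinarith

theorem fisher_quadForm_le (h : RegularModel Θ θ₀ R D D₂ C) (n : ℕ)
    (u : EuclideanSpace ℝ (Fin p)) :
    u.ofLp ⬝ᵥ fisher (R n θ₀) (D n) *ᵥ u.ofLp ≤ C ^ 2 * (p * C) ^ 2 * ‖u‖ ^ 2 := by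
  have hC : 0 < C := by linarith [h.one_le]
  rw [fisher_quadForm]
  set B := dirDeriv (D n) u.ofLp
  have hB : ‖B‖ ≤ p * C * ‖u‖ := norm_dirDeriv_le (h.norm_deriv_le n) u
  have hP : ‖(R n θ₀)⁻¹‖ ≤ C := h.norm_inv_le n θ₀ h.mem
  have h1 : ‖(R n θ₀)⁻¹ * B * (R n θ₀)⁻¹ * B‖ ≤ C * (p * C * ‖u‖) * C * (p * C * ‖u‖) := by
    refine (norm_mul_le _ _).trans ?_
    gcongr
    refine (norm_mul_le _ _).trans ?_
    gcongr
    refine (norm_mul_le _ _).trans ?_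
    gcongr
  have h2 := (le_abs_self _).trans (abs_trace_le ((R n θ₀)⁻¹ * B * (R n θ₀)⁻¹ * B))
  rw [Fintype.card_fin] at h2
  have h3 : ((R n θ₀)⁻¹ * B * (R n θ₀)⁻¹ * B).trace ≤ n * (C * (p * C * ‖u‖) * C * (p * C * ‖u‖)) :=
    h2.trans (by gcongr)
  have h4 : (1 / (2 * (n : ℝ))) * n ≤ 1 := by
    rcases n.eq_zero_or_pos with rfl | hn
    · simp
    · have : (0 : ℝ) < n := by exact_mod_cast hn
      rw [one_div_mul_eq_div, div_le_one (by positivity)]; linarith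
  calc _ ≤ (1 / (2 * (n : ℝ))) * (n * (C * (p * C * ‖u‖) * C * (p * C * ‖u‖))) := by gcongr
    _ = ((1 / (2 * (n : ℝ))) * n) * (C ^ 2 * (p * C) ^ 2 * ‖u‖ ^ 2) := by ring
    _ ≤ 1 * (C ^ 2 * (p * C) ^ 2 * ‖u‖ ^ 2) := by gcongr
    _ = _ := one_mul _

end RegularModel

theorem exists_unit_eigenvector {M : Matrix (Fin p) (Fin p) ℝ} (hM : M.IsHermitian) {μ : ℝ}
    (hμ : μ ∈ spectrum ℝ M) :
    ∃ u : EuclideanSpace ℝ (Fin p), ‖u‖ = 1 ∧ u.ofLp ⬝ᵥ M *ᵥ u.ofLp = μ := by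
  rw [hM.spectrum_real_eq_range_eigenvalues] at hμ
  obtain ⟨i, rfl⟩ := hμ
  refine ⟨hM.eigenvectorBasis i, hM.eigenvectorBasis.orthonormal.1 i, ?_⟩
  rw [hM.mulVec_eigenvectorBasis, dotProduct_smul, dotProduct_self_eq_norm_sq]
  simp [hM.eigenvectorBasis.orthonormal.1 i]

theorem le_lambdaMin {M : Matrix (Fin p) (Fin p) ℝ} (hM : M.IsHermitian) {m : ℝ}
    (h : ∀ u : EuclideanSpace ℝ (Fin p), m * ‖u‖ ^ 2 ≤ u.ofLp ⬝ᵥ M *ᵥ u.ofLp) :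
    (m : EReal) ≤ lambdaMin M := by
  refine le_iInf₂ fun μ hμ => ?_
  obtain ⟨u, hu, hu'⟩ := exists_unit_eigenvector hM hμ
  have := h u
  rw [hu, hu'] at this
  exact_mod_cast (by simpa using this)

theorem lambdaMax_le {M : Matrix (Fin p) (Fin p) ℝ} (hM : M.IsHermitian) {m : ℝ}
    (h : ∀ u : EuclideanSpace ℝ (Fin p), u.ofLp ⬝ᵥ M *ᵥ u.ofLp ≤ m * ‖u‖ ^ 2) :
    lambdaMax M ≤ (m : EReal) := by
  refine iSup₂_le fun μ hμ => ?_
  obtain ⟨u, hu, hu'⟩ := exists_unit_eigenvector hM hμ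
  have := h u
  rw [hu, hu'] at this
  exact_mod_cast (by simpa using this)

/-- Positivity of p matters: an empty spectrum would give ⊤ on the left and ⊥ on the right. -/
theorem lambdaMin_le_lambdaMax (hp : 0 < p) {M : Matrix (Fin p) (Fin p) ℝ} (hM : M.IsHermitian) :
    lambdaMin M ≤ lambdaMax M :=
  (iInf₂_le _ (hM.eigenvalues_mem_spectrum_real ⟨0, hp⟩)).trans
    (le_iSup₂ (f := fun (μ : ℝ) (_ : μ ∈ spectrum ℝ M) => (μ : EReal)) _
      (hM.eigenvalues_mem_spectrum_real ⟨0, hp⟩))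

theorem RegularModel.lambda_bounds {Θ : Set (EuclideanSpace ℝ (Fin p))}
    {θ₀ : EuclideanSpace ℝ (Fin p)}
    {R : (n : ℕ) → EuclideanSpace ℝ (Fin p) → Matrix (Fin n) (Fin n) ℝ}
    {D : (n : ℕ) → Fin p → Matrix (Fin n) (Fin n) ℝ}
    {D₂ : (n : ℕ) → Fin p → Fin p → Matrix (Fin n) (Fin n) ℝ} {C : ℝ}
    (h : RegularModel Θ θ₀ R D D₂ C) (hp : 0 < p) :
    (0 : EReal) < liminf (fun n => lambdaMin (fisher (R n θ₀) (D n))) atTop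
    ∧ liminf (fun n => lambdaMin (fisher (R n θ₀) (D n))) atTop
        ≤ limsup (fun n => lambdaMax (fisher (R n θ₀) (D n))) atTop
    ∧ limsup (fun n => lambdaMax (fisher (R n θ₀) (D n))) atTop < ⊤ := by
  refine ⟨?_, ?_, ?_⟩
  · obtain ⟨m, hm, hev⟩ := h.exists_fisher_ge
    refine lt_of_lt_of_le (b := (m : EReal)) (by exact_mod_cast hm) ?_
    refine le_liminf_of_le (by isBoundedDefault) ?_
    filter_upwards [hev] with n hn using le_lambdaMin (isHermitian_fisher _ _) hn
  · refine (liminf_le_limsup).trans ?_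
    exact limsup_le_limsup (Eventually.of_forall fun n =>
      lambdaMin_le_lambdaMax hp (isHermitian_fisher _ _))
  · refine lt_of_le_of_lt (b := ((C ^ 2 * (p * C) ^ 2 : ℝ) : EReal)) ?_ (EReal.coe_lt_top _)
    refine limsup_le_of_le (by isBoundedDefault) ?_
    exact Eventually.of_forall fun n => lambdaMax_le (isHermitian_fisher _ _)
      (h.fisher_quadForm_le n)

end Information

end GPML

namespace GPML

/-! ### Deterministic estimates for the likelihood. -/

section Likelihood

open scoped Matrix.Norms.L2Operator

variable {n : ℕ}

/-- The quadratic form `y ↦ yᵀ A y`, as a linear function of `A`. -/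
noncomputable def quadLin (y : Fin n → ℝ) : Matrix (Fin n) (Fin n) ℝ →ₗ[ℝ] ℝ where
  toFun A := y ⬝ᵥ A *ᵥ y
  map_add' A B := by rw [add_mulVec, dotProduct_add]
  map_smul' c A := by rw [smul_mulVec, dotProduct_smul, RingHom.id_apply]

/-- The normalised deviation `(1/n) (yᵀ A y - tr (A R))`, as a linear function of `A`. -/
noncomputable def quadDev (R : Matrix (Fin n) (Fin n) ℝ) (y : Fin n → ℝ) :
    Matrix (Fin n) (Fin n) ℝ →ₗ[ℝ] ℝ where
  toFun A := (1 / (n : ℝ)) * (y ⬝ᵥ A *ᵥ y - (A * R).trace)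
  map_add' A B := by
    rw [add_mulVec, dotProduct_add, Matrix.add_mul, trace_add]; ring
  map_smul' c A := by
    rw [smul_mulVec, dotProduct_smul, RingHom.id_apply, Matrix.smul_mul, trace_smul,
      smul_eq_mul, smul_eq_mul, smul_eq_mul]; ring

theorem quadDev_apply (R A : Matrix (Fin n) (Fin n) ℝ) (y : Fin n → ℝ) :
    quadDev R y A = (1 / (n : ℝ)) * (y ⬝ᵥ A *ᵥ y - (A * R).trace) := rfl

/-- The modified negative log-likelihood for the covariance matrix `A`. -/
noncomputable def nll (A : Matrix (Fin n) (Fin n) ℝ) (y : Fin n → ℝ) : ℝ :=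
  (1 / (n : ℝ)) * Real.log A.det + (1 / (n : ℝ)) * (y ⬝ᵥ (A⁻¹ *ᵥ y))

theorem isUnit_det_of_posDef {A : Matrix (Fin n) (Fin n) ℝ} (hA : A.PosDef) : IsUnit A.det :=
  isUnit_iff_ne_zero.2 hA.det_pos.ne'

/-- Used three times in succession, it expands the inverse to second order with an exact third-order
remainder. -/
theorem resolvent_identity {A B : Matrix (Fin n) (Fin n) ℝ} (hA : A.PosDef) (hB : B.PosDef) :
    B⁻¹ = A⁻¹ - A⁻¹ * (B - A) * B⁻¹ := by
  rw [Matrix.mul_sub, Matrix.sub_mul, nonsing_inv_mul _ (isUnit_det_of_posDef hA), Matrix.one_mul,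
    Matrix.mul_assoc, mul_nonsing_inv _ (isUnit_det_of_posDef hB), Matrix.mul_one]
  abel

theorem one_div_mul_le_of_le {x c : ℝ} (h : x ≤ n * c) (hc : 0 ≤ c) : (1 / (n : ℝ)) * x ≤ c := by
  rcases n.eq_zero_or_pos with rfl | hn
  · simpa using hc
  · have : (0 : ℝ) < n := by exact_mod_cast hn
    rw [one_div_mul_eq_div, div_le_iff₀ this, mul_comm]; exact h

/-- A Lipschitz bound in operator norm with a constant free of n, on the event y·y ≤ nκ; it carries
estimates from a finite net to all of Θ. -/
theorem abs_nll_sub_le {A B : Matrix (Fin n) (Fin n) ℝ} (hA : A.PosDef) (hB : B.PosDef) {C κ : ℝ}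
    (hκ : 0 ≤ κ) (hAC : ‖A⁻¹‖ ≤ C) (hBC : ‖B⁻¹‖ ≤ C) {y : Fin n → ℝ} (hy : y ⬝ᵥ y ≤ n * κ) :
    |nll B y - nll A y| ≤ (C + C ^ 2 * κ) * ‖B - A‖ := by
  have hC : 0 ≤ C := (norm_nonneg _).trans hAC
  have h1 := abs_logdet_sub_le hA hB hAC hBC
  rw [Fintype.card_fin] at h1
  have h2 : |y ⬝ᵥ B⁻¹ *ᵥ y - y ⬝ᵥ A⁻¹ *ᵥ y| ≤ n * (C ^ 2 * κ * ‖B - A‖) := by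
    have e : y ⬝ᵥ B⁻¹ *ᵥ y - y ⬝ᵥ A⁻¹ *ᵥ y = -(y ⬝ᵥ (A⁻¹ * (B - A) * B⁻¹) *ᵥ y) := by
      conv_lhs => rw [resolvent_identity hA hB]
      rw [sub_mulVec, dotProduct_sub]; ring
    rw [e, abs_neg]
    refine (abs_quadForm_le _ _).trans ?_
    have h3 : ‖A⁻¹ * (B - A) * B⁻¹‖ ≤ C * ‖B - A‖ * C := by
      refine (norm_mul_le _ _).trans ?_
      gcongr
      refine (norm_mul_le _ _).trans ?_
      gcongr
    calc _ ≤ (C * ‖B - A‖ * C) * (n * κ) := by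
          gcongr
          exact dotProduct_self_nonneg' y
      _ = _ := by ring
  have e : nll B y - nll A y = (1 / (n : ℝ)) * ((Real.log B.det - Real.log A.det) +
      (y ⬝ᵥ B⁻¹ *ᵥ y - y ⬝ᵥ A⁻¹ *ᵥ y)) := by simp only [nll]; ring
  rw [e, abs_mul, abs_of_nonneg (by positivity : (0 : ℝ) ≤ 1 / n)]
  refine one_div_mul_le_of_le ?_ (by positivity)
  refine (abs_add_le _ _).trans ((add_le_add h1 h2).trans (le_of_eq ?_))
  ring

theorem frobSq_sub_comm (A B : Matrix (Fin n) (Fin n) ℝ) : frobSq (A - B) = frobSq (B - A) := by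
  simp only [frobSq, Matrix.sub_apply]
  exact Finset.sum_congr rfl fun i _ => Finset.sum_congr rfl fun j _ => by ring

/-- The centring trace of `quadDev` is exactly what completes the log-determinants to a
Kullback-Leibler divergence, which `frobSq_le_kullback` bounds below. -/
theorem nll_sub_ge {A B : Matrix (Fin n) (Fin n) ℝ} (hA : A.PosDef) (hB : B.PosDef) {C : ℝ}
    (hC : 0 < C) (hAC : ‖A‖ ≤ C) (hBC : ‖B‖ ≤ C) (hAC' : ‖A⁻¹‖ ≤ C) (y : Fin n → ℝ) :
    (1 / (n : ℝ)) * (frobSq (A - B) / (C ^ 2 * (C + 1) ^ 2)) + quadDev B y (A⁻¹ - B⁻¹)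
      ≤ nll A y - nll B y := by
  have h1 := frobSq_le_kullback hA hB hC hAC hBC hAC'
  have htr : ((A⁻¹ - B⁻¹) * B).trace = (A⁻¹ * (B - A)).trace := by
    rw [Matrix.sub_mul, Matrix.mul_sub, nonsing_inv_mul _ (isUnit_det_of_posDef hA),
      nonsing_inv_mul _ (isUnit_det_of_posDef hB)]
  have e : nll A y - nll B y = (1 / (n : ℝ)) * ((A⁻¹ * (B - A)).trace
      - (Real.log B.det - Real.log A.det)) + quadDev B y (A⁻¹ - B⁻¹) := by
    rw [quadDev_apply, htr, sub_mulVec, dotProduct_sub]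
    simp only [nll]; ring
  rw [e, frobSq_sub_comm]
  gcongr

theorem trace_conj_mul {A B : Matrix (Fin n) (Fin n) ℝ} (hA : A.PosDef) :
    (A⁻¹ * B * A⁻¹ * A).trace = (A⁻¹ * B).trace := by
  rw [Matrix.mul_assoc, nonsing_inv_mul _ (isUnit_det_of_posDef hA), Matrix.mul_one]

theorem norm_mul_le_of_le' {A B : Matrix (Fin n) (Fin n) ℝ} {a b : ℝ} (hA : ‖A‖ ≤ a)
    (hB : ‖B‖ ≤ b) : ‖A * B‖ ≤ a * b :=
  norm_mul_le_of_le hA hB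

set_option maxHeartbeats 1000000 in
/-- Second-order expansion of the likelihood with a third-order remainder. -/
theorem abs_nll_expansion_le {A R B₁ B₂ : Matrix (Fin n) (Fin n) ℝ} (hA : A.PosDef) (hR : R.PosDef)
    {C κ τ : ℝ} (hC : 1 ≤ C) (hκ : 0 ≤ κ) (hAC : ‖A⁻¹‖ ≤ C) (hRC : ‖R⁻¹‖ ≤ C) (hτ : 0 ≤ τ)
    (h1 : ‖B₁‖ ≤ C * τ) (h2 : ‖B₂‖ ≤ C * τ ^ 2) (hE : ‖R - A - B₁ - B₂‖ ≤ C * τ ^ 3)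
    (hτC : 6 * C ^ 2 * τ ≤ 1) {y : Fin n → ℝ} (hy : y ⬝ᵥ y ≤ n * κ) :
    |nll R y - nll A y - (-quadDev A y (A⁻¹ * B₁ * A⁻¹) - quadDev A y (A⁻¹ * B₂ * A⁻¹)
        + quadDev A y (A⁻¹ * B₁ * A⁻¹ * B₁ * A⁻¹)
        + (1 / (2 * (n : ℝ))) * (A⁻¹ * B₁ * A⁻¹ * B₁).trace)|
      ≤ (60 * C ^ 6 + 40 * C ^ 7 * κ) * τ ^ 3 := by
  have hC0 : 0 ≤ C := by linarith
  set Q := A⁻¹ with hQ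
  set B := R - A with hB
  -- B₁, B₂ and E have orders τ, τ² and τ³; whatever is of order τ³ goes into the remainder.
  set E := B - B₁ - B₂ with hEdef
  have hτ1 : τ ≤ 1 := by nlinarith [mul_nonneg (mul_nonneg hC0 hC0) hτ]
  have hτ2 : τ ^ 2 ≤ τ := by nlinarith
  have hτ3 : τ ^ 3 ≤ τ ^ 2 := pow_le_pow_of_le_one hτ hτ1 (by norm_num)
  have hBB₁ : ‖B - B₁‖ ≤ 2 * C * τ ^ 2 := by
    have : B - B₁ = B₂ + E := by rw [hEdef]; abel
    rw [this]
    refine (norm_add_le _ _).trans ?_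
    have := mul_le_mul_of_nonneg_left hτ3 hC0
    linarith
  have hBn : ‖B‖ ≤ 3 * C * τ := by
    have : B = B₁ + (B - B₁) := by abel
    rw [this]
    refine (norm_add_le _ _).trans ?_
    have := mul_le_mul_of_nonneg_left hτ2 hC0
    linarith
  set ρ := Real.log R.det - Real.log A.det - (Q * B).trace + (Q * B * Q * B).trace / 2 with hρ
  -- The assumption 6C²τ ≤ 1 gives ‖A⁻¹‖‖R − A‖ ≤ 3C²τ ≤ 1/2, as the expansion of log det requires;
  -- 54 = 2·3³.
  have hρb : |ρ| ≤ n * (54 * C ^ 6 * τ ^ 3) := by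
    have h3 : ‖A⁻¹‖ * ‖R - A‖ ≤ 3 * C ^ 2 * τ := by
      calc _ ≤ C * (3 * C * τ) := by gcongr
        _ = _ := by ring
    have := abs_logdet_expansion_le hA hR (by linarith)
    refine this.trans ?_
    rw [Fintype.card_fin]
    calc _ ≤ 2 * (n : ℝ) * (3 * C ^ 2 * τ) ^ 3 := by gcongr
      _ = _ := by ring
  -- Replacing B by B₁ in the second-order terms costs only order τ³.
  set X := Q * B * Q * B - Q * B₁ * Q * B₁ with hX
  have hXn : ‖X‖ ≤ 8 * C ^ 4 * τ ^ 3 := by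
    have e : X = Q * (B - B₁) * Q * B + Q * B₁ * Q * (B - B₁) := by
      rw [hX]; noncomm_ring
    rw [e]
    refine (norm_add_le _ _).trans ?_
    have a1 : ‖Q * (B - B₁) * Q * B‖ ≤ C * (2 * C * τ ^ 2) * C * (3 * C * τ) :=
      norm_mul_le_of_le' (norm_mul_le_of_le' (norm_mul_le_of_le' hAC hBB₁) hAC) hBn
    have a2 : ‖Q * B₁ * Q * (B - B₁)‖ ≤ C * (C * τ) * C * (2 * C * τ ^ 2) :=
      norm_mul_le_of_le' (norm_mul_le_of_le' (norm_mul_le_of_le' hAC h1) hAC) hBB₁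
    refine (add_le_add a1 a2).trans (le_of_eq ?_)
    ring
  set Z := Q * B * Q * B * Q * B * R⁻¹ with hZ
  have hZn : ‖Z‖ ≤ 27 * C ^ 7 * τ ^ 3 := by
    have : ‖Z‖ ≤ C * (3 * C * τ) * C * (3 * C * τ) * C * (3 * C * τ) * C :=
      norm_mul_le_of_le' (norm_mul_le_of_le' (norm_mul_le_of_le' (norm_mul_le_of_le'
        (norm_mul_le_of_le' (norm_mul_le_of_le' hAC hBn) hAC) hBn) hAC) hBn) hRC
    refine this.trans (le_of_eq ?_)
    ring
  have hinv : R⁻¹ = Q - Q * B * Q + Q * B * Q * B * Q - Z := by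
    have h := resolvent_identity hA hR
    calc R⁻¹ = Q - Q * B * R⁻¹ := h
      _ = Q - Q * B * (Q - Q * B * (Q - Q * B * R⁻¹)) := by
          conv_lhs => rw [h]
          conv_lhs => rw [h]
      _ = _ := by rw [hZ]; noncomm_ring
  have hquad : y ⬝ᵥ R⁻¹ *ᵥ y = quadLin y Q - quadLin y (Q * B * Q)
      + quadLin y (Q * B₁ * Q * B₁ * Q) + quadLin y (X * Q) - quadLin y Z := by
    have e : R⁻¹ = Q - Q * B * Q + Q * B₁ * Q * B₁ * Q + X * Q - Z := by
      rw [hinv, hX, Matrix.sub_mul]; abel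
    rw [← map_sub, ← map_add, ← map_add, ← map_sub, ← e]
    rfl
  have hBsum : Q * B * Q = Q * B₁ * Q + Q * B₂ * Q + Q * E * Q := by
    rw [hEdef]; noncomm_ring
  have hqB : quadDev A y (Q * B * Q) = (1 / (n : ℝ)) * (quadLin y (Q * B * Q) - (Q * B).trace) := by
    rw [quadDev_apply, trace_conj_mul hA]; rfl
  have hq11 : quadDev A y (Q * B₁ * Q * B₁ * Q)
      = (1 / (n : ℝ)) * (quadLin y (Q * B₁ * Q * B₁ * Q) - (Q * B₁ * Q * B₁).trace) := by
    rw [quadDev_apply, Matrix.mul_assoc _ Q A, hQ,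
      nonsing_inv_mul _ (isUnit_det_of_posDef hA), Matrix.mul_one]; rfl
  have hqE : quadDev A y (Q * E * Q) = (1 / (n : ℝ)) * (quadLin y (Q * E * Q) - (Q * E).trace) := by
    rw [quadDev_apply, trace_conj_mul hA]; rfl
  have hqsum : quadDev A y (Q * B * Q) = quadDev A y (Q * B₁ * Q) + quadDev A y (Q * B₂ * Q)
      + quadDev A y (Q * E * Q) := by rw [hBsum, map_add, map_add]
  have hXtr : X.trace = (Q * B * Q * B).trace - (Q * B₁ * Q * B₁).trace := trace_sub _ _
  -- The trace of QB from log det centres the first-order form. At second order log det contributes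
  -- −1/2 of the trace and centring the form +1, leaving the +1/2 that is the information term.
  have hkey : nll R y - nll A y - (-quadDev A y (Q * B₁ * Q) - quadDev A y (Q * B₂ * Q)
        + quadDev A y (Q * B₁ * Q * B₁ * Q) + (1 / (2 * (n : ℝ))) * (Q * B₁ * Q * B₁).trace)
      = (1 / (n : ℝ)) * (ρ - X.trace / 2 + quadLin y (X * Q) - quadLin y Z
          - quadLin y (Q * E * Q) + (Q * E).trace) := by
    have hA' : y ⬝ᵥ A⁻¹ *ᵥ y = quadLin y Q := rfl
    have h2n : (1 / (2 * (n : ℝ))) = (1 / 2) * (1 / (n : ℝ)) := by rw [one_div_mul_one_div]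
    simp only [nll]
    rw [hquad, hA', hXtr, hρ, h2n, hq11]
    linear_combination hqB + hqE - hqsum - 2 * hqE
  rw [hkey, abs_mul, abs_of_nonneg (by positivity : (0 : ℝ) ≤ 1 / n)]
  have hn0 : (0 : ℝ) ≤ n := Nat.cast_nonneg n
  refine one_div_mul_le_of_le ?_ (by positivity)
  have hql : ∀ (M : Matrix (Fin n) (Fin n) ℝ) (b : ℝ), ‖M‖ ≤ b → |quadLin y M| ≤ n * (b * κ) :=
    fun M b hM => by
      refine (abs_quadForm_le M y).trans ?_
      calc ‖M‖ * (y ⬝ᵥ y) ≤ b * (n * κ) := by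
            gcongr
            · exact dotProduct_self_nonneg' y
            · exact (norm_nonneg _).trans hM
        _ = _ := by ring
  have htl : ∀ (M : Matrix (Fin n) (Fin n) ℝ) (b : ℝ), ‖M‖ ≤ b → |M.trace| ≤ n * b :=
    fun M b hM => (abs_trace_le M).trans (by rw [Fintype.card_fin]; gcongr)
  have b1 := htl X _ hXn
  have b2 := hql (X * Q) (8 * C ^ 4 * τ ^ 3 * C) (norm_mul_le_of_le' hXn hAC)
  have b3 := hql Z _ hZn
  have b4 := hql (Q * E * Q) (C * (C * τ ^ 3) * C)
    (norm_mul_le_of_le' (norm_mul_le_of_le' hAC hE) hAC)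
  have b5 := htl (Q * E) (C * (C * τ ^ 3)) (norm_mul_le_of_le' hAC hE)
  have t3 : 0 ≤ τ ^ 3 := by positivity
  have c2 : C ^ 2 ≤ C ^ 6 := pow_le_pow_right₀ hC (by norm_num)
  have c4 : C ^ 4 ≤ C ^ 6 := pow_le_pow_right₀ hC (by norm_num)
  have c5 : C ^ 5 ≤ C ^ 7 := pow_le_pow_right₀ hC (by norm_num)
  have c3 : C ^ 3 ≤ C ^ 7 := pow_le_pow_right₀ hC (by norm_num)
  have htri : |ρ - X.trace / 2 + quadLin y (X * Q) - quadLin y Z - quadLin y (Q * E * Q)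
      + (Q * E).trace| ≤ |ρ| + |X.trace| / 2 + |quadLin y (X * Q)| + |quadLin y Z|
        + |quadLin y (Q * E * Q)| + |(Q * E).trace| := by
    have g1 := abs_add_le (ρ - X.trace / 2 + quadLin y (X * Q) - quadLin y Z
      - quadLin y (Q * E * Q)) ((Q * E).trace)
    have g2 := abs_sub (ρ - X.trace / 2 + quadLin y (X * Q) - quadLin y Z) (quadLin y (Q * E * Q))
    have g3 := abs_sub (ρ - X.trace / 2 + quadLin y (X * Q)) (quadLin y Z)
    have g4 := abs_add_le (ρ - X.trace / 2) (quadLin y (X * Q))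
    have g5 := abs_sub ρ (X.trace / 2)
    rw [abs_div, abs_two] at g5
    linarith
  refine htri.trans ?_
  -- After raising powers of C: 54 + 4 + 1 ≤ 60 without κ, and 8 + 27 + 1 ≤ 40 with κ.
  have hfin : 54 * C ^ 6 * τ ^ 3 + 8 * C ^ 4 * τ ^ 3 / 2 + 8 * C ^ 4 * τ ^ 3 * C * κ
      + 27 * C ^ 7 * τ ^ 3 * κ + C * (C * τ ^ 3) * C * κ + C * (C * τ ^ 3)
      ≤ (60 * C ^ 6 + 40 * C ^ 7 * κ) * τ ^ 3 := by
    have u1 : 0 ≤ (C ^ 6 - C ^ 2) * τ ^ 3 := mul_nonneg (by linarith) t3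
    have u2 : 0 ≤ (C ^ 6 - C ^ 4) * τ ^ 3 := mul_nonneg (by linarith) t3
    have u3 : 0 ≤ (C ^ 7 - C ^ 5) * κ * τ ^ 3 := mul_nonneg (mul_nonneg (by linarith) hκ) t3
    have u4 : 0 ≤ (C ^ 7 - C ^ 3) * κ * τ ^ 3 := mul_nonneg (mul_nonneg (by linarith) hκ) t3
    have u5 : 0 ≤ C ^ 7 * κ * τ ^ 3 := by positivity
    have u6 : 0 ≤ C ^ 6 * τ ^ 3 := by positivity
    linear_combination u1 + 4 * u2 + 8 * u3 + u4 + 4 * u5 + u6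
  calc _ ≤ (n : ℝ) * (54 * C ^ 6 * τ ^ 3 + 8 * C ^ 4 * τ ^ 3 / 2 + 8 * C ^ 4 * τ ^ 3 * C * κ
      + 27 * C ^ 7 * τ ^ 3 * κ + C * (C * τ ^ 3) * C * κ + C * (C * τ ^ 3)) := by linarith
    _ ≤ _ := mul_le_mul_of_nonneg_left hfin hn0

end Likelihood

end GPML

namespace GPML

/-! ### Consistency and local quadratic approximation of the likelihood. -/

section Consistency

open scoped Matrix.Norms.L2Operator

variable {p : ℕ} {Θ : Set (EuclideanSpace ℝ (Fin p))} {θ₀ : EuclideanSpace ℝ (Fin p)}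
  {R : (n : ℕ) → EuclideanSpace ℝ (Fin p) → Matrix (Fin n) (Fin n) ℝ}
  {D : (n : ℕ) → Fin p → Matrix (Fin n) (Fin n) ℝ}
  {D₂ : (n : ℕ) → Fin p → Fin p → Matrix (Fin n) (Fin n) ℝ} {C : ℝ}
  {Ω : Type*} [MeasurableSpace Ω] {P : Measure Ω} [IsProbabilityMeasure P]
  {y : (n : ℕ) → Ω → Fin n → ℝ}

namespace RegularModel

/-- Chebyshev at level nε: the variance of the form is O(n), so the normalised deviation has
variance O(1/n). -/
theorem meas_quadDev_le (h : RegularModel Θ θ₀ R D D₂ C)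
    (hy : ∀ n, IsCenteredGaussian (y n) P (R n θ₀)) {n : ℕ} (hn : 1 ≤ n)
    {A : Matrix (Fin n) (Fin n) ℝ} {B : ℝ} (hA : ‖A‖ ≤ B) {ε : ℝ} (hε : 0 < ε) :
    P {ω | ε ≤ |quadDev (R n θ₀) (y n ω) A|} ≤ ENNReal.ofReal (2 * (B * C) ^ 2 / (n * ε ^ 2)) := by
  have hn0 : (0 : ℝ) < n := by exact_mod_cast hn
  have hB : 0 ≤ B := (norm_nonneg _).trans hA
  have hC : 0 ≤ C := by linarith [h.one_le]
  have h1 := (hy n).meas_quadForm_deviation_le (A := A) (h.posDef n θ₀ h.mem).posSemidef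
    (c := n * ε) (by positivity)
  refine le_trans (measure_mono ?_) (h1.trans (ENNReal.ofReal_le_ofReal ?_))
  · intro ω hω
    have hω' : ε ≤ |quadDev (R n θ₀) (y n ω) A| := hω
    rw [quadDev_apply, abs_mul, abs_of_nonneg (by positivity : (0 : ℝ) ≤ 1 / n),
      one_div_mul_eq_div, le_div_iff₀ hn0, mul_comm] at hω'
    exact hω'
  · rw [Fintype.card_fin]
    have h2 : ‖A‖ * ‖R n θ₀‖ ≤ B * C := by
      gcongr
      exact h.norm_le n θ₀ h.mem
    calc 2 * (n : ℝ) * (‖A‖ * ‖R n θ₀‖) ^ 2 / (n * ε) ^ 2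
        ≤ 2 * (n : ℝ) * (B * C) ^ 2 / (n * ε) ^ 2 := by gcongr
      _ = _ := by field_simp

theorem highProb_quadDev (h : RegularModel Θ θ₀ R D D₂ C)
    (hy : ∀ n, IsCenteredGaussian (y n) P (R n θ₀))
    {A : (n : ℕ) → Matrix (Fin n) (Fin n) ℝ} {B : ℝ} (hA : ∀ n, ‖A n‖ ≤ B) {ε : ℝ} (hε : 0 < ε) :
    HighProb P fun n ω => |quadDev (R n θ₀) (y n ω) (A n)| < ε := by
  have hlim : Tendsto (fun n : ℕ => ENNReal.ofReal (2 * (B * C) ^ 2 / (n * ε ^ 2))) atTop (𝓝 0) := by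
    rw [← ENNReal.ofReal_zero]
    refine (ENNReal.continuous_ofReal.tendsto 0).comp ?_
    exact Tendsto.const_div_atTop (tendsto_natCast_atTop_atTop.atTop_mul_const (by positivity)) _
  refine tendsto_of_tendsto_of_tendsto_of_le_of_le' tendsto_const_nhds hlim
    (Eventually.of_forall fun _ => zero_le) ?_
  filter_upwards [eventually_ge_atTop 1] with n hn
  simp only [not_lt]
  exact h.meas_quadDev_le hy hn (hA n) hε

theorem highProb_dotProduct_self_le (h : RegularModel Θ θ₀ R D D₂ C)
    (hy : ∀ n, IsCenteredGaussian (y n) P (R n θ₀)) :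
    HighProb P fun n ω => y n ω ⬝ᵥ y n ω ≤ n * (C + 1) := by
  have h1 := h.highProb_quadDev hy (A := fun n => (1 : Matrix (Fin n) (Fin n) ℝ)) (B := 1)
    (fun n => by
      rw [← diagonal_one, l2_opNorm_diagonal]
      exact (pi_norm_le_iff_of_nonneg zero_le_one).2 fun i => by simp) one_pos
  refine h1.mono ?_
  filter_upwards [eventually_ge_atTop 1] with n hn
  refine ae_of_all _ fun ω hω => ?_
  have hn0 : (0 : ℝ) < n := by exact_mod_cast hn
  have hω' := (le_abs_self _).trans_lt hω
  rw [quadDev_apply, one_div_mul_eq_div, div_lt_one hn0, one_mulVec, Matrix.one_mul] at hω'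
  have htr := (le_abs_self _).trans (abs_trace_le (R n θ₀))
  rw [Fintype.card_fin] at htr
  have := mul_le_mul_of_nonneg_left (h.norm_le n θ₀ h.mem) hn0.le
  linarith

/-- Consistency of minimisers of the likelihood. -/
theorem highProb_norm_sub_lt (h : RegularModel Θ θ₀ R D D₂ C)
    (hy : ∀ n, IsCenteredGaussian (y n) P (R n θ₀))
    {θhat : ℕ → Ω → EuclideanSpace ℝ (Fin p)}
    (hmem : ∀ n, 1 ≤ n → ∀ᵐ ω ∂P, θhat n ω ∈ Θ)
    (hmin : ∀ n, 1 ≤ n → ∀ᵐ ω ∂P, ∀ θ ∈ Θ, nll (R n (θhat n ω)) (y n ω) ≤ nll (R n θ) (y n ω))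
    {α : ℝ} (hα : 0 < α) : HighProb P fun n ω => ‖θhat n ω - θ₀‖ < α := by
  have hC1 := h.one_le
  have hC : 0 < C := by linarith
  obtain ⟨ε, hε, hsepn⟩ := h.separates α hα
  obtain ⟨δ, hδ, hlip⟩ := h.lipschitz
  -- a is the divergence gap outside the α-ball. Deviations on the net and the passage from the net
  -- each use at most a/4, so the likelihood there still exceeds its value at θ₀, contradicting
  -- minimality.
  set a : ℝ := ε / (C ^ 2 * (C + 1) ^ 2) with ha
  have ha0 : 0 < a := by positivity
  set L : ℝ := (C + C ^ 2 * (C + 1)) * C with hL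
  have hL0 : 0 < L := by positivity
  set η : ℝ := min δ (a / (4 * L)) with hη
  have hη0 : 0 < η := by positivity
  set T : Set (EuclideanSpace ℝ (Fin p)) := {θ ∈ Θ | α ≤ ‖θ - θ₀‖} with hT
  have hTc : IsCompact T := h.compact.inter_right (t := {θ | α ≤ ‖θ - θ₀‖})
    (isClosed_le (by fun_prop) (by fun_prop))
  -- The net does not depend on n, so only finitely many deviations have to be controlled.
  obtain ⟨s, hsT, hsf, hcov⟩ := hTc.finite_cover_balls hη0
  have := hsf.to_subtype
  have hdev : HighProb P fun n ω => ∀ x : s,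
      |quadDev (R n θ₀) (y n ω) ((R n x)⁻¹ - (R n θ₀)⁻¹)| < a / 4 :=
    HighProb.forall fun x => h.highProb_quadDev hy (B := C + C) (fun n =>
      (norm_sub_le _ _).trans (add_le_add (h.norm_inv_le n x (hsT x.2).1)
        (h.norm_inv_le n θ₀ h.mem))) (by positivity)
  refine (hdev.and (h.highProb_dotProduct_self_le hy)).mono ?_
  filter_upwards [hsepn, eventually_ge_atTop 1] with n hn hn1
  have hn0 : (0 : ℝ) < n := by exact_mod_cast hn1
  filter_upwards [hmem n hn1, hmin n hn1] with ω hω1 hω2 hω3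
  by_contra hcon
  push Not at hcon
  obtain ⟨x, hx, hxb⟩ := Set.mem_iUnion₂.1 (hcov ⟨hω1, hcon⟩)
  have hxT := hsT hx
  have hd : dist x (θhat n ω) < η := by rw [dist_comm]; exact hxb
  have h1 := abs_nll_sub_le (h.posDef n x hxT.1) (h.posDef n _ hω1) (κ := C + 1) (by positivity)
    (h.norm_inv_le n x hxT.1) (h.norm_inv_le n _ hω1) hω3.2
  have h2 := hlip n x hxT.1 (θhat n ω) hω1 (hd.trans_le (min_le_left _ _))
  have h3 : |nll (R n (θhat n ω)) (y n ω) - nll (R n x) (y n ω)| ≤ a / 4 := by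
    refine h1.trans ?_
    calc _ ≤ (C + C ^ 2 * (C + 1)) * (C * (a / (4 * L))) := by
          gcongr
          refine h2.trans ?_
          gcongr
          exact hd.le.trans (min_le_right _ _)
      _ = a / 4 := by rw [← mul_assoc, ← hL]; field_simp
  have h4 := nll_sub_ge (h.posDef n x hxT.1) (h.posDef n θ₀ h.mem) hC (h.norm_le n x hxT.1)
    (h.norm_le n θ₀ h.mem) (h.norm_inv_le n x hxT.1) (y n ω)
  have h5 : a ≤ (1 / (n : ℝ)) * (frobSq (R n x - R n θ₀) / (C ^ 2 * (C + 1) ^ 2)) := by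
    rw [one_div_mul_eq_div, le_div_iff₀ hn0, ha, div_mul_eq_mul_div]
    gcongr
    exact hn x hxT.1 hxT.2
  have h6 := (abs_lt.1 (hω3.1 ⟨x, hx⟩)).1
  have h7 := hω2 θ₀ h.mem
  have h8 := (abs_le.1 h3).1
  simp only at h6
  linarith

/-- The score at `θ₀` (up to sign): the vector of normalised deviations in the directions `Dᵢ`. -/
noncomputable def score {n : ℕ} (A : Matrix (Fin n) (Fin n) ℝ)
    (D : Fin p → Matrix (Fin n) (Fin n) ℝ) (y : Fin n → ℝ) : Fin p → ℝ :=
  fun i => quadDev A y (A⁻¹ * D i * A⁻¹)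

theorem quadDev_dirDeriv {n : ℕ} (A : Matrix (Fin n) (Fin n) ℝ)
    (D : Fin p → Matrix (Fin n) (Fin n) ℝ) (y : Fin n → ℝ) (u : Fin p → ℝ) :
    quadDev A y (A⁻¹ * dirDeriv D u * A⁻¹) = u ⬝ᵥ score A D y := by
  simp only [dirDeriv, Matrix.mul_sum, Matrix.sum_mul, Matrix.mul_smul, Matrix.smul_mul, map_sum,
    map_smul, smul_eq_mul, dotProduct, score]

theorem abs_sum_sum_le (t : EuclideanSpace ℝ (Fin p)) {a : Fin p → Fin p → ℝ} {η : ℝ}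
    (ha : ∀ i j, |a i j| ≤ η) :
    |∑ i, ∑ j, (t i * t j) * a i j| ≤ (p : ℝ) ^ 2 * η * ‖t‖ ^ 2 := by
  refine (Finset.abs_sum_le_sum_abs _ _).trans ?_
  calc _ ≤ ∑ _i : Fin p, ∑ _j : Fin p, ‖t‖ * ‖t‖ * η := by
        refine Finset.sum_le_sum fun i _ => (Finset.abs_sum_le_sum_abs _ _).trans ?_
        refine Finset.sum_le_sum fun j _ => ?_
        rw [abs_mul, abs_mul]
        have := abs_apply_le_norm t i
        have := abs_apply_le_norm t j
        have := ha i j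
        gcongr
    _ = _ := by simp; ring

theorem norm_sum_sum_le {n : ℕ} (t : EuclideanSpace ℝ (Fin p))
    {M : Fin p → Fin p → Matrix (Fin n) (Fin n) ℝ} {C : ℝ} (hM : ∀ i j, ‖M i j‖ ≤ C) :
    ‖∑ i, ∑ j, (t i * t j) • M i j‖ ≤ (p : ℝ) ^ 2 * C * ‖t‖ ^ 2 := by
  refine (norm_sum_le _ _).trans ?_
  calc _ ≤ ∑ _i : Fin p, ∑ _j : Fin p, ‖t‖ * ‖t‖ * C := by
        refine Finset.sum_le_sum fun i _ => (norm_sum_le _ _).trans ?_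
        refine Finset.sum_le_sum fun j _ => ?_
        rw [norm_smul, Real.norm_eq_abs, abs_mul]
        have := abs_apply_le_norm t i
        have := abs_apply_le_norm t j
        have := hM i j
        gcongr
    _ = _ := by simp; ring

/-- Uniform local quadratic approximation of the likelihood around `θ₀`. -/
theorem highProb_quadratic_expansion (h : RegularModel Θ θ₀ R D D₂ C)
    (hy : ∀ n, IsCenteredGaussian (y n) P (R n θ₀)) {η : ℝ} (hη : 0 < η) :
    ∃ ρ, 0 < ρ ∧ HighProb P fun n ω => ∀ t : EuclideanSpace ℝ (Fin p), ‖t‖ ≤ ρ → θ₀ + t ∈ Θ ∧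
      |nll (R n (θ₀ + t)) (y n ω) - nll (R n θ₀) (y n ω)
        - (-(t.ofLp ⬝ᵥ score (R n θ₀) (D n) (y n ω))
          + t.ofLp ⬝ᵥ fisher (R n θ₀) (D n) *ᵥ t.ofLp)| ≤ η * ‖t‖ ^ 2 := by
  have hC1 := h.one_le
  have hC : 0 < C := by linarith
  obtain ⟨r, hr, htaylor⟩ := h.taylor
  -- Dominates C, pC and p²C, the bounds arising for the inverses, for B₁ and for B₂.
  set C' : ℝ := (p + 1) ^ 2 * C with hC'
  have hCC' : C ≤ C' := by
    rw [hC']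
    have : (1 : ℝ) ≤ (p + 1) ^ 2 := by
      have : (0 : ℝ) ≤ p := Nat.cast_nonneg p
      nlinarith
    nlinarith
  have hC'1 : 1 ≤ C' := hC1.trans hCC'
  have hC'0 : 0 < C' := by linarith
  set G : ℝ := 60 * C' ^ 6 + 40 * C' ^ 7 * (C + 1) with hG
  have hG0 : 0 < G := by positivity
  set ζ : ℝ := η / (4 * ((p : ℝ) ^ 2 + 1)) with hζ
  have hζ0 : 0 < ζ := by positivity
  -- r allows the Taylor expansion, the second term gives 6C'²‖t‖ ≤ 1, and the third makes the cubic
  -- remainder at most (η/2)‖t‖². Bilinearity reduces the deviation terms for all t to finitely many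
  -- pairs (i, j), whose tolerance ζ satisfies p²ζ ≤ η/4.
  refine ⟨min r (min (1 / (6 * C' ^ 2)) (η / (2 * G))), by positivity, ?_⟩
  have hdev2 : HighProb P fun n ω => ∀ q : Fin p × Fin p,
      |quadDev (R n θ₀) (y n ω) ((R n θ₀)⁻¹ * D₂ n q.1 q.2 * (R n θ₀)⁻¹)| < ζ :=
    HighProb.forall fun q => h.highProb_quadDev hy (B := C * C * C) (fun n =>
      norm_mul_le_of_le' (norm_mul_le_of_le' (h.norm_inv_le n θ₀ h.mem)
        (h.norm_deriv₂_le n q.1 q.2)) (h.norm_inv_le n θ₀ h.mem)) hζ0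
  have hdev11 : HighProb P fun n ω => ∀ q : Fin p × Fin p,
      |quadDev (R n θ₀) (y n ω)
        ((R n θ₀)⁻¹ * D n q.1 * (R n θ₀)⁻¹ * D n q.2 * (R n θ₀)⁻¹)| < ζ :=
    HighProb.forall fun q => h.highProb_quadDev hy (B := C * C * C * C * C) (fun n =>
      norm_mul_le_of_le' (norm_mul_le_of_le' (norm_mul_le_of_le' (norm_mul_le_of_le'
        (h.norm_inv_le n θ₀ h.mem) (h.norm_deriv_le n q.1)) (h.norm_inv_le n θ₀ h.mem))
        (h.norm_deriv_le n q.2)) (h.norm_inv_le n θ₀ h.mem)) hζ0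
  refine ((hdev2.and hdev11).and (h.highProb_dotProduct_self_le hy)).mono
    (Eventually.of_forall fun n => ae_of_all _ ?_)
  rintro ω ⟨⟨hω2, hω11⟩, hωy⟩ t ht
  obtain ⟨htΘ, hE⟩ := htaylor n t (ht.trans (min_le_left _ _))
  refine ⟨htΘ, ?_⟩
  have ht1 : ‖t‖ ≤ 1 / (6 * C' ^ 2) := ht.trans ((min_le_right _ _).trans (min_le_left _ _))
  have ht2 : ‖t‖ ≤ η / (2 * G) := ht.trans ((min_le_right _ _).trans (min_le_right _ _))
  set τ := ‖t‖ with hτ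
  have hτ0 : 0 ≤ τ := norm_nonneg _
  set B₁ := dirDeriv (D n) t.ofLp with hB₁
  set B₂ : Matrix (Fin n) (Fin n) ℝ := (1 / 2 : ℝ) • ∑ i, ∑ j, (t i * t j) • D₂ n i j with hB₂
  have hp0 : (0 : ℝ) ≤ p := Nat.cast_nonneg p
  have n1 : ‖B₁‖ ≤ C' * τ := by
    refine (norm_dirDeriv_le (h.norm_deriv_le n) t).trans ?_
    gcongr
    rw [hC']
    gcongr
    nlinarith
  have n2 : ‖B₂‖ ≤ C' * τ ^ 2 := by
    rw [hB₂, norm_smul]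
    have := norm_sum_sum_le t (h.norm_deriv₂_le n)
    have e : ‖(1 / 2 : ℝ)‖ = 1 / 2 := by norm_num
    rw [e]
    have h3 : (p : ℝ) ^ 2 * C * τ ^ 2 ≤ C' * τ ^ 2 := by
      rw [hC']; gcongr; linarith
    have h4 : 0 ≤ C' * τ ^ 2 := by positivity
    linarith
  have nE : ‖R n (θ₀ + t) - R n θ₀ - B₁ - B₂‖ ≤ C' * τ ^ 3 := hE.trans (by gcongr)
  have key := abs_nll_expansion_le (h.posDef n θ₀ h.mem) (h.posDef n _ htΘ) hC'1
    (by positivity : (0 : ℝ) ≤ C + 1)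
    ((h.norm_inv_le n θ₀ h.mem).trans hCC') ((h.norm_inv_le n _ htΘ).trans hCC') hτ0 n1 n2 nE
    (by rw [le_div_iff₀ (by positivity)] at ht1; linarith) hωy
  rw [quadDev_dirDeriv, ← fisher_quadForm] at key
  have e2 : quadDev (R n θ₀) (y n ω) ((R n θ₀)⁻¹ * B₂ * (R n θ₀)⁻¹) = (1 / 2) *
      ∑ i, ∑ j, (t i * t j) * quadDev (R n θ₀) (y n ω)
        ((R n θ₀)⁻¹ * D₂ n i j * (R n θ₀)⁻¹) := by
    simp only [hB₂, Matrix.mul_smul, Matrix.smul_mul, Matrix.mul_sum, Matrix.sum_mul, map_smul,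
      map_sum, smul_eq_mul]
  have e11 : quadDev (R n θ₀) (y n ω) ((R n θ₀)⁻¹ * B₁ * (R n θ₀)⁻¹ * B₁ * (R n θ₀)⁻¹) =
      ∑ i, ∑ j, (t i * t j) * quadDev (R n θ₀) (y n ω)
        ((R n θ₀)⁻¹ * D n i * (R n θ₀)⁻¹ * D n j * (R n θ₀)⁻¹) := by
    simp only [hB₁, dirDeriv, Matrix.mul_smul, Matrix.smul_mul, Matrix.mul_sum, Matrix.sum_mul,
      map_smul, map_sum, smul_eq_mul]
    rw [Finset.sum_comm]
    refine Finset.sum_congr rfl fun i _ => ?_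
    rw [Finset.mul_sum]
    exact Finset.sum_congr rfl fun j _ => by ring
  have a2 := abs_sum_sum_le t (a := fun i j => quadDev (R n θ₀) (y n ω)
    ((R n θ₀)⁻¹ * D₂ n i j * (R n θ₀)⁻¹)) (fun i j => (hω2 (i, j)).le)
  have a11 := abs_sum_sum_le t (a := fun i j => quadDev (R n θ₀) (y n ω)
    ((R n θ₀)⁻¹ * D n i * (R n θ₀)⁻¹ * D n j * (R n θ₀)⁻¹)) (fun i j => (hω11 (i, j)).le)
  rw [e2, e11] at key
  set S2 := ∑ i, ∑ j, (t i * t j) * quadDev (R n θ₀) (y n ω)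
    ((R n θ₀)⁻¹ * D₂ n i j * (R n θ₀)⁻¹)
  set S11 := ∑ i, ∑ j, (t i * t j) * quadDev (R n θ₀) (y n ω)
    ((R n θ₀)⁻¹ * D n i * (R n θ₀)⁻¹ * D n j * (R n θ₀)⁻¹)
  have hz : (p : ℝ) ^ 2 * ζ * τ ^ 2 ≤ η / 4 * τ ^ 2 := by
    gcongr
    rw [hζ, mul_div_assoc', div_le_div_iff₀ (by positivity) (by positivity)]
    nlinarith
  have hG3 : G * τ ^ 3 ≤ η / 2 * τ ^ 2 := by
    have : G * τ ≤ η / 2 := by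
      rw [le_div_iff₀ (by positivity)] at ht2; linarith
    calc G * τ ^ 3 = (G * τ) * τ ^ 2 := by ring
      _ ≤ _ := by gcongr
  have k1 := abs_le.1 key
  have k2 := abs_le.1 a2
  have k3 := abs_le.1 a11
  have hnn : 0 ≤ η * τ ^ 2 := by positivity
  rw [abs_le]
  constructor <;> linarith [k1.1, k1.2, k2.1, k2.2, k3.1, k3.2]

end RegularModel

end Consistency

end GPML

namespace GPML

/-! ### Matrix square root and stability of minimisers of quadratic functions. -/

section SquareRoot

theorem cfc_sqrt_spec {p : ℕ} {M : Matrix (Fin p) (Fin p) ℝ} (hM : M.PosSemidef) :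
    (cfc Real.sqrt M).IsHermitian ∧ cfc Real.sqrt M * cfc Real.sqrt M = M := by
  have hsa : IsSelfAdjoint M := hM.1
  refine ⟨cfc_predicate (R := ℝ) (p := IsSelfAdjoint) Real.sqrt M, ?_⟩
  rw [← cfc_mul Real.sqrt Real.sqrt M (by fun_prop) (by fun_prop)]
  conv_rhs => rw [← cfc_id ℝ M]
  refine cfc_congr fun x hx => ?_
  rw [hM.1.spectrum_real_eq_range_eigenvalues] at hx
  obtain ⟨i, rfl⟩ := hx
  exact Real.mul_self_sqrt (hM.eigenvalues_nonneg i)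

end SquareRoot

section Argmin

variable {p : ℕ}

theorem quadForm_sub_of_symm {M : Matrix (Fin p) (Fin p) ℝ} (hM : M.IsHermitian)
    (x z : Fin p → ℝ) :
    (x - z) ⬝ᵥ M *ᵥ (x - z) = x ⬝ᵥ M *ᵥ x - 2 * (x ⬝ᵥ M *ᵥ z) + z ⬝ᵥ M *ᵥ z := by
  have hs : z ⬝ᵥ M *ᵥ x = x ⬝ᵥ M *ᵥ z := by
    have hMt : Mᵀ = M := by simpa using hM.eq
    rw [dotProduct_mulVec, dotProduct_comm, ← mulVec_transpose, hMt]
  rw [mulVec_sub, sub_dotProduct, dotProduct_sub, dotProduct_sub, hs]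
  ring

/-- Near-minimisers of a function close to a quadratic form are close to its minimiser. -/
theorem norm_sub_sq_le_of_quadratic_approx {M : Matrix (Fin p) (Fin p) ℝ} (hM : M.IsHermitian)
    {m η : ℝ} (hm : 0 < m) (hη : 4 * η ≤ m)
    (hMm : ∀ u : EuclideanSpace ℝ (Fin p), m * ‖u‖ ^ 2 ≤ u.ofLp ⬝ᵥ M *ᵥ u.ofLp)
    {g : Fin p → ℝ} {F : EuclideanSpace ℝ (Fin p) → ℝ} {x z : EuclideanSpace ℝ (Fin p)}
    (hη0 : 0 ≤ η)
    (hz : g = (2 : ℝ) • (M *ᵥ z.ofLp)) (hFx : |F x - (-(x.ofLp ⬝ᵥ g) + x.ofLp ⬝ᵥ M *ᵥ x.ofLp)| ≤ η * ‖x‖ ^ 2)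
    (hFz : |F z - (-(z.ofLp ⬝ᵥ g) + z.ofLp ⬝ᵥ M *ᵥ z.ofLp)| ≤ η * ‖z‖ ^ 2) (hF : F x ≤ F z) :
    ‖x - z‖ ^ 2 ≤ 6 * η / m * ‖z‖ ^ 2 := by
  have h1 := hMm (x - z)
  rw [WithLp.ofLp_sub, quadForm_sub_of_symm hM] at h1
  rw [hz, dotProduct_smul, smul_eq_mul] at hFx hFz
  have h2 : ‖x‖ ^ 2 ≤ 2 * ‖x - z‖ ^ 2 + 2 * ‖z‖ ^ 2 := by
    have : ‖x‖ ≤ ‖x - z‖ + ‖z‖ := by simpa using norm_add_le (x - z) z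
    nlinarith [norm_nonneg x, norm_nonneg (x - z), norm_nonneg z, sq_nonneg (‖x - z‖ - ‖z‖)]
  -- With g = 2Mz the quadratic exceeds its value at z by (x − z)ᵀM(x − z). Hence m‖x − z‖² ≤ η(‖x‖²
  -- + ‖z‖²), and 4η ≤ m absorbs the part of ‖x‖² due to x − z.
  have h3 := abs_le.1 hFx
  have h4 := abs_le.1 hFz
  have h5 : m * ‖x - z‖ ^ 2 ≤ η * ‖x‖ ^ 2 + η * ‖z‖ ^ 2 := by linarith [h3.1, h4.2]
  have h6 := mul_le_mul_of_nonneg_left h2 hη0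
  have h7 : 0 ≤ (m - 4 * η) * ‖x - z‖ ^ 2 := mul_nonneg (by linarith) (sq_nonneg _)
  rw [div_mul_eq_mul_div, le_div_iff₀ hm]
  linarith

theorem norm_le_of_score_le {M : Matrix (Fin p) (Fin p) ℝ} {m : ℝ} (hm : 0 < m)
    (hMm : ∀ u : EuclideanSpace ℝ (Fin p), m * ‖u‖ ^ 2 ≤ u.ofLp ⬝ᵥ M *ᵥ u.ofLp)
    {g : Fin p → ℝ} {z : EuclideanSpace ℝ (Fin p)} (hz : g = (2 : ℝ) • (M *ᵥ z.ofLp)) {b : ℝ}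
    (hb : 0 ≤ b) (hg : ∀ i, |g i| ≤ b) : ‖z‖ ≤ p * b / (2 * m) := by
  have h1 := hMm z
  have h2 : z.ofLp ⬝ᵥ g = 2 * (z.ofLp ⬝ᵥ M *ᵥ z.ofLp) := by
    rw [hz, dotProduct_smul, smul_eq_mul]
  have h3 : z.ofLp ⬝ᵥ g ≤ p * (‖z‖ * b) := (le_abs_self _).trans (abs_sum_mul_le hg)
  rcases eq_or_ne ‖z‖ 0 with h0 | h0
  · rw [h0]; positivity
  · have hpos : 0 < ‖z‖ := lt_of_le_of_ne (norm_nonneg _) h0.symm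
    rw [le_div_iff₀ (by positivity)]
    have : ‖z‖ * (‖z‖ * (2 * m)) ≤ ‖z‖ * (p * b) := by nlinarith
    exact le_of_mul_le_mul_left this hpos

end Argmin

/-! ### Equivalence of the estimator and the one-step minimiser. -/

section Asymptotics

open scoped Matrix.Norms.L2Operator

variable {p : ℕ} {Θ : Set (EuclideanSpace ℝ (Fin p))} {θ₀ : EuclideanSpace ℝ (Fin p)}
  {R : (n : ℕ) → EuclideanSpace ℝ (Fin p) → Matrix (Fin n) (Fin n) ℝ}
  {D : (n : ℕ) → Fin p → Matrix (Fin n) (Fin n) ℝ}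
  {D₂ : (n : ℕ) → Fin p → Fin p → Matrix (Fin n) (Fin n) ℝ} {C : ℝ}
  {Ω : Type*} [MeasurableSpace Ω] {P : Measure Ω} [IsProbabilityMeasure P]
  {y : (n : ℕ) → Ω → Fin n → ℝ}

/-- The minimiser of the quadratic approximation of the likelihood. -/
noncomputable def oneStep {n : ℕ} (A : Matrix (Fin n) (Fin n) ℝ)
    (D : Fin p → Matrix (Fin n) (Fin n) ℝ) (y : Fin n → ℝ) : EuclideanSpace ℝ (Fin p) :=
  WithLp.toLp 2 ((1 / 2 : ℝ) • ((fisher A D)⁻¹ *ᵥ RegularModel.score A D y))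

theorem posDef_of_quadForm_ge {M : Matrix (Fin p) (Fin p) ℝ} (hM : M.IsHermitian) {m : ℝ}
    (hm : 0 < m)
    (hMm : ∀ u : EuclideanSpace ℝ (Fin p), m * ‖u‖ ^ 2 ≤ u.ofLp ⬝ᵥ M *ᵥ u.ofLp) : M.PosDef := by
  refine PosDef.of_dotProduct_mulVec_pos hM fun x hx => ?_
  have h := hMm (WithLp.toLp 2 x)
  have hx' : 0 < ‖WithLp.toLp 2 x‖ := norm_pos_iff.2 fun h0 => hx (by
    simpa using congrArg WithLp.ofLp h0)
  rw [star_trivial]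
  exact lt_of_lt_of_le (by positivity) h

theorem score_eq_of_posDef {n : ℕ} {A : Matrix (Fin n) (Fin n) ℝ}
    {D : Fin p → Matrix (Fin n) (Fin n) ℝ} (h : (fisher A D).PosDef) (y : Fin n → ℝ) :
    RegularModel.score A D y = (2 : ℝ) • (fisher A D *ᵥ (oneStep A D y).ofLp) := by
  have hu : IsUnit (fisher A D).det := isUnit_iff_ne_zero.2 h.det_pos.ne'
  simp only [oneStep]
  rw [mulVec_smul, mulVec_mulVec, mul_nonsing_inv _ hu, one_mulVec, smul_smul]
  norm_num

theorem continuous_oneStep {n : ℕ} (A : Matrix (Fin n) (Fin n) ℝ)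
    (D : Fin p → Matrix (Fin n) (Fin n) ℝ) : Continuous (oneStep A D) := by
  have h1 : Continuous (RegularModel.score A D) := by
    refine continuous_pi fun i => ?_
    simp only [RegularModel.score, quadDev_apply, dotProduct, mulVec]
    fun_prop
  unfold oneStep
  have h2 : Continuous fun y => (1 / 2 : ℝ) • ((fisher A D)⁻¹ *ᵥ RegularModel.score A D y) :=
    (LinearMap.continuous_of_finiteDimensional
      ((1 / 2 : ℝ) • Matrix.mulVecLin (fisher A D)⁻¹)).comp h1
  exact (PiLp.continuous_toLp 2 _).comp h2

namespace RegularModel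

theorem exists_posDef_fisher (h : RegularModel Θ θ₀ R D D₂ C) :
    ∃ m, 0 < m ∧ ∀ᶠ n : ℕ in atTop, (fisher (R n θ₀) (D n)).PosDef ∧
      ∀ u : EuclideanSpace ℝ (Fin p),
        m * ‖u‖ ^ 2 ≤ u.ofLp ⬝ᵥ fisher (R n θ₀) (D n) *ᵥ u.ofLp := by
  obtain ⟨m, hm, hev⟩ := h.exists_fisher_ge
  exact ⟨m, hm, hev.mono fun n hn => ⟨posDef_of_quadForm_ge (isHermitian_fisher _ _) hm hn, hn⟩⟩

theorem norm_scoreMatrix_le (h : RegularModel Θ θ₀ R D D₂ C) (n : ℕ) (i : Fin p) :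
    ‖(R n θ₀)⁻¹ * D n i * (R n θ₀)⁻¹‖ ≤ C * C * C :=
  norm_mul_le_of_le' (norm_mul_le_of_le' (h.norm_inv_le n θ₀ h.mem) (h.norm_deriv_le n i))
    (h.norm_inv_le n θ₀ h.mem)

/-- The minimiser of the likelihood is equivalent to the minimiser of its quadratic
approximation. -/
theorem highProb_norm_sub_oneStep_le (h : RegularModel Θ θ₀ R D D₂ C)
    (hy : ∀ n, IsCenteredGaussian (y n) P (R n θ₀))
    {θhat : ℕ → Ω → EuclideanSpace ℝ (Fin p)}
    (hmem : ∀ n, 1 ≤ n → ∀ᵐ ω ∂P, θhat n ω ∈ Θ)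
    (hmin : ∀ n, 1 ≤ n → ∀ᵐ ω ∂P, ∀ θ ∈ Θ, nll (R n (θhat n ω)) (y n ω) ≤ nll (R n θ) (y n ω))
    {η : ℝ} (hη : 0 < η) :
    HighProb P fun n ω => ‖(θhat n ω - θ₀) - oneStep (R n θ₀) (D n) (y n ω)‖ ^ 2
      ≤ η * ‖oneStep (R n θ₀) (D n) (y n ω)‖ ^ 2 := by
  obtain ⟨m, hm, hfish⟩ := h.exists_posDef_fisher
  -- m/4 permits the absorption in `norm_sub_sq_le_of_quadratic_approx`; ηm/6 makes its constant
  -- 6ζ/m at most η.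
  set ζ : ℝ := min (m / 4) (η * m / 6) with hζ
  have hζ0 : 0 < ζ := by positivity
  obtain ⟨ρ, hρ, hexp⟩ := h.highProb_quadratic_expansion hy hζ0
  -- Scores below b give ‖z‖ ≤ pρ/(p + 1) ≤ ρ, so θ₀ + z lies in Θ and is an admissible competitor.
  set b : ℝ := 2 * m * ρ / (p + 1) with hb
  have hb0 : 0 < b := by positivity
  have hscore : HighProb P fun n ω => ∀ i, |score (R n θ₀) (D n) (y n ω) i| < b :=
    HighProb.forall fun i => h.highProb_quadDev hy (fun n => h.norm_scoreMatrix_le n i) hb0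
  refine ((hexp.and hscore).and (h.highProb_norm_sub_lt hy hmem hmin hρ)).mono ?_
  filter_upwards [hfish, eventually_ge_atTop 1] with n hn hn1
  filter_upwards [hmin n hn1] with ω hωmin
  rintro ⟨⟨hω1, hω2⟩, hω3⟩
  set z := oneStep (R n θ₀) (D n) (y n ω) with hz
  have hg := score_eq_of_posDef hn.1 (y n ω)
  have hzρ : ‖z‖ ≤ ρ := by
    refine (norm_le_of_score_le hm hn.2 hg hb0.le fun i => (hω2 i).le).trans ?_
    rw [div_le_iff₀ (by positivity), hb, mul_div_assoc', div_le_iff₀ (by positivity)]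
    have : 0 ≤ 2 * m * ρ := by positivity
    nlinarith
  obtain ⟨hzΘ, hFz⟩ := hω1 z hzρ
  obtain ⟨-, hFx⟩ := hω1 (θhat n ω - θ₀) hω3.le
  have key := norm_sub_sq_le_of_quadratic_approx (isHermitian_fisher _ _) hm
    (by linarith [min_le_left (m / 4) (η * m / 6)] : 4 * ζ ≤ m) hn.2 hζ0.le hg
    (F := fun t => nll (R n (θ₀ + t)) (y n ω) - nll (R n θ₀) (y n ω)) hFx hFz
    (by
      have := hωmin _ hzΘ
      simp only [add_sub_cancel]
      linarith)
  refine key.trans ?_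
  gcongr
  rw [div_le_iff₀ hm]
  linarith [min_le_right (m / 4) (η * m / 6)]

/-- Tightness of √n times the score, uniformly in n: the 1/n in the variance cancels the squared
scaling. -/
theorem meas_score_ge_le (h : RegularModel Θ θ₀ R D D₂ C)
    (hy : ∀ n, IsCenteredGaussian (y n) P (R n θ₀)) {n : ℕ} (hn : 1 ≤ n) {κ : ℝ} (hκ : 0 < κ) :
    P {ω | ∃ i, κ / √n ≤ |score (R n θ₀) (D n) (y n ω) i|}
      ≤ p * ENNReal.ofReal (2 * (C * C * C * C) ^ 2 / κ ^ 2) := by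
  have hn0 : (0 : ℝ) < n := by exact_mod_cast hn
  have hs : √(n : ℝ) ^ 2 = n := Real.sq_sqrt hn0.le
  have e : {ω | ∃ i, κ / √n ≤ |score (R n θ₀) (D n) (y n ω) i|}
      = ⋃ i ∈ (Finset.univ : Finset (Fin p)),
        {ω | κ / √n ≤ |score (R n θ₀) (D n) (y n ω) i|} := by
    ext ω; simp
  rw [e]
  refine (measure_biUnion_finset_le _ _).trans ?_
  have : ∀ i ∈ (Finset.univ : Finset (Fin p)),
      P {ω | κ / √n ≤ |score (R n θ₀) (D n) (y n ω) i|}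
        ≤ ENNReal.ofReal (2 * (C * C * C * C) ^ 2 / κ ^ 2) := fun i _ => by
    have := h.meas_quadDev_le hy hn (h.norm_scoreMatrix_le n i) (ε := κ / √n) (by positivity)
    rw [div_pow, hs, mul_div_cancel₀ _ hn0.ne'] at this
    exact this
  refine (Finset.sum_le_sum this).trans ?_
  simp

theorem norm_sq_toEuclideanLin {N M : Matrix (Fin p) (Fin p) ℝ} (hN : N.IsHermitian)
    (hNM : N * N = M) (x : EuclideanSpace ℝ (Fin p)) :
    ‖Matrix.toEuclideanLin N x‖ ^ 2 = x.ofLp ⬝ᵥ M *ᵥ x.ofLp := by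
  have hNt : Nᵀ = N := by simpa using hN.eq
  have e : Matrix.toEuclideanLin N x = WithLp.toLp 2 (N *ᵥ x.ofLp) := rfl
  rw [e, ← dotProduct_self_eq_norm_sq, ← hNM, ← mulVec_mulVec, dotProduct_mulVec x.ofLp,
    ← mulVec_transpose, hNt]

/-- The relative error η‖z‖² with arbitrary η, multiplied by n, vanishes because n‖z‖² is tight. Any
symmetric square root of the information matrix may serve as N. -/
theorem tendstoInMeasure_sub_oneStep (h : RegularModel Θ θ₀ R D D₂ C)
    (hy : ∀ n, IsCenteredGaussian (y n) P (R n θ₀))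
    {θhat : ℕ → Ω → EuclideanSpace ℝ (Fin p)}
    (hmem : ∀ n, 1 ≤ n → ∀ᵐ ω ∂P, θhat n ω ∈ Θ)
    (hmin : ∀ n, 1 ≤ n → ∀ᵐ ω ∂P, ∀ θ ∈ Θ, nll (R n (θhat n ω)) (y n ω) ≤ nll (R n θ) (y n ω))
    {N : ℕ → Matrix (Fin p) (Fin p) ℝ} (hN : ∀ᶠ n : ℕ in atTop, (fisher (R n θ₀) (D n)).PosDef →
      (N n).IsHermitian ∧ N n * N n = fisher (R n θ₀) (D n)) :
    TendstoInMeasure P (fun (n : ℕ) ω => √(n : ℝ) • Matrix.toEuclideanLin (N n)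
      ((θhat n ω - θ₀) - oneStep (R n θ₀) (D n) (y n ω))) atTop (fun _ => 0) := by
  have hC : 0 < C := by linarith [h.one_le]
  obtain ⟨m, hm, hfish⟩ := h.exists_posDef_fisher
  rw [tendstoInMeasure_iff_norm]
  intro ε hε
  simp only [sub_zero]
  rw [ENNReal.tendsto_nhds_zero]
  intro δ hδ
  have hδ2 : 0 < δ / 2 := ENNReal.half_pos hδ.ne'
  have hlimκ : Tendsto (fun κ : ℝ => p * ENNReal.ofReal (2 * (C * C * C * C) ^ 2 / κ ^ 2)) atTop
      (𝓝 0) := by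
    have h1 : Tendsto (fun κ : ℝ => ENNReal.ofReal (2 * (C * C * C * C) ^ 2 / κ ^ 2)) atTop
        (𝓝 0) := by
      rw [← ENNReal.ofReal_zero]
      refine (ENNReal.continuous_ofReal.tendsto 0).comp ?_
      exact Tendsto.const_div_atTop (tendsto_pow_atTop (by norm_num)) _
    have h2 := ENNReal.Tendsto.const_mul (a := (p : ENNReal)) h1 (Or.inr (by simp))
    simpa using h2
  -- κ is fixed before η: it bounds √n‖z‖ outside an event of probability δ/2, and η is then small
  -- enough that Gη < ε².
  obtain ⟨κ, hκ1, hκ0⟩ := ((hlimκ.eventually_le_const hδ2).and (eventually_gt_atTop 0)).exists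
  set Λ : ℝ := C ^ 2 * (p * C) ^ 2 with hΛ
  have hΛ0 : 0 ≤ Λ := by positivity
  set G : ℝ := Λ * (p * κ / (2 * m)) ^ 2 with hG
  have hG0 : 0 ≤ G := by positivity
  set η : ℝ := ε ^ 2 / (2 * (G + 1)) with hη
  have hη0 : 0 < η := by positivity
  have hhp := h.highProb_norm_sub_oneStep_le hy hmem hmin hη0
  filter_upwards [hfish, hN, eventually_ge_atTop 1, ENNReal.tendsto_nhds_zero.1 hhp _ hδ2]
    with n hn hNn hn1 hbad
  have hn0 : (0 : ℝ) < n := by exact_mod_cast hn1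
  have hs : √(n : ℝ) ^ 2 = n := Real.sq_sqrt hn0.le
  refine le_trans (measure_mono ?_) ((measure_union_le _ _).trans
    ((add_le_add hbad ((h.meas_score_ge_le hy hn1 hκ0).trans hκ1)).trans
      (le_of_eq (ENNReal.add_halves δ))))
  intro ω hω
  by_contra hcon
  simp only [Set.mem_union, Set.mem_ofPred_eq, not_or, not_exists, not_le] at hcon hω
  obtain ⟨hc1, hc2⟩ := hcon
  have hg := score_eq_of_posDef hn.1 (y n ω)
  set z := oneStep (R n θ₀) (D n) (y n ω) with hz
  have hzn := norm_le_of_score_le hm hn.2 hg (by positivity) fun i => (hc2 i).le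
  obtain ⟨hN1, hN2⟩ := hNn hn.1
  have hz2 : n * ‖z‖ ^ 2 ≤ (p * κ / (2 * m)) ^ 2 := by
    calc (n : ℝ) * ‖z‖ ^ 2 ≤ n * (p * (κ / √n) / (2 * m)) ^ 2 := by gcongr
      _ = (n / √(n : ℝ) ^ 2) * (p * κ / (2 * m)) ^ 2 := by ring
      _ = _ := by rw [hs, div_self hn0.ne', one_mul]
  have hfin : ‖√(n : ℝ) • Matrix.toEuclideanLin (N n) ((θhat n ω - θ₀) - z)‖ ^ 2 < ε ^ 2 := by
    rw [norm_smul, mul_pow, Real.norm_eq_abs, sq_abs, hs, norm_sq_toEuclideanLin hN1 hN2]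
    calc (n : ℝ) * _ ≤ n * (Λ * ‖(θhat n ω - θ₀) - z‖ ^ 2) := by
          gcongr
          exact h.fisher_quadForm_le n _
      _ ≤ n * (Λ * (η * ‖z‖ ^ 2)) := by gcongr; exact not_lt.1 hc1
      _ = Λ * η * (n * ‖z‖ ^ 2) := by ring
      _ ≤ Λ * η * (p * κ / (2 * m)) ^ 2 := by gcongr
      _ = G * η := by rw [hG]; ring
      _ < ε ^ 2 := by
          rw [hη, mul_div_assoc', div_lt_iff₀ (by positivity)]
          have : 0 < ε ^ 2 := by positivity
          nlinarith
  exact absurd (lt_of_pow_lt_pow_left₀ 2 hε.le hfin) (not_lt.2 hω)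

end RegularModel

end Asymptotics

end GPML

namespace GPML

/-! ### Asymptotic normality of the one-step minimiser and of the estimator. -/

section AsymptoticNormality

open scoped Matrix.Norms.L2Operator

variable {p : ℕ} {Θ : Set (EuclideanSpace ℝ (Fin p))} {θ₀ : EuclideanSpace ℝ (Fin p)}
  {R : (n : ℕ) → EuclideanSpace ℝ (Fin p) → Matrix (Fin n) (Fin n) ℝ}
  {D : (n : ℕ) → Fin p → Matrix (Fin n) (Fin n) ℝ}
  {D₂ : (n : ℕ) → Fin p → Fin p → Matrix (Fin n) (Fin n) ℝ} {C : ℝ}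
  {Ω : Type*} [MeasurableSpace Ω] {P : Measure Ω} [IsProbabilityMeasure P]
  {y : (n : ℕ) → Ω → Fin n → ℝ}

theorem continuous_toEuclideanLin (N : Matrix (Fin p) (Fin p) ℝ) :
    Continuous (Matrix.toEuclideanLin N) :=
  LinearMap.continuous_of_finiteDimensional _

/-- The information norm of v = M⁻¹Nu is the Euclidean norm of u; this makes the limiting covariance
the identity. -/
theorem dotProduct_nonsing_inv_mulVec_of_sq {N M : Matrix (Fin p) (Fin p) ℝ}
    (hN : N.IsHermitian) (hNM : N * N = M) (hM : IsUnit M.det) (u : Fin p → ℝ) :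
    (M⁻¹ *ᵥ (N *ᵥ u)) ⬝ᵥ M *ᵥ (M⁻¹ *ᵥ (N *ᵥ u)) = u ⬝ᵥ u := by
  have hNt : Nᵀ = N := by simpa using hN.eq
  have hMt : Mᵀ = M := by rw [← hNM, transpose_mul, hNt]
  have hNu : IsUnit N.det := by
    rw [← hNM, det_mul] at hM
    exact isUnit_of_mul_isUnit_left hM
  rw [mulVec_mulVec _ M, mul_nonsing_inv _ hM, one_mulVec, ← hNM, Matrix.mul_inv_rev,
    mulVec_mulVec _ (N⁻¹ * N⁻¹), Matrix.mul_assoc, nonsing_inv_mul _ hNu, Matrix.mul_one,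
    dotProduct_mulVec, ← mulVec_transpose, hNt, mulVec_mulVec, mul_nonsing_inv _ hNu, one_mulVec]

/-- Every linear functional of the normalised minimiser is a single centred quadratic form, so a
scalar limit theorem suffices. The factor 1/(2√n) is √n · (1/2) · (1/n). -/
theorem inner_toEuclideanLin_oneStep {n : ℕ} (hn : 1 ≤ n) {A : Matrix (Fin n) (Fin n) ℝ}
    {D : Fin p → Matrix (Fin n) (Fin n) ℝ} {N : Matrix (Fin p) (Fin p) ℝ} (hN : N.IsHermitian)
    (y : Fin n → ℝ) (u : EuclideanSpace ℝ (Fin p)) :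
    inner ℝ (√(n : ℝ) • Matrix.toEuclideanLin N (oneStep A D y)) u
      = y ⬝ᵥ ((1 / (2 * √(n : ℝ))) •
            (A⁻¹ * dirDeriv D ((fisher A D)⁻¹ *ᵥ (N *ᵥ u.ofLp)) * A⁻¹)) *ᵥ y
          - (((1 / (2 * √(n : ℝ))) •
            (A⁻¹ * dirDeriv D ((fisher A D)⁻¹ *ᵥ (N *ᵥ u.ofLp)) * A⁻¹)) * A).trace := by
  have hn0 : (0 : ℝ) < n := by exact_mod_cast hn
  have hs : √(n : ℝ) * √(n : ℝ) = n := Real.mul_self_sqrt hn0.le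
  have hs0 : √(n : ℝ) ≠ 0 := (Real.sqrt_pos.2 hn0).ne'
  have hNt : Nᵀ = N := by simpa using hN.eq
  have hMt : ((fisher A D)⁻¹)ᵀ = (fisher A D)⁻¹ := by
    rw [transpose_nonsing_inv]
    congr 1
    simpa using (isHermitian_fisher A D).eq
  set v := (fisher A D)⁻¹ *ᵥ (N *ᵥ u.ofLp) with hv
  have h1 := RegularModel.quadDev_dirDeriv A D y v
  rw [quadDev_apply] at h1
  have h2 : inner ℝ (√(n : ℝ) • Matrix.toEuclideanLin N (oneStep A D y)) u
      = √(n : ℝ) * ((1 / 2) * (v ⬝ᵥ RegularModel.score A D y)) := by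
    rw [real_inner_smul_left]
    congr 1
    have e : inner ℝ (Matrix.toEuclideanLin N (oneStep A D y)) u
        = u.ofLp ⬝ᵥ (N *ᵥ (oneStep A D y).ofLp) := by
      rw [EuclideanSpace.inner_eq_star_dotProduct, star_trivial]
      rfl
    rw [e]
    simp only [oneStep]
    rw [mulVec_smul, dotProduct_smul, smul_eq_mul, dotProduct_mulVec, ← mulVec_transpose, hNt,
      dotProduct_mulVec, ← mulVec_transpose, hMt]
  rw [h2, ← h1, smul_mulVec, dotProduct_smul, Matrix.smul_mul, trace_smul, smul_eq_mul,
    smul_eq_mul, ← mul_sub, ← mul_assoc, ← mul_assoc]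
  congr 1
  have hn' : (n : ℝ) = √(n : ℝ) ^ 2 := by rw [pow_two, hs]
  field_simp
  exact hn'.symm

namespace RegularModel

/-- Asymptotic normality of the minimiser of the quadratic approximation of the likelihood. -/
theorem tendstoInDistribution_oneStep (h : RegularModel Θ θ₀ R D D₂ C)
    (hy : ∀ n, IsCenteredGaussian (y n) P (R n θ₀))
    {N : ℕ → Matrix (Fin p) (Fin p) ℝ} (hN : ∀ᶠ n : ℕ in atTop, (fisher (R n θ₀) (D n)).PosDef →
      (N n).IsHermitian ∧ N n * N n = fisher (R n θ₀) (D n)) :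
    TendstoInDistribution (fun (n : ℕ) ω => √(n : ℝ) • Matrix.toEuclideanLin (N n)
      (oneStep (R n θ₀) (D n) (y n ω))) atTop
      (id : EuclideanSpace ℝ (Fin p) → EuclideanSpace ℝ (Fin p))
      (fun _ => P) (stdGaussian (EuclideanSpace ℝ (Fin p))) := by
  have hC : 0 < C := by linarith [h.one_le]
  obtain ⟨m, hm, hfish⟩ := h.exists_posDef_fisher
  have hmeas : ∀ n : ℕ, AEMeasurable (fun ω => √(n : ℝ) • Matrix.toEuclideanLin (N n)
      (oneStep (R n θ₀) (D n) (y n ω))) P := fun n =>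
    AEMeasurable.fun_const_smul (((continuous_toEuclideanLin (N n)).comp (continuous_oneStep _ _)).measurable.comp_aemeasurable
      (hy n).gaussian.aemeasurable) _
  refine ⟨hmeas, aemeasurable_id, ?_⟩
  refine ProbabilityMeasure.tendsto_iff_tendsto_charFun.2 fun u => ?_
  set v : (n : ℕ) → EuclideanSpace ℝ (Fin p) := fun n =>
    WithLp.toLp 2 ((fisher (R n θ₀) (D n))⁻¹ *ᵥ (N n *ᵥ u.ofLp)) with hv
  set good : ℕ → Prop := fun n => 1 ≤ n ∧ (fisher (R n θ₀) (D n)).PosDef ∧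
    (∀ w : EuclideanSpace ℝ (Fin p), m * ‖w‖ ^ 2 ≤ w.ofLp ⬝ᵥ fisher (R n θ₀) (D n) *ᵥ w.ofLp) ∧
    (N n).IsHermitian ∧ N n * N n = fisher (R n θ₀) (D n) with hgood
  have hev : ∀ᶠ n in atTop, good n := by
    filter_upwards [hfish, hN, eventually_ge_atTop 1] with n h1 h2 h3
    exact ⟨h3, h1.1, h1.2, h2 h1.1⟩
  set A : (n : ℕ) → Matrix (Fin n) (Fin n) ℝ := fun n =>
    (1 / (2 * √(n : ℝ))) • ((R n θ₀)⁻¹ * dirDeriv (D n) (v n).ofLp * (R n θ₀)⁻¹) with hA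
  have hvM : ∀ n, good n →
      (v n).ofLp ⬝ᵥ fisher (R n θ₀) (D n) *ᵥ (v n).ofLp = ‖u‖ ^ 2 := fun n hn => by
    have := dotProduct_nonsing_inv_mulVec_of_sq hn.2.2.2.1 hn.2.2.2.2
      (isUnit_det_of_posDef hn.2.1) u.ofLp
    rw [dotProduct_self_eq_norm_sq] at this
    exact this
  have hvn : ∀ n, good n → ‖v n‖ ≤ ‖u‖ / √m := fun n hn => by
    have h1 := hn.2.2.1 (v n)
    rw [hvM n hn] at h1
    rw [le_div_iff₀ (Real.sqrt_pos.2 hm)]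
    refine le_of_pow_le_pow_left₀ two_ne_zero (norm_nonneg _) ?_
    rw [mul_pow, Real.sq_sqrt hm.le]
    linarith
  have hAherm : ∀ n, (A n).IsHermitian := fun n => by
    have hR := (h.posDef n θ₀ h.mem).isHermitian.inv.eq
    have hD := (isHermitian_dirDeriv (h.isHermitian n) (v n).ofLp).eq
    rw [IsHermitian, hA, conjTranspose_smul, conjTranspose_mul, conjTranspose_mul, hR, hD,
      star_trivial, ← Matrix.mul_assoc]
  -- The scalar factors give 1/(4n), and the remaining trace is 2n vᵀM_n v = 2n‖u‖². The form has
  -- variance twice this trace, that is ‖u‖².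
  have hσ : ∀ᶠ n in atTop, (A n * R n θ₀ * A n * R n θ₀).trace = ‖u‖ ^ 2 / 2 := by
    filter_upwards [hev] with n hn
    have hn0 : (0 : ℝ) < n := by exact_mod_cast hn.1
    have hs : √(n : ℝ) * √(n : ℝ) = n := Real.mul_self_sqrt hn0.le
    have hs0 : √(n : ℝ) ≠ 0 := (Real.sqrt_pos.2 hn0).ne'
    have h1 := fisher_quadForm (R n θ₀) (D n) (v n).ofLp
    rw [hvM n hn] at h1
    have hu := isUnit_det_of_posDef (h.posDef n θ₀ h.mem)
    have h2 : A n * R n θ₀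
        = (1 / (2 * √(n : ℝ))) • ((R n θ₀)⁻¹ * dirDeriv (D n) (v n).ofLp) := by
      rw [hA, Matrix.smul_mul, Matrix.mul_assoc _ _ (R n θ₀), nonsing_inv_mul _ hu, Matrix.mul_one]
    rw [Matrix.mul_assoc (A n * R n θ₀), h2, Matrix.smul_mul, Matrix.mul_smul, trace_smul,
      trace_smul, smul_eq_mul, smul_eq_mul, ← Matrix.mul_assoc, h1, ← hs]
    field_simp
    norm_num
  -- ‖v n‖ stays bounded since M_n ≥ m, so ‖A n‖ = O(n^{-1/2}): no single chi-square dominates.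
  have hb : Tendsto (fun n => ‖A n‖ * ‖R n θ₀‖) atTop (𝓝 0) := by
    set B : ℝ := C * (p * C * (‖u‖ / √m)) * C * C with hB
    have hlim : Tendsto (fun n : ℕ => B / (2 * √(n : ℝ))) atTop (𝓝 0) :=
      Tendsto.const_div_atTop (Tendsto.const_mul_atTop two_pos
        (Real.tendsto_sqrt_atTop.comp tendsto_natCast_atTop_atTop)) _
    refine squeeze_zero' (Eventually.of_forall fun n => by positivity) ?_ hlim
    filter_upwards [hev] with n hn
    have h1 : ‖(R n θ₀)⁻¹ * dirDeriv (D n) (v n).ofLp * (R n θ₀)⁻¹‖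
        ≤ C * (p * C * (‖u‖ / √m)) * C := by
      refine norm_mul_le_of_le' (norm_mul_le_of_le' (h.norm_inv_le n θ₀ h.mem) ?_)
        (h.norm_inv_le n θ₀ h.mem)
      refine (norm_dirDeriv_le (h.norm_deriv_le n) (v n)).trans ?_
      have := hvn n hn
      gcongr
    have h2 : ‖A n‖ ≤ 1 / (2 * √(n : ℝ)) * (C * (p * C * (‖u‖ / √m)) * C) := by
      rw [hA, norm_smul, Real.norm_of_nonneg (by positivity)]
      gcongr
    calc ‖A n‖ * ‖R n θ₀‖ ≤ 1 / (2 * √(n : ℝ)) * (C * (p * C * (‖u‖ / √m)) * C) * C :=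
          mul_le_mul h2 (h.norm_le n θ₀ h.mem) (norm_nonneg _) (by positivity)
      _ = B / (2 * √(n : ℝ)) := by rw [hB]; ring
  have key := tendsto_integral_exp_quadForm hy (fun n => (h.posDef n θ₀ h.mem).posSemidef)
    hAherm hσ hb
  have e : charFun (stdGaussian (EuclideanSpace ℝ (Fin p))) u
      = Complex.exp (-((‖u‖ ^ 2 / 2 : ℝ) : ℂ)) := by
    rw [charFun_stdGaussian]
    congr 1
    push_cast
    ring
  simp only [ProbabilityMeasure.coe_mk, Measure.map_id, e]
  refine key.congr' ?_
  filter_upwards [hev] with n hn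
  rw [charFun_apply, integral_map (hmeas n) (by fun_prop)]
  refine integral_congr_ae (Eventually.of_forall fun ω => ?_)
  simp only
  rw [inner_toEuclideanLin_oneStep hn.1 hn.2.2.2.1]

/-- Asymptotic normality of the maximum likelihood estimator in a regular model. -/
theorem tendstoInDistribution_mle (h : RegularModel Θ θ₀ R D D₂ C)
    (hy : ∀ n, IsCenteredGaussian (y n) P (R n θ₀))
    {θhat : ℕ → Ω → EuclideanSpace ℝ (Fin p)} (hmeas : ∀ n, AEMeasurable (θhat n) P)
    (hmem : ∀ n, 1 ≤ n → ∀ᵐ ω ∂P, θhat n ω ∈ Θ)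
    (hmin : ∀ n, 1 ≤ n → ∀ᵐ ω ∂P, ∀ θ ∈ Θ, nll (R n (θhat n ω)) (y n ω) ≤ nll (R n θ) (y n ω))
    {N : ℕ → Matrix (Fin p) (Fin p) ℝ} (hN : ∀ᶠ n : ℕ in atTop, (fisher (R n θ₀) (D n)).PosDef →
      (N n).IsHermitian ∧ N n * N n = fisher (R n θ₀) (D n)) :
    TendstoInDistribution (fun (n : ℕ) ω => √(n : ℝ) • Matrix.toEuclideanLin (N n)
      (θhat n ω - θ₀)) atTop
      (id : EuclideanSpace ℝ (Fin p) → EuclideanSpace ℝ (Fin p))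
      (fun _ => P) (stdGaussian (EuclideanSpace ℝ (Fin p))) := by
  -- Slutsky's lemma.
  refine tendstoInDistribution_of_tendstoInMeasure_sub _ _
    (h.tendstoInDistribution_oneStep hy hN) ?_ fun n =>
      AEMeasurable.fun_const_smul ((continuous_toEuclideanLin (N n)).measurable.comp_aemeasurable
        ((hmeas n).sub_const _)) _
  have := h.tendstoInMeasure_sub_oneStep hy hmem hmin hN
  simp only [map_sub, smul_sub] at this ⊢
  exact this

end RegularModel

end AsymptoticNormality

/-! ### Finite-dimensional marginals of the process. -/

section FiniteMarginals

theorem IsCenteredGP.isCenteredGaussian {H Ω : Type*} [MeasurableSpace Ω] {Y : H → Ω → ℝ}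
    {P : Measure Ω} {C : H → H → ℝ} (hY : IsCenteredGP Y P C) {ι : Type*} [Fintype ι]
    [DecidableEq ι] (x : ι → H) :
    IsCenteredGaussian (fun ω i => Y (x i) ω) P (Matrix.of fun i j => C (x i) (x j)) where
  gaussian := by
    have h1 := (hY.gaussian.comp_right x).hasGaussianLaw Finset.univ
    exact h1.map_fun (ContinuousLinearMap.pi fun i : ι =>
      ContinuousLinearMap.proj (R := ℝ) (φ := fun _ : (Finset.univ : Finset ι) => ℝ)
        ⟨i, Finset.mem_univ i⟩)
  mean i := hY.mean (x i)
  covariance i j := hY.covariance (x i) (x j)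

end FiniteMarginals

end GPML

/-- Asymptotic normality of the maximum likelihood estimator. -/
theorem theorem2
    -- a real or complex separable Hilbert space with an orthonormal basis `e`
    {𝕜 H : Type*} [RCLike 𝕜] [NormedAddCommGroup H] [InnerProductSpace 𝕜 H] [CompleteSpace H]
    {N : ℕ∞} (e : HilbertBasis (GPML.BasisIndex N) 𝕜 H)
    -- the parameter set and the true parameter
    {p : ℕ} (hp : 0 < p) (Θ : Set (EuclideanSpace ℝ (Fin p))) (hΘ : IsCompact Θ)
    (θ₀ : EuclideanSpace ℝ (Fin p)) (hθ₀ : θ₀ ∈ interior Θ)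
    -- the stationary family of covariance functions `K_θ(g, h) = k_θ(g - h)`
    (K : EuclideanSpace ℝ (Fin p) → H → H → ℝ) (k : EuclideanSpace ℝ (Fin p) → H → ℝ)
    (hK : ∀ θ ∈ Θ, GPML.IsCovarianceFunction (K θ))
    (hstat : ∀ θ ∈ Θ, ∀ g h, K θ g h = k θ (g - h))
    -- the design: separation, coordinate bounds, approximation order `d₀`
    (f : (n : ℕ) → Fin n → H)
    (Δ : ℝ) (hΔ : 0 < Δ) (hsep : GPML.Separated f Δ)
    (J₀ : ℕ) (s : ℕ → ℝ) (hcoord : GPML.UniformCoordinateBound e f J₀ s)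
    (d₀ : ℕ) (hd₀ : GPML.IsApproximationOrder e f Δ J₀ s d₀)
    -- decay of the kernels; `finrank ℝ 𝕜 * d₀` is the number of real coordinates of a truncated
    -- input, namely `d₀` if `𝕜 = ℝ` and `2 * d₀` if `𝕜 = ℂ`
    (γ₀ : ℝ) (hγ₀ : ((Module.finrank ℝ 𝕜 * d₀ : ℕ) : ℝ) < γ₀)
    (hdecay : GPML.DecaysUniformly k Θ γ₀)
    -- eigenvalues of the covariance matrices bounded away from zero
    (c : ℝ) (hc : 0 < c) (hmin : ∀ θ ∈ Θ, ∀ n, (c : EReal) ≤ GPML.lambdaMin (GPML.covMatrix K f n θ))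
    -- separation of the covariance parameters, asymptotic independence of the derivatives
    (hident : GPML.AsymptoticallySeparates K f Θ θ₀)
    (hindep : GPML.AsymptoticallyIndependentDerivatives K f θ₀)
    -- the derivatives in `θ` exist on an open set `U` containing `Θ`; `V` contains the segments
    -- between nearby points of `Θ` (one may take `V = Θ` if `Θ` is convex, or `V = U`)
    (U V : Set (EuclideanSpace ℝ (Fin p))) (hU : IsOpen U) (hVU : V ⊆ U)
    (hV : ∃ δ : ℝ, 0 < δ ∧ ∀ θ ∈ Θ, ∀ θ' ∈ Θ, dist θ θ' < δ → segment ℝ θ θ' ⊆ V)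
    -- first-order regularity
    (hC1 : ∀ h : H, ContDiffOn ℝ 1 (fun θ => k θ h) U)
    (γ₁ : ℝ) (hγ₁ : ((Module.finrank ℝ 𝕜 * d₀ : ℕ) : ℝ) < γ₁)
    (hdecay1 : ∀ i, GPML.DecaysUniformly (fun θ h => GPML.pderiv i (fun θ' => k θ' h) θ) V γ₁)
    -- second- and third-order regularity
    (hC3 : ∀ h : H, ContDiffOn ℝ 3 (fun θ => k θ h) U)
    (γ₂ : ℝ) (hγ₂ : ((Module.finrank ℝ 𝕜 * d₀ : ℕ) : ℝ) < γ₂)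
    (hdecay2 : ∀ i j, GPML.DecaysUniformly
      (fun θ h => GPML.pderiv i (GPML.pderiv j (fun θ' => k θ' h)) θ) Θ γ₂)
    (hdecay3 : ∀ i j l, GPML.DecaysUniformly
      (fun θ h => GPML.pderiv i (GPML.pderiv j (GPML.pderiv l (fun θ' => k θ' h))) θ) Θ γ₂)
    -- the Gaussian process and the maximum likelihood estimator
    {Ω : Type*} [MeasurableSpace Ω] (P : Measure Ω) [IsProbabilityMeasure P]
    (Y : H → Ω → ℝ) (hY : GPML.IsCenteredGP Y P (K θ₀))
    (θhat : ℕ → Ω → EuclideanSpace ℝ (Fin p)) (hθhat : GPML.IsMLE K f Y P Θ θhat) :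
    -- `√n M_n^{1/2} (θhat_n - θ₀)` converges in law to `N(0, I_p)`
    TendstoInDistribution
      (fun (n : ℕ) ω => √(n : ℝ) •
        Matrix.toEuclideanLin (cfc Real.sqrt (GPML.infoMatrix K f θ₀ n)) (θhat n ω - θ₀))
      atTop (id : EuclideanSpace ℝ (Fin p) → EuclideanSpace ℝ (Fin p))
      (fun _ => P) (stdGaussian (EuclideanSpace ℝ (Fin p)))
    ∧ (0 : EReal) < liminf (fun n => GPML.lambdaMin (GPML.infoMatrix K f θ₀ n)) atTop
    ∧ liminf (fun n => GPML.lambdaMin (GPML.infoMatrix K f θ₀ n)) atTop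
        ≤ limsup (fun n => GPML.lambdaMax (GPML.infoMatrix K f θ₀ n)) atTop
    ∧ limsup (fun n => GPML.lambdaMax (GPML.infoMatrix K f θ₀ n)) atTop < ⊤ := by
  obtain ⟨C, hreg⟩ := GPML.exists_regularModel e hΘ hθ₀ hK hstat hΔ hd₀.separated hγ₀ hdecay hc hmin
    hident hindep hU hVU hV hγ₁ hdecay1 hC3 hγ₂ hdecay2 hdecay3
  refine ⟨?_, hreg.lambda_bounds hp⟩
  -- `infoMatrix` and `negLogLik` agree by definition with `fisher` and `nll` for the covariance
  -- matrices and their derivatives.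
  refine hreg.tendstoInDistribution_mle (y := fun n ω i => Y (f n i) ω)
    (N := fun n => cfc Real.sqrt (GPML.infoMatrix K f θ₀ n))
    (fun n => hY.isCenteredGaussian (f n)) hθhat.aemeasurable hθhat.mem
    (fun n hn => ?_) (Eventually.of_forall fun n hpos => GPML.cfc_sqrt_spec hpos.posSemidef)
  filter_upwards [hθhat.isMinOn n hn] with ω hω θ hθ using hω hθ
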